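/- **Conventions.** Manifolds with corners are smooth, Hausdorff, second countable, locally modelled on $[0,\infty)^n$, possibly empty or disconnected, with all components of the same dimension. The geometric boundary $\partial P$ of an $n$-dimensional manifold with corners $P$ is the $(n-1)$-dimensional manifold with corners obtained by replacing each local model $[0,\infty)^n$ by the disjoint union of its $n$ faces $\{x_i=0\}$; it carries a natural map to $P$, and an orientation of $P$ induces one of $\partial P$ by the outward-normal-first convention. Let $M,N$ be smooth finite-dimensional paracompact Hausdorff manifolds without boundary. A *chain* of dimension $n$ in $M$ is a smooth map $\sigma:P\to M$ from a compact oriented $n$-dimensional manifold with corners $P$ (from a fixed universe of sets). Chains $\sigma:P\to M$ and $\tau:R\to M$ are *isomorphic* if $\tau\circ f=\sigma$ for some orientation-preserving diffeomorphism $f:P\to R$. Write $-\sigma$ for $\sigma$ with the opposite orientation of its domain, $\sigma\sqcup\tau$ for the disjoint union, and $\partial\sigma:\partial P\to P\to M$ for the boundary (empty if $n=0$). A chain $\sigma$ is *trivial* if $\sigma\circ f=\sigma$ for some orientation-reversing diffeomorphism $f:P\to P$; it has *small image* if it is empty or $\sigma(P)\subseteq g(T)$ for some smooth map $g:T\to M$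 from a (possibly non-compact) manifold with corners with $\dim T<\dim P$; it is *degenerate* if it has small image and $\partial\sigma$ is isomorphic to a disjoint union of a trivial chain and a chain with small image. Let $Q(M)$ be the set of chains isomorphic to $\alpha\sqcup\beta$ with $\alpha$ trivial and $\beta$ degenerate, put $\sigma\sim\tau$ if $\sigma\sqcup-\tau\in Q(M)$, and let $C_n(M)$ be the set of $n$-dimensional chains modulo $\sim$. **Theorem.** 1. Every chain of positive dimension has a boundary chain, unique up to isomorphism. The sets $C_n(M)$ are abelian groups with addition $[\sigma]+[\tau]=[\sigma\sqcup\tau]$, and $\partial[\sigma]=[\partial\sigma]$ makes $C_*(M)$ a chain complex. A smooth map $f:M\to N$ induces a chain map $f_*:C_*(M)\to C_*(N)$, $f_*[\sigma]=[f\circ\sigma]$, and $M\mapsto C_*(M)$, $f\mapsto f_*$ is a functor from smooth manifolds and smooth maps to chain complexes of abelian groups. 2. Let $F:M\times[0,1]\to N$ be a smooth homotopy and $F_t=F(\cdot,t)$. For a chain $\sigma:P\to M$ let $H(\sigma):P\times[0,1]\to N$ be the chain $H(\sigma)(p,t)=F(\sigma(p),t)$, where $P\times[0,1]$ has the product orientation.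 Then, up to isomorphism of chains, $$\partial H(\sigma)=(-1)^{\dim P}\bigl(F_1\circ\sigma\;\sqcup\;-(F_0\circ\sigma)\bigr)\;\sqcup\;H(\partial\sigma)$$ (the last term being absent if $\dim P=0$). 3. $H$ descends to homomorphisms $C_n(M)\to C_{n+1}(N)$, and the homomorphisms $h_n[\sigma]=(-1)^n[H(\sigma)]$ form a chain homotopy from $(F_1)_*$ to $(F_0)_*$: $\partial h_n+h_{n-1}\partial=(F_1)_*-(F_0)_*$. In particular $(F_0)_*$ and $(F_1)_*$ are chain homotopic. -/

import Mathlib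

open CategoryTheory
open scoped Manifold ContDiff Topology

universe u

noncomputable section

namespace GeomHomology

open Set Filter

/-! ### Manifolds with corners and their orientations -/

/-- The model for `n`-dimensional manifolds with corners: the quadrant `[0,∞)ⁿ` in `ℝⁿ`. -/
abbrev Q (n : ℕ) : ModelWithCorners ℝ (EuclideanSpace ℝ (Fin n)) (EuclideanQuadrant n) :=
  modelWithCornersEuclideanQuadrant n

section Orientation

variable {n : ℕ} {P R : Type} [TopologicalSpace P] [ChartedSpace (EuclideanQuadrant n) P]
  [IsManifold (Q n) 1 P] [TopologicalSpace R] [ChartedSpace (EuclideanQuadrant n) R]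
  [IsManifold (Q n) 1 R]

/-- The identification of the tangent space at `y` with `ℝⁿ` given by the local trivialization of the
tangent bundle around `x`. -/
def tangentTriv (x y : P) (hy : y ∈ (trivializationAt (EuclideanSpace ℝ (Fin n))
      (TangentSpace (Q n) : P → Type) x).baseSet) :
    TangentSpace (Q n) y ≃ₗ[ℝ] EuclideanSpace ℝ (Fin n) :=
  ((trivializationAt (EuclideanSpace ℝ (Fin n))
    (TangentSpace (Q n) : P → Type) x).continuousLinearEquivAt ℝ y hy).toLinearEquiv

/-- A field `o` of orientations of the tangent spaces is an orientation of `P` if it is locally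
constant in the local trivializations of the tangent bundle. (An orientation of the interior of `P`
extends uniquely to the boundary points in this way, so this is the same thing as an orientation of
the interior. For `n = 0` it is a choice of a sign at each point.) -/
def IsOrientationField (o : ∀ p : P, Orientation ℝ (TangentSpace (Q n) p) (Fin n)) : Prop :=
  ∀ x : P, ∃ c : Orientation ℝ (EuclideanSpace ℝ (Fin n)) (Fin n), ∀ᶠ y in 𝓝 x,
    ∀ hy, Orientation.map (Fin n) (tangentTriv x y hy) (o y) = c

theorem tangentTriv_apply (x y : P) (hy) (v : TangentSpace (Q n) y) :
    tangentTriv x y hy v = tangentCoordChange (Q n) y x y v := by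
  have := TangentBundle.continuousLinearMapAt_trivializationAt_eq_core (I := Q n) (b₀ := x) hy
  rw [tangentCoordChange, ← this]
  exact congrFun (Bundle.Trivialization.coe_continuousLinearEquivAt_eq _ hy) v

theorem IsOrientationField.neg {o : ∀ p : P, Orientation ℝ (TangentSpace (Q n) p) (Fin n)}
    (ho : IsOrientationField o) : IsOrientationField fun p => -o p := by
  intro x
  obtain ⟨c, hc⟩ := ho x
  refine ⟨-c, hc.mono fun y h hy => ?_⟩
  rw [Orientation.map_neg, h hy]

/-- The orientation of a disjoint union; the tangent space of `P ⊕ R` at a point of a summand is, by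
definition, the tangent space of the summand. -/
def sumOrientation (o : ∀ p : P, Orientation ℝ (TangentSpace (Q n) p) (Fin n))
    (o' : ∀ p : R, Orientation ℝ (TangentSpace (Q n) p) (Fin n)) :
    ∀ p : P ⊕ R, Orientation ℝ (TangentSpace (Q n) p) (Fin n)
  | .inl p => o p
  | .inr p => o' p

theorem tangentCoordChange_inl (x y : P) :
    tangentCoordChange (Q n) (Sum.inl y : P ⊕ R) (Sum.inl x) (Sum.inl y) =
      tangentCoordChange (Q n) y x y := by
  have h : (extChartAt (Q n) (Sum.inl x : P ⊕ R)) ∘ (extChartAt (Q n) (Sum.inl y : P ⊕ R)).symm =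
      (extChartAt (Q n) x) ∘ (extChartAt (Q n) y).symm := by
    funext z
    simp only [extChartAt, ChartedSpace.sum_chartAt_inl, Function.comp_apply,
      OpenPartialHomeomorph.extend_coe, OpenPartialHomeomorph.extend_coe_symm,
      OpenPartialHomeomorph.lift_openEmbedding_symm,
      OpenPartialHomeomorph.lift_openEmbedding_apply]
  rw [tangentCoordChange_def, tangentCoordChange_def, h, extChartAt_inl_apply]

theorem tangentCoordChange_inr (x y : R) :
    tangentCoordChange (Q n) (Sum.inr y : P ⊕ R) (Sum.inr x) (Sum.inr y) =
      tangentCoordChange (Q n) y x y := by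
  have h : (extChartAt (Q n) (Sum.inr x : P ⊕ R)) ∘ (extChartAt (Q n) (Sum.inr y : P ⊕ R)).symm =
      (extChartAt (Q n) x) ∘ (extChartAt (Q n) y).symm := by
    funext z
    simp only [extChartAt, ChartedSpace.sum_chartAt_inr, Function.comp_apply,
      OpenPartialHomeomorph.extend_coe, OpenPartialHomeomorph.extend_coe_symm,
      OpenPartialHomeomorph.lift_openEmbedding_symm,
      OpenPartialHomeomorph.lift_openEmbedding_apply]
  rw [tangentCoordChange_def, tangentCoordChange_def, h, extChartAt_inr_apply]

theorem IsOrientationField.sum {o : ∀ p : P, Orientation ℝ (TangentSpace (Q n) p) (Fin n)}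
    {o' : ∀ p : R, Orientation ℝ (TangentSpace (Q n) p) (Fin n)}
    (ho : IsOrientationField o) (ho' : IsOrientationField o') :
    IsOrientationField (sumOrientation o o') := by
  rintro (x | x)
  · obtain ⟨c, hc⟩ := ho x
    refine ⟨c, ?_⟩
    rw [nhds_inl, eventually_map]
    have hx := (chartAt (EuclideanQuadrant n) x).open_source.mem_nhds
      (mem_chart_source (EuclideanQuadrant n) x)
    filter_upwards [hc, hx] with y h hy' hy
    rw [← h hy']
    have e : (tangentTriv (Sum.inl x : P ⊕ R) (Sum.inl y) hy : _ ≃ₗ[ℝ] _) =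
        tangentTriv x y hy' := by
      refine LinearEquiv.ext fun v => ?_
      exact (tangentTriv_apply _ _ hy v).trans
        ((DFunLike.congr_fun (tangentCoordChange_inl x y) v).trans
          (tangentTriv_apply x y hy' v).symm)
    exact congrArg (fun f => Orientation.map (Fin n) f (o y)) e
  · obtain ⟨c, hc⟩ := ho' x
    refine ⟨c, ?_⟩
    rw [nhds_inr, eventually_map]
    have hx := (chartAt (EuclideanQuadrant n) x).open_source.mem_nhds
      (mem_chart_source (EuclideanQuadrant n) x)
    filter_upwards [hc, hx] with y h hy' hy
    rw [← h hy']
    have e : (tangentTriv (Sum.inr x : P ⊕ R) (Sum.inr y) hy : _ ≃ₗ[ℝ] _) =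
        tangentTriv x y hy' := by
      refine LinearEquiv.ext fun v => ?_
      exact (tangentTriv_apply _ _ hy v).trans
        ((DFunLike.congr_fun (tangentCoordChange_inr x y) v).trans
          (tangentTriv_apply x y hy' v).symm)
    exact congrArg (fun f => Orientation.map (Fin n) f (o' y)) e

end Orientation
/-- A smooth `n`-dimensional manifold with corners: Hausdorff, second countable, locally modelled on
`[0,∞)ⁿ`. It may be empty or disconnected; all its components have dimension `n`. -/
structure CornerMfd (n : ℕ) : Type 1 where
  carrier : Type
  [top : TopologicalSpace carrier]
  [t2 : T2Space carrier]
  [secondCountable : SecondCountableTopology carrier]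
  [charted : ChartedSpace (EuclideanQuadrant n) carrier]
  [isManifold : IsManifold (Q n) ∞ carrier]

instance (n : ℕ) : CoeSort (CornerMfd n) Type := ⟨CornerMfd.carrier⟩

attribute [instance] CornerMfd.top CornerMfd.t2 CornerMfd.secondCountable CornerMfd.charted
  CornerMfd.isManifold

instance {n : ℕ} (P : CornerMfd n) : IsManifold (Q n) 1 P :=
  IsManifold.of_le (n := ∞) (by simp)

/-- A field of orientations of the tangent spaces of `P`. -/
abbrev OrientationField {n : ℕ} (P : CornerMfd n) : Type :=
  ∀ p : P, Orientation ℝ (TangentSpace (Q n) p) (Fin n)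

/-- The diffeomorphism `f` carries the orientation `o` to the orientation `o'`. -/
def PreservesOrientation {n : ℕ} {P R : CornerMfd n} (f : P ≃ₘ⟮Q n, Q n⟯ R)
    (o : OrientationField P) (o' : OrientationField R) : Prop :=
  ∀ p, Orientation.map (Fin n)
    (f.mfderivToContinuousLinearEquiv (by simp) p).toLinearEquiv (o p) = o' (f p)

/-- The diffeomorphism `f` carries the orientation `o` to the opposite of the orientation `o'`. -/
def ReversesOrientation {n : ℕ} {P R : CornerMfd n} (f : P ≃ₘ⟮Q n, Q n⟯ R)
    (o : OrientationField P) (o' : OrientationField R) : Prop :=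
  ∀ p, Orientation.map (Fin n)
    (f.mfderivToContinuousLinearEquiv (by simp) p).toLinearEquiv (o p) = -o' (f p)

/-! ### The geometric boundary of a manifold with corners

The boundary of `P` is the manifold with corners obtained by replacing each local model `[0,∞)ⁿ⁺¹` by
the disjoint union of its `n + 1` faces `{xᵢ = 0}`. It maps to `P`, but a point of `P` that lies on
`k` local faces has `k` preimages. -/

/-- For `ι : B → P`, a point `b : B` and a chart `e` of `P` around `ι b`: near `b`, the map `ι` takes
values in the face `{xᵢ = 0}` of the chart `e`. -/
def LiesOnFace {n : ℕ} {B : CornerMfd n} {P : CornerMfd (n + 1)} (ι : B → P) (b : B)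
    (e : OpenPartialHomeomorph P (EuclideanQuadrant (n + 1))) (i : Fin (n + 1)) : Prop :=
  ∀ᶠ b' in 𝓝 b, (e (ι b')).1 i = 0

/-- `ι : B → P` exhibits `B` as the geometric boundary of `P`: in suitable charts `ι` is locally the
inclusion of a face of the quadrant (insertion of a zero at the `i`-th place), and for every chart
`e` of `P` around a point `p`, each of the faces `{xᵢ = 0}` of `e` through `p` is the face of exactly
one point of `B` over `p`. This determines `B` up to a unique diffeomorphism over `P`. -/
structure IsGeometricBoundary {n : ℕ} {B : CornerMfd n} {P : CornerMfd (n + 1)} (ι : B → P) :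
    Prop where
  locally_face : ∀ b : B, ∃ ψ ∈ IsManifold.maximalAtlas (Q n) ∞ B,
    ∃ e ∈ IsManifold.maximalAtlas (Q (n + 1)) ∞ P, ∃ i : Fin (n + 1),
      b ∈ ψ.source ∧ ∀ b' ∈ ψ.source, ι b' ∈ e.source ∧
        (e (ι b')).1 i = 0 ∧ ∀ j : Fin n, (e (ι b')).1 (i.succAbove j) = (ψ b').1 j
  existsUnique_face : ∀ e ∈ IsManifold.maximalAtlas (Q (n + 1)) ∞ P, ∀ p ∈ e.source,
    ∀ i : Fin (n + 1), (e p).1 i = 0 → ∃! b : B, ι b = p ∧ LiesOnFace ι b e i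

/-- The `i`-th component in the chart `e` of a tangent vector `ν` at `p`. -/
def chartComponent {n : ℕ} {P : CornerMfd n} (e : OpenPartialHomeomorph P (EuclideanQuadrant n))
    (i : Fin n) (p : P) (ν : TangentSpace (Q n) p) : ℝ :=
  mfderiv (Q n) 𝓘(ℝ) (fun x => (e x).1 i) p ν

/-- The tangent vector `ν` of `P` at `ι b` points out of `P` through the local face `b`: in a chart
where this face is `{xᵢ = 0}`, the `i`-th component of `ν` is negative. -/
def IsOutward {n : ℕ} {B : CornerMfd n} {P : CornerMfd (n + 1)} (ι : B → P) (b : B)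
    (ν : TangentSpace (Q (n + 1)) (ι b)) : Prop :=
  ∃ e ∈ IsManifold.maximalAtlas (Q (n + 1)) ∞ P, ι b ∈ e.source ∧ ∃ i : Fin (n + 1),
    LiesOnFace ι b e i ∧
      chartComponent e i (ι b) ν < 0

/-- The orientation `o'` of the boundary is induced by `o` with the outward-normal-first convention:
for `ν` outward, a basis `v` of the tangent space of the boundary is positive if and only if the
basis `(ν, v)` of the tangent space of `P` is positive. -/
def IsBoundaryOrientation {n : ℕ} {B : CornerMfd n} {P : CornerMfd (n + 1)} (ι : B → P)
    (o : OrientationField P) (o' : OrientationField B) : Prop :=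
  ∀ (b : B) (ν : TangentSpace (Q (n + 1)) (ι b)), IsOutward ι b ν →
    ∀ v : Module.Basis (Fin n) ℝ (TangentSpace (Q n) b),
      ∃ w : Module.Basis (Fin (n + 1)) ℝ (TangentSpace (Q (n + 1)) (ι b)),
        w 0 = ν ∧ (∀ j : Fin n, w j.succ = mfderiv (Q n) (Q (n + 1)) ι b (v j)) ∧
          (w.orientation = o (ι b) ↔ v.orientation = o' b)

/-! ### The category of smooth manifolds -/

/-- A smooth finite-dimensional (Hausdorff, paracompact) manifold without boundary. -/
structure SmoothMfd : Type (u + 1) where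
  dim : ℕ
  carrier : Type u
  [top : TopologicalSpace carrier]
  [t2 : T2Space carrier]
  [paracompact : ParacompactSpace carrier]
  [charted : ChartedSpace (EuclideanSpace ℝ (Fin dim)) carrier]
  [isManifold : IsManifold (𝓡 dim) ∞ carrier]

instance : CoeSort SmoothMfd.{u} (Type u) := ⟨SmoothMfd.carrier⟩

attribute [instance] SmoothMfd.top SmoothMfd.t2 SmoothMfd.paracompact SmoothMfd.charted
  SmoothMfd.isManifold

/-- Smooth maps between smooth manifolds. -/
abbrev SmoothMap (M N : SmoothMfd.{u}) : Type u := C^∞⟮𝓡 M.dim, M; 𝓡 N.dim, N⟯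

/-- The category of smooth manifolds and smooth maps. -/
instance : Category SmoothMfd.{u} where
  Hom M N := SmoothMap M N
  id _ := ContMDiffMap.id
  comp f g := ContMDiffMap.comp g f

/-- A smooth homotopy: a smooth map `M × [0,1] → N`. -/
abbrev SmoothHomotopy (M N : SmoothMfd.{u}) : Type u :=
  C^∞⟮(𝓡 M.dim).prod (𝓡∂ 1), M × Icc (0 : ℝ) 1; 𝓡 N.dim, N⟯

/-- The smooth map `F(·, t) : M → N`. -/
def SmoothHomotopy.slice {M N : SmoothMfd.{u}} (F : SmoothHomotopy M N) (t : Icc (0 : ℝ) 1) :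
    M ⟶ N :=
  (⟨fun x => F (x, t), F.contMDiff.comp (contMDiff_id.prodMk contMDiff_const)⟩ : SmoothMap M N)

/-! ### Chains -/

/-- A chain of dimension `n` in `M`: a smooth map to `M` from a compact oriented `n`-dimensional
manifold with corners. -/
structure GeomChain (n : ℕ) (M : SmoothMfd.{u}) where
  dom : CornerMfd n
  [compact : CompactSpace dom]
  orient : OrientationField dom
  isOrientation : IsOrientationField orient
  map : dom → M
  smooth : ContMDiff (Q n) (𝓡 M.dim) ∞ map

attribute [instance] GeomChain.compact

namespace GeomChain

variable {n : ℕ} {M N : SmoothMfd.{u}}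

/-- Chains are isomorphic if they differ by an orientation preserving diffeomorphism of domains. -/
def Isomorphic (σ τ : GeomChain n M) : Prop :=
  ∃ f : σ.dom ≃ₘ⟮Q n, Q n⟯ τ.dom,
    PreservesOrientation f σ.orient τ.orient ∧ ∀ p, τ.map (f p) = σ.map p

/-- The chain `-σ`: the same map with the opposite orientation of the domain. -/
def neg (σ : GeomChain n M) : GeomChain n M where
  dom := σ.dom
  orient p := -σ.orient p
  isOrientation := σ.isOrientation.neg
  map := σ.map
  smooth := σ.smooth

/-- The disjoint union `σ ⊔ τ` of chains. -/
def sum (σ τ : GeomChain n M) : GeomChain n M where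
  dom := { carrier := σ.dom ⊕ τ.dom }
  compact := inferInstanceAs (CompactSpace (σ.dom ⊕ τ.dom))
  orient := sumOrientation σ.orient τ.orient
  isOrientation := σ.isOrientation.sum τ.isOrientation
  map := Sum.elim σ.map τ.map
  smooth := σ.smooth.sumElim τ.smooth

/-- The chain `(-1)ᵏ σ`. -/
def signPow (k : ℕ) (σ : GeomChain n M) : GeomChain n M :=
  if Even k then σ else σ.neg

/-- The chain `f ∘ σ`. -/
def push (f : SmoothMap M N) (σ : GeomChain n M) : GeomChain n N where
  dom := σ.dom
  orient := σ.orient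
  isOrientation := σ.isOrientation
  map p := f (σ.map p)
  smooth := f.contMDiff.comp σ.smooth

/-- `τ` is (a model of) the boundary chain `∂σ`: the domain of `τ` is the oriented geometric boundary
of the domain of `σ`, and `τ` is the restriction of `σ` to it. -/
def IsBoundary (σ : GeomChain (n + 1) M) (τ : GeomChain n M) : Prop :=
  ∃ ι : τ.dom → σ.dom, IsGeometricBoundary ι ∧ IsBoundaryOrientation ι σ.orient τ.orient ∧
    ∀ b, τ.map b = σ.map (ι b)

/-- A chain is trivial if it admits an orientation reversing automorphism. -/
def IsTrivial (σ : GeomChain n M) : Prop :=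
  ∃ f : σ.dom ≃ₘ⟮Q n, Q n⟯ σ.dom,
    ReversesOrientation f σ.orient σ.orient ∧ ∀ p, σ.map (f p) = σ.map p

/-- A chain has small image if its image is contained in the image of a smooth map from a (possibly
non-compact) manifold with corners of smaller dimension. The empty chain has small image in every
dimension. -/
def HasSmallImage (σ : GeomChain n M) : Prop :=
  IsEmpty σ.dom ∨ ∃ k < n, ∃ (T : CornerMfd k) (g : T → M),
    ContMDiff (Q k) (𝓡 M.dim) ∞ g ∧ range σ.map ⊆ range g

/-- A chain is degenerate if it has small image and its boundary is a disjoint union of a trivial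
chain and a chain with small image. (A chain of dimension `0` has empty boundary.) -/
def IsDegenerate : {n : ℕ} → GeomChain n M → Prop
  | 0, σ => σ.HasSmallImage
  | _ + 1, σ => σ.HasSmallImage ∧
      ∃ α β, IsTrivial α ∧ HasSmallImage β ∧ IsBoundary σ (α.sum β)

/-- The set `Q(M)` of chains isomorphic to a disjoint union of a trivial and a degenerate chain. -/
def IsNull (σ : GeomChain n M) : Prop :=
  ∃ α β : GeomChain n M, α.IsTrivial ∧ β.IsDegenerate ∧ σ.Isomorphic (α.sum β)

/-- The relation `σ ∼ τ` on chains: `σ ⊔ -τ` belongs to `Q(M)`. -/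
def Equivalent (σ τ : GeomChain n M) : Prop := (σ.sum τ.neg).IsNull

/-- `ρ` is (a model of) the chain `H(σ) : P × [0,1] → N`, `(p, t) ↦ F(σ(p), t)`, where `P` is the
domain of `σ` and `P × [0,1]` has the product orientation: a basis `(v, ∂ₜ)` is positive if and only
if the basis `v` of the tangent space of `P` is positive. -/
def IsCylinder (F : SmoothHomotopy M N) (σ : GeomChain n M) (ρ : GeomChain (n + 1) N) : Prop :=
  ∃ Φ : ρ.dom ≃ₘ⟮Q (n + 1), (Q n).prod (𝓡∂ 1)⟯ (σ.dom × Icc (0 : ℝ) 1),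
    (∀ r, ρ.map r = F (σ.map (Φ r).1, (Φ r).2)) ∧
    ∀ (r : ρ.dom) (v : Module.Basis (Fin n) ℝ (TangentSpace (Q n) (Φ r).1)),
      ∃ w : Module.Basis (Fin (n + 1)) ℝ (TangentSpace (Q (n + 1)) r),
        (∀ j : Fin n, mfderiv (Q (n + 1)) (Q n) (fun s => (Φ s).1) r (w j.castSucc) = v j ∧
          mfderiv (Q (n + 1)) 𝓘(ℝ) (fun s => ((Φ s).2 : ℝ)) r (w j.castSucc) = (0 : ℝ)) ∧
        mfderiv (Q (n + 1)) (Q n) (fun s => (Φ s).1) r (w (Fin.last n)) = 0 ∧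
        mfderiv (Q (n + 1)) 𝓘(ℝ) (fun s => ((Φ s).2 : ℝ)) r (w (Fin.last n)) = (1 : ℝ) ∧
        (w.orientation = ρ.orient r ↔ v.orientation = σ.orient (Φ r).1)

end GeomChain

/-- The set `Cₙ(M)` of chains of dimension `n` modulo the relation `∼`. -/
def GeomChainClass (n : ℕ) (M : SmoothMfd.{u}) : Type (max 1 u) :=
  Quot (GeomChain.Equivalent (n := n) (M := M))

/-- The class of a chain in `Cₙ(M)`. -/
def GeomChain.cls {n : ℕ} {M : SmoothMfd.{u}} (σ : GeomChain n M) : GeomChainClass n M :=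
  Quot.mk _ σ

end GeomHomology

end

open GeomHomology

/-!
The proof has a geometric part, about faces and orientations of manifolds with corners, and an
algebraic part, in the monoid of chains up to isomorphism.

*The boundary.* Let `p` lie in the domains of two charts. The transition map carries a quadrant to a
quadrant, so its derivative at `p` carries the orthant spanned at `p` by the first quadrant to the
one spanned by the second. A linear isomorphism of orthants permutes their facets
(`exists_coord_of_orthant`), so a face of the first chart through `p` is near `p` a face of the
second (`exists_sameFace`). Hence the pairs of a boundary point and a local face through it do not
depend on charts; they are the points of a manifold with corners `boundaryMfd` whose map to the
original manifold is a geometric boundary (`isGeometricBoundary_pt`), and every other geometric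
boundary is diffeomorphic to it over that map (`IsGeometricBoundary.exists_diffeomorph`). The
diffeomorphism preserves the boundary orientations, as these are determined by the face and the
outward normal; so boundary chains are unique up to isomorphism (`GeomChain.IsBoundary.isomorphic`).

*The boundary of the boundary* consists of the corners of codimension two with an ordering of their
two faces. Exchanging the two faces is an involution over the map to the original manifold, and it
reverses the orientation because it exchanges the two outward normals
(`carries_neg_of_oppositeCorner`). So `∂∂σ` is trivial (`GeomChain.IsBoundary.isTrivial`).

*Cancellation.* If `σ ⊔ τ` and `σ ⊔ υ` are isomorphic, so are `τ` and `υ`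
(`GeomChain.Isomorphic.sum_left_cancel`): send a point of `τ` through the isomorphism, and through
it again as long as it lands in `σ`. This stops since a compact manifold has finitely many components,
and inversion of the isomorphism gives the inverse map. So the isomorphism classes of chains form a
cancellative commutative monoid `IsoClass`, with additive operations `neg`, `bd`, `push` and `cyl`
(reversal, boundary, composition, and `H`). A trivial chain is a class fixed by `neg`. Then `∂` takes
null chains to null chains (`IsoClass.Null.bd`): for a degenerate `b` with `∂b = a' + b'`, where `a'`
is trivial and `b'` has small image, both `∂a' + ∂b' = ∂∂b` and `∂a'` are fixed by `neg`, so `∂b'`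
is fixed too by cancellation, and `b'` is degenerate.

*The homotopy.* The faces of `P × [0,1]` are two copies of `P` and the product `∂P × [0,1]`
(`isGeometricBoundary_cylinder`). Comparing the outward normals gives the signs
(`isBoundaryOrientation_cylinderEnd`, `isBoundaryOrientation_cylinderSide`), and with them the formula
for `∂H(σ)` (`GeomChain.IsCylinder.isBoundary_succ`). Small images are stable under finite unions and
under `H`, because a manifold with corners can be replaced by its product with `[0,1]`
(`exists_raise_dim`). By the formula `H` takes null chains to null chains (`IsoClass.Null.cyl`), so it
acts on classes, and the formula becomes the identity of a chain homotopy (`chainHomotopy`).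
-/

noncomputable section

namespace GeomHomology

open Set Filter

/-! ### The model quadrants -/

/-- The vector space on which `n`-dimensional manifolds with corners are modelled. -/
abbrev Vec (n : ℕ) : Type := EuclideanSpace ℝ (Fin n)

/-- The inclusion of the face `{xᵢ = 0}` of the quadrant. -/
def insertZero {n : ℕ} (i : Fin (n + 1)) (y : EuclideanQuadrant n) : EuclideanQuadrant (n + 1) :=
  ⟨WithLp.toLp 2 (i.insertNth (0 : ℝ) fun j => y.1 j), fun k => by
    rcases Fin.eq_self_or_eq_succAbove i k with rfl | ⟨j, rfl⟩
    · simp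
    · simpa using y.2 j⟩

/-- Forgetting the `i`-th coordinate. -/
def removeCoord {n : ℕ} (i : Fin (n + 1)) (x : EuclideanQuadrant (n + 1)) : EuclideanQuadrant n :=
  ⟨WithLp.toLp 2 fun j => x.1 (i.succAbove j), fun j => x.2 (i.succAbove j)⟩

@[simp] theorem insertZero_same {n : ℕ} (i : Fin (n + 1)) (y : EuclideanQuadrant n) :
    (insertZero i y).1 i = 0 := by simp [insertZero]

@[simp] theorem insertZero_succAbove {n : ℕ} (i : Fin (n + 1)) (y : EuclideanQuadrant n)
    (j : Fin n) : (insertZero i y).1 (i.succAbove j) = y.1 j := by simp [insertZero]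

@[simp] theorem removeCoord_apply {n : ℕ} (i : Fin (n + 1)) (x : EuclideanQuadrant (n + 1))
    (j : Fin n) : (removeCoord i x).1 j = x.1 (i.succAbove j) := rfl

theorem quadrant_ext {n : ℕ} {x y : EuclideanQuadrant n} (h : ∀ i, x.1 i = y.1 i) : x = y := by
  apply Subtype.ext
  ext i
  exact h i

@[simp] theorem removeCoord_insertZero {n : ℕ} (i : Fin (n + 1)) (y : EuclideanQuadrant n) :
    removeCoord i (insertZero i y) = y := quadrant_ext fun j => by simp

theorem insertZero_removeCoord {n : ℕ} {i : Fin (n + 1)} {x : EuclideanQuadrant (n + 1)}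
    (h : x.1 i = 0) : insertZero i (removeCoord i x) = x := quadrant_ext fun k => by
  rcases Fin.eq_self_or_eq_succAbove i k with rfl | ⟨j, rfl⟩
  · simp [h]
  · simp

section Smooth

variable {E H X : Type*} [NormedAddCommGroup E] [NormedSpace ℝ E] [TopologicalSpace H]
  {I : ModelWithCorners ℝ E H} [TopologicalSpace X] [ChartedSpace H X]

theorem contMDiffAt_quadrant {n : ℕ} {f : X → EuclideanQuadrant n} {x : X}
    (h : ContMDiffAt I 𝓘(ℝ, Vec n) ∞ (fun x => (f x).1) x) : ContMDiffAt I (Q n) ∞ f x := by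
  rw [contMDiffAt_iff_target]
  refine ⟨?_, ?_⟩
  · exact (Topology.IsInducing.subtypeVal.continuousAt_iff).2 h.continuousAt
  · exact h

theorem contMDiffAt_coords {n : ℕ} {f : X → EuclideanQuadrant n} {x : X}
    (h : ∀ i, ContMDiffAt I 𝓘(ℝ) ∞ (fun x => (f x).1 i) x) : ContMDiffAt I (Q n) ∞ f x := by
  apply contMDiffAt_quadrant
  have h1 : ContMDiffAt I 𝓘(ℝ, Fin n → ℝ) ∞ (fun x => WithLp.ofLp (f x).1) x :=
    contMDiffAt_pi_space.2 h
  exact ((PiLp.continuousLinearEquiv 2 ℝ fun _ : Fin n => ℝ).symm.contDiff.contMDiff _).comp x h1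

end Smooth

theorem contMDiff_coord {n : ℕ} (i : Fin n) :
    ContMDiff (Q n) 𝓘(ℝ) ∞ fun x : EuclideanQuadrant n => x.1 i :=
  ((PiLp.proj 2 (fun _ : Fin n => ℝ) i : Vec n →L[ℝ] ℝ).contMDiff).comp (Q n).contMDiff

theorem contMDiff_insertZero {n : ℕ} (i : Fin (n + 1)) :
    ContMDiff (Q n) (Q (n + 1)) ∞ (insertZero i) := by
  intro x
  apply contMDiffAt_coords
  intro k
  rcases Fin.eq_self_or_eq_succAbove i k with rfl | ⟨j, rfl⟩
  · simpa using contMDiffAt_const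
  · simpa using (contMDiff_coord j) x

theorem contMDiff_removeCoord {n : ℕ} (i : Fin (n + 1)) :
    ContMDiff (Q (n + 1)) (Q n) ∞ (removeCoord i) := by
  intro x
  apply contMDiffAt_coords
  intro j
  exact contMDiff_coord (i.succAbove j) x

theorem range_Q (n : ℕ) : range (Q n) = {x : Vec n | ∀ i, 0 ≤ x i} := range_euclideanQuadrant n

/-! ### Charts and their derivatives -/

/-- The maximal atlas of a manifold with corners. -/
abbrev maxAtlas {n : ℕ} (P : CornerMfd n) : Set (OpenPartialHomeomorph P (EuclideanQuadrant n)) :=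
  IsManifold.maximalAtlas (Q n) ∞ P

section Charts

variable {n : ℕ} {P : CornerMfd n} {e e' : OpenPartialHomeomorph P (EuclideanQuadrant n)} {p : P}

theorem chart_mem_maxAtlas (p : P) : chartAt (EuclideanQuadrant n) p ∈ maxAtlas P :=
  IsManifold.chart_mem_maximalAtlas p

theorem mdifferentiable_of_mem_maxAtlas (he : e ∈ maxAtlas P) : e.MDifferentiable (Q n) (Q n) :=
  ⟨(contMDiffOn_of_mem_maximalAtlas he).mdifferentiableOn (by simp),
    (contMDiffOn_symm_of_mem_maximalAtlas he).mdifferentiableOn (by simp)⟩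

/-- The derivative of a chart, as an identification of the tangent space with `ℝⁿ`. -/
def chartEquiv (he : e ∈ maxAtlas P) (hp : p ∈ e.source) : TangentSpace (Q n) p ≃L[ℝ] Vec n :=
  (mdifferentiable_of_mem_maxAtlas he).mfderiv hp

theorem chartEquiv_apply (he : e ∈ maxAtlas P) (hp : p ∈ e.source) (v : TangentSpace (Q n) p) :
    chartEquiv he hp v = mfderiv (Q n) (Q n) e p v := rfl

theorem hasMFDerivAt_chart_coe (he : e ∈ maxAtlas P) (hp : p ∈ e.source) :
    HasMFDerivAt (Q n) 𝓘(ℝ, Vec n) (fun q => (e q).1) p (chartEquiv he hp : _ →L[ℝ] Vec n) :=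
  ((Q n).hasMFDerivAt (x := e p)).comp p
    ((mdifferentiable_of_mem_maxAtlas he).mdifferentiableAt hp).hasMFDerivAt

theorem hasMFDerivAt_chart_coord (he : e ∈ maxAtlas P) (hp : p ∈ e.source) (i : Fin n) :
    HasMFDerivAt (Q n) 𝓘(ℝ) (fun q => (e q).1 i) p
      ((PiLp.proj 2 (fun _ : Fin n => ℝ) i : Vec n →L[ℝ] ℝ).comp
        (chartEquiv he hp : _ →L[ℝ] Vec n)) :=
  ((PiLp.proj 2 (fun _ : Fin n => ℝ) i : Vec n →L[ℝ] ℝ).hasMFDerivAt (x := (e p).1)).comp p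
    (hasMFDerivAt_chart_coe he hp)

theorem chartComponent_eq (he : e ∈ maxAtlas P) (hp : p ∈ e.source) (i : Fin n)
    (v : TangentSpace (Q n) p) : chartComponent e i p v = chartEquiv he hp v i := by
  rw [chartComponent, (hasMFDerivAt_chart_coord he hp i).mfderiv]
  rfl

/-- In a chart, a differentiable function `h` has the derivative `mfderiv h p ∘ (De)⁻¹`. -/
theorem exists_hasFDerivWithinAt_chart {F : Type*} [NormedAddCommGroup F] [NormedSpace ℝ F]
    {h : P → F} (he : e ∈ maxAtlas P) (hp : p ∈ e.source)
    (hh : MDifferentiableAt (Q n) 𝓘(ℝ, F) h p) :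
    ∃ D : Vec n →L[ℝ] F,
      HasFDerivWithinAt (fun x => h (e.symm ((Q n).symm x))) D (range (Q n)) (e p).1 ∧
      ∀ v, D (chartEquiv he hp v) = mfderiv (Q n) 𝓘(ℝ, F) h p v := by
  refine ⟨(mfderiv (Q n) 𝓘(ℝ, F) h p).comp ((chartEquiv he hp).symm : Vec n →L[ℝ] _),
    HasMFDerivWithinAt.hasFDerivWithinAt ?_, fun v => ?_⟩
  · have hx : (e p).1 ∈ range (Q n) := ⟨e p, rfl⟩
    have h1 := (Q n).hasMFDerivWithinAt_symm hx
    have hs : (Q n).symm (e p).1 = e p := (Q n).left_inv (e p)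
    have hd := ((mdifferentiable_of_mem_maxAtlas he).mdifferentiableAt_symm
      (e.map_source hp)).hasMFDerivAt
    have hl := e.left_inv hp
    have h2 : HasMFDerivAt (Q n) 𝓘(ℝ, F) h (e.symm (e p)) (mfderiv (Q n) 𝓘(ℝ, F) h p) := by
      rw [hl]; exact hh.hasMFDerivAt
    have h3 := (h2.comp (e p) hd)
    have h4 : ∀ y, y = e p → HasMFDerivAt (Q n) 𝓘(ℝ, F) (h ∘ e.symm) y
        (show Vec n →L[ℝ] F from (mfderiv (Q n) 𝓘(ℝ, F) h p).comp
          ((chartEquiv he hp).symm : Vec n →L[ℝ] _)) := by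
      rintro _ rfl
      exact h3
    exact (h4 _ hs).comp_hasMFDerivWithinAt _ h1
  · exact congrArg (mfderiv (Q n) 𝓘(ℝ, F) h p)
      ((chartEquiv he hp).symm_apply_apply v)

end Charts

/-! ### Local faces in different charts -/

/-- A linear automorphism that identifies two orthants `{v | ∀ k ∈ K, 0 ≤ vₖ}` matches their facets:
up to positive factors, it carries the coordinates in `K` to coordinates in `K'`. -/
theorem exists_coord_of_orthant {n : ℕ} (B : Vec n ≃ₗ[ℝ] Vec n) (K K' : Set (Fin n))
    (hB : ∀ v, (∀ k ∈ K, 0 ≤ v k) ↔ ∀ j ∈ K', 0 ≤ B v j) {i : Fin n} (hi : i ∈ K) :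
    ∃ j ∈ K', ∃ c : ℝ, 0 < c ∧ ∀ v, B v j = c * v i := by
  have hL : ∀ v, (∀ k ∈ K, v k = 0) ↔ ∀ j ∈ K', B v j = 0 := by
    intro v
    have h1 := hB v
    have h2 := hB (-v)
    simp only [map_neg, PiLp.neg_apply, Left.nonneg_neg_iff] at h2
    constructor
    · intro h j hj
      exact le_antisymm (h2.1 (fun k hk => (h k hk).le) j hj) (h1.1 (fun k hk => (h k hk).ge) j hj)
    · intro h j hj
      exact le_antisymm (h2.2 (fun k hk => (h k hk).le) j hj) (h1.2 (fun k hk => (h k hk).ge) j hj)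
  have hs : ∀ k l : Fin n, 0 ≤ (EuclideanSpace.single k (1 : ℝ) : Vec n) l := by
    intro k l
    by_cases h : l = k <;> simp [h]
  have hw : ∀ j ∈ K', 0 ≤ B (EuclideanSpace.single i 1) j := (hB _).1 fun k _ => hs i k
  obtain ⟨j, hj, hne⟩ : ∃ j ∈ K', B (EuclideanSpace.single i 1) j ≠ 0 := by
    by_contra! h
    have := (hL _).2 h i hi
    simp at this
  have hwj : 0 < B (EuclideanSpace.single i 1) j := lt_of_le_of_ne (hw j hj) hne.symm
  obtain ⟨u, hu⟩ := B.surjective (EuclideanSpace.single j 1)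
  have huC : ∀ k ∈ K, 0 ≤ u k := (hB u).2 fun l _ => by rw [hu]; exact hs j l
  -- subtracting its `j`-th component keeps a vector in the second orthant
  have hsub : ∀ v, (∀ k ∈ K, 0 ≤ v k) → ∀ k ∈ K, 0 ≤ v k - B v j * u k := by
    intro v hv
    have := (hB (v - B v j • u)).2 fun l hl => by
      by_cases h : l = j
      · subst h; simp [hu]
      · simpa [hu, h] using (hB v).1 hv l hl
    simpa using this
  have huk : ∀ k ∈ K, k ≠ i → u k = 0 := by
    intro k hk hki
    have h := hsub _ (fun l _ => hs i l) k hk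
    simp only [PiLp.single_apply, hki, if_false] at h
    nlinarith [huC k hk]
  have hui : 0 < u i := by
    refine lt_of_le_of_ne (huC i hi) fun h0 => ?_
    have := (hL u).1 (fun k hk => by
      by_cases h : k = i
      · rw [h, ← h0]
      · exact huk k hk h) j hj
    rw [hu] at this
    simp at this
  have hzero : ∀ k, k ≠ i → B (EuclideanSpace.single k 1) j = 0 := by
    intro k hk
    have h1 := (hB (EuclideanSpace.single k 1)).1 (fun l _ => hs k l) j hj
    have h2 := hsub _ (fun l _ => hs k l) i hi
    simp only [PiLp.single_apply, hk.symm, if_false] at h2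
    nlinarith
  refine ⟨j, hj, _, hwj, fun v => ?_⟩
  have hv : v = ∑ k, v k • (EuclideanSpace.single k (1 : ℝ) : Vec n) := by
    ext l
    simp [Pi.single_apply]
  conv_lhs => rw [hv]
  simp only [map_sum, map_smul, WithLp.ofLp_sum, Finset.sum_apply, PiLp.smul_apply, smul_eq_mul]
  rw [Finset.sum_eq_single i (fun k _ hk => by rw [hzero k hk, mul_zero]) (by simp), mul_comm]

section Faces

variable {n : ℕ} {P : CornerMfd n} {e e' e'' : OpenPartialHomeomorph P (EuclideanQuadrant n)} {p : P}

/-- A function that is minimal at `p` has nonnegative derivative along inward vectors. -/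
theorem mfderiv_nonneg_of_inward (he : e ∈ maxAtlas P) (hp : p ∈ e.source) {h : P → ℝ}
    (hd : MDifferentiableAt (Q n) 𝓘(ℝ) h p) (hmin : ∀ᶠ q in 𝓝 p, h p ≤ h q)
    {v : TangentSpace (Q n) p} (hv : ∀ k, (e p).1 k = 0 → 0 ≤ chartEquiv he hp v k) :
    (0 : ℝ) ≤ mfderiv (Q n) 𝓘(ℝ) h p v := by
  obtain ⟨D, hD, hDv⟩ := exists_hasFDerivWithinAt_chart he hp hd
  have hs : (Q n).symm (e p).1 = e p := (Q n).left_inv (e p)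
  have hmin' : IsLocalMinOn (fun x => h (e.symm ((Q n).symm x))) (range (Q n)) (e p).1 := by
    have hc : Tendsto (fun x => e.symm ((Q n).symm x)) (𝓝 (e p).1) (𝓝 p) := by
      have h1 : Tendsto (Q n).symm (𝓝 (e p).1) (𝓝 (e p)) := by
        have := (Q n).continuousAt_symm (x := (e p).1)
        rwa [ContinuousAt, hs] at this
      have h2 := (e.continuousAt_symm (e.map_source hp)).tendsto
      rw [e.left_inv hp] at h2
      exact h2.comp h1
    refine Filter.Eventually.filter_mono nhdsWithin_le_nhds ?_
    simp only [hs, e.left_inv hp]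
    exact hc.eventually hmin
  have hcone : chartEquiv he hp v ∈ posTangentConeAt (range (Q n)) (e p).1 := by
    refine mem_posTangentConeAt_of_frequently_mem (Eventually.frequently ?_)
    rw [range_Q]
    simp only [mem_ofPred_eq]
    rw [eventually_all]
    intro k
    rcases ((e p).2 k).eq_or_lt with h0 | h0
    · filter_upwards [self_mem_nhdsWithin] with t ht
      have := mul_nonneg (le_of_lt ht) (hv k h0.symm)
      simpa [← h0] using this
    · refine Eventually.filter_mono nhdsWithin_le_nhds ?_
      have hc : Tendsto (fun t : ℝ => ((e p).1 + t • chartEquiv he hp v) k) (𝓝 0)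
          (𝓝 ((e p).1 k)) := by
        have : Continuous fun t : ℝ => (e p).1 k + t * chartEquiv he hp v k := by fun_prop
        simpa using this.tendsto 0
      exact (hc.eventually (lt_mem_nhds h0)).mono fun t ht => ht.le
  rw [← hDv]
  exact hmin'.hasFDerivWithinAt_nonneg hD hcone

/-- At a point of the face `{xᵢ = 0}` of a chart, every other chart has a face with the same
conormal direction. -/
theorem exists_proportional_coord (he : e ∈ maxAtlas P) (he' : e' ∈ maxAtlas P) (hp : p ∈ e.source)
    (hp' : p ∈ e'.source) {i : Fin n} (hi : (e p).1 i = 0) :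
    ∃ j, (e' p).1 j = 0 ∧ ∃ c : ℝ, 0 < c ∧ ∀ v, chartEquiv he' hp' v j = c * chartEquiv he hp v i := by
  have key : ∀ {e e' : OpenPartialHomeomorph P (EuclideanQuadrant n)} (he : e ∈ maxAtlas P)
      (he' : e' ∈ maxAtlas P) (hp : p ∈ e.source) (hp' : p ∈ e'.source) (v : TangentSpace (Q n) p),
      (∀ k, (e p).1 k = 0 → 0 ≤ chartEquiv he hp v k) →
      ∀ j, (e' p).1 j = 0 → 0 ≤ chartEquiv he' hp' v j := by
    intro e e' he he' hp hp' v hv j hj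
    have hd := hasMFDerivAt_chart_coord he' hp' j
    have := mfderiv_nonneg_of_inward he hp hd.mdifferentiableAt
      (Eventually.of_forall fun q => by rw [hj]; exact (e' q).2 j) hv
    rwa [hd.mfderiv] at this
  obtain ⟨j, hj, c, hc, h⟩ := exists_coord_of_orthant
    ((chartEquiv he hp).symm.trans (chartEquiv he' hp')).toLinearEquiv {k | (e p).1 k = 0}
    {k | (e' p).1 k = 0} (fun v => by
      have h1 := key he he' hp hp' ((chartEquiv he hp).symm v)
      have h2 := key he' he hp' hp ((chartEquiv he hp).symm v)
      simp only [ContinuousLinearEquiv.apply_symm_apply] at h1 h2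
      exact ⟨h1, h2⟩) hi
  refine ⟨j, hj, c, hc, fun v => ?_⟩
  have := h (chartEquiv he hp v)
  simpa using this

/-- The derivative of a change of charts is continuous. -/
theorem exists_transition_deriv (he : e ∈ maxAtlas P) (he' : e' ∈ maxAtlas P) (hp : p ∈ e.source)
    (hp' : p ∈ e'.source) : ∃ G : P → Vec n →L[ℝ] Vec n, ContinuousAt G p ∧
      ∀ q (hq : q ∈ e.source) (hq' : q ∈ e'.source) (v : TangentSpace (Q n) q),
        chartEquiv he' hq' v = G q (chartEquiv he hq v) := by
  set S := ((Q n).extendCoordChange e e').source with hS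
  set φ := (Q n).extendCoordChange e e' with hφ
  have hSq : ∀ q, q ∈ e.source → q ∈ e'.source → (e q).1 ∈ S := by
    intro q hq hq'
    rw [hS, ← OpenPartialHomeomorph.extend_image_source_inter]
    exact mem_image_of_mem _ ⟨hq, hq'⟩
  have hSr : S ⊆ range (Q n) := by
    rw [hS, ModelWithCorners.extendCoordChange_source]
    exact image_subset_range _ _
  have hcd : ContDiffOn ℝ ∞ φ S := (Q n).contDiffOn_extendCoordChange he he'
  have hu : UniqueDiffOn ℝ S := (Q n).uniqueDiffOn_extendCoordChange_source
  have hcont := hcd.continuousOn_fderivWithin hu (by simp)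
  refine ⟨fun q => fderivWithin ℝ φ S (e q).1, ?_, fun q hq hq' v => ?_⟩
  · have h1 := hcont _ (hSq p hp hp')
    have h2 : ContinuousAt (fun q => (e q).1) p :=
      continuous_subtype_val.continuousAt.comp (e.continuousAt hp)
    refine ContinuousWithinAt.tendsto h1 |>.comp (tendsto_nhdsWithin_iff.2 ⟨h2, ?_⟩)
    filter_upwards [e.open_source.mem_nhds hp, e'.open_source.mem_nhds hp'] with q hq hq'
    exact hSq q hq hq'
  · have hd := hasMFDerivAt_chart_coe he' hq'
    obtain ⟨D, hD, hDv⟩ := exists_hasFDerivWithinAt_chart he hq hd.mdifferentiableAt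
    have h' : HasFDerivWithinAt φ D S (e q).1 := hD.mono hSr
    beta_reduce
    rw [h'.fderivWithin (hu _ (hSq q hq hq')), hDv, hd.mfderiv]
    rfl

/-- The faces `{xᵢ = 0}` of `e` and `{xⱼ = 0}` of `e'` agree near `p`. -/
def SameFace (e : OpenPartialHomeomorph P (EuclideanQuadrant n)) (i : Fin n)
    (e' : OpenPartialHomeomorph P (EuclideanQuadrant n)) (j : Fin n) (p : P) : Prop :=
  ∀ᶠ q in 𝓝 p, (e q).1 i = 0 ↔ (e' q).1 j = 0

theorem SameFace.refl (e : OpenPartialHomeomorph P (EuclideanQuadrant n)) (i : Fin n) (p : P) :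
    SameFace e i e i p := Eventually.of_forall fun _ => Iff.rfl

theorem SameFace.symm {i j : Fin n} (h : SameFace e i e' j p) : SameFace e' j e i p :=
  Eventually.mono h fun _ hq => hq.symm

theorem SameFace.trans {i j k : Fin n} (h : SameFace e i e' j p) (h' : SameFace e' j e'' k p) :
    SameFace e i e'' k p := by
  filter_upwards [h, h'] with q hq hq' using hq.trans hq'

theorem SameFace.zero_iff {i j : Fin n} (h : SameFace e i e' j p) :
    (e p).1 i = 0 ↔ (e' p).1 j = 0 := h.self_of_nhds

/-- Near every point of the face `{xᵢ = 0}` there are points on no other face. -/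
theorem eq_of_face_subset (hp : p ∈ e.source) {i j : Fin n} (hi : (e p).1 i = 0)
    (h : ∀ᶠ q in 𝓝 p, (e q).1 i = 0 → (e q).1 j = 0) : i = j := by
  by_contra hij
  let x : ℝ → EuclideanQuadrant n := fun t =>
    ⟨WithLp.toLp 2 fun k => if k = i then 0 else (e p).1 k + |t|, fun k => by
      by_cases hk : k = i
      · simp [hk]
      · simpa [hk] using add_nonneg ((e p).2 k) (abs_nonneg t)⟩
  have hx : Continuous x := by
    refine Continuous.subtype_mk ((PiLp.continuous_toLp 2 _).comp (continuous_pi fun k => ?_)) _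
    by_cases hk : k = i
    · simp only [hk, if_true]; exact continuous_const
    · simp only [hk, if_false]; fun_prop
  have hx0 : x 0 = e p := quadrant_ext fun k => by
    by_cases hk : k = i <;> simp [x, hk, hi]
  have ht : Tendsto (fun t => e.symm (x t)) (𝓝[>] 0) (𝓝 p) := by
    have h2 := (e.continuousAt_symm (e.map_source hp)).tendsto
    rw [e.left_inv hp, ← hx0] at h2
    exact (h2.comp hx.continuousAt.tendsto).mono_left nhdsWithin_le_nhds
  have hmem : ∀ᶠ t in 𝓝[>] (0 : ℝ), x t ∈ e.target := by
    refine Eventually.filter_mono nhdsWithin_le_nhds (hx.continuousAt.eventually ?_)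
    rw [hx0]
    exact e.open_target.mem_nhds (e.map_source hp)
  obtain ⟨t, ht1, ht2, ht3⟩ :=
    ((ht.eventually h).and (hmem.and self_mem_nhdsWithin)).exists
  rw [e.right_inv ht2] at ht1
  have h0 := ht1 (by simp [x])
  simp only [x, Ne.symm hij, if_false] at h0
  have h1 := (e p).2 j
  have h2 : (0 : ℝ) < |t| := abs_pos.2 (ne_of_gt ht3)
  linarith

theorem SameFace.unique {i j k : Fin n} (hp : p ∈ e'.source) (h : SameFace e i e' j p)
    (h' : SameFace e i e' k p) (hj : (e' p).1 j = 0) : j = k :=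
  eq_of_face_subset hp hj (Eventually.mono (h.symm.trans h') fun _ hq => hq.1)

theorem frequently_interior_face (hp : p ∈ e.source) (i : Fin n) :
    ¬ ∀ᶠ q in 𝓝 p, (e q).1 i = 0 := by
  intro h
  let x : ℝ → EuclideanQuadrant n := fun t =>
    ⟨WithLp.toLp 2 fun k => (e p).1 k + |t|, fun k => add_nonneg ((e p).2 k) (abs_nonneg t)⟩
  have hx : Continuous x := by
    refine Continuous.subtype_mk ((PiLp.continuous_toLp 2 _).comp (continuous_pi fun k => ?_)) _
    fun_prop
  have hx0 : x 0 = e p := quadrant_ext fun k => by simp [x]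
  have ht : Tendsto (fun t => e.symm (x t)) (𝓝[>] 0) (𝓝 p) := by
    have h2 := (e.continuousAt_symm (e.map_source hp)).tendsto
    rw [e.left_inv hp, ← hx0] at h2
    exact (h2.comp hx.continuousAt.tendsto).mono_left nhdsWithin_le_nhds
  have hmem : ∀ᶠ t in 𝓝[>] (0 : ℝ), x t ∈ e.target := by
    refine Eventually.filter_mono nhdsWithin_le_nhds (hx.continuousAt.eventually ?_)
    rw [hx0]
    exact e.open_target.mem_nhds (e.map_source hp)
  obtain ⟨t, ht1, ht2, ht3⟩ :=
    ((ht.eventually h).and (hmem.and self_mem_nhdsWithin)).exists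
  rw [e.right_inv ht2] at ht1
  have h1 := (e p).2 i
  have h2 : (0 : ℝ) < |t| := abs_pos.2 (ne_of_gt ht3)
  simp only [x] at ht1
  linarith

/-- One inclusion of `exists_sameFace`: at points `q` of the face near `p`, the conormal of the face
is proportional to some `d e'ⱼ`, and by continuity of the derivative of the change of charts `j`
is the index found at `p`. -/
theorem exists_face_subset (he : e ∈ maxAtlas P) (he' : e' ∈ maxAtlas P) (hp : p ∈ e.source)
    (hp' : p ∈ e'.source) {i : Fin n} (hi : (e p).1 i = 0) :
    ∃ j, ((e' p).1 j = 0 ∧ ∃ c : ℝ, 0 < c ∧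
        ∀ v, chartEquiv he' hp' v j = c * chartEquiv he hp v i) ∧
      ∀ᶠ q in 𝓝 p, (e q).1 i = 0 → (e' q).1 j = 0 := by
  obtain ⟨j, hj, c, hc, hcj⟩ := exists_proportional_coord he he' hp hp' hi
  refine ⟨j, ⟨hj, c, hc, hcj⟩, ?_⟩
  obtain ⟨G, hG, hGe⟩ := exists_transition_deriv he he' hp hp'
  -- near `p`, no coordinate of `e'` other than the `j`-th can be conormal to the face `{xᵢ = 0}`
  have key : ∀ l, l ≠ j → ∀ᶠ q in 𝓝 p, ∀ (hq : q ∈ e.source) (hq' : q ∈ e'.source),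
      (e' q).1 l = 0 → ¬ ∃ c : ℝ, 0 < c ∧
        ∀ v, chartEquiv he' hq' v l = c * chartEquiv he hq v i := by
    intro l hl
    by_cases hl0 : (e' p).1 l = 0
    · obtain ⟨k, hk, d, hd, hdk⟩ := exists_proportional_coord he' he hp' hp hl0
      have hki : k ≠ i := by
        rintro rfl
        -- otherwise the `l`-th and `j`-th coordinates of `e'` would be proportional
        have h1 := hcj ((chartEquiv he' hp').symm (EuclideanSpace.single j 1))
        have h2 := hdk ((chartEquiv he' hp').symm (EuclideanSpace.single j 1))
        simp [hl] at h1 h2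
        rw [h2] at h1
        simp at h1
      have hpos : 0 < G p (EuclideanSpace.single k 1) l := by
        have h1 := hdk ((chartEquiv he hp).symm (EuclideanSpace.single k 1))
        have h2 := hGe p hp hp' ((chartEquiv he hp).symm (EuclideanSpace.single k 1))
        simp only [ContinuousLinearEquiv.apply_symm_apply] at h1 h2
        rw [h2] at h1
        simp only [PiLp.single_apply, if_true] at h1
        by_contra hneg
        nlinarith
      have hGc : ContinuousAt (fun q => G q (EuclideanSpace.single k 1) l) p := by
        have h1 : ContinuousAt (fun q => G q (EuclideanSpace.single k (1 : ℝ) : Vec n)) p :=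
          hG.clm_apply continuousAt_const
        exact (PiLp.continuous_apply 2 _ l).continuousAt.comp h1
      filter_upwards [hGc.eventually (lt_mem_nhds hpos)] with q hq hqs hqs' _ ⟨c', _, h⟩
      have h2 := hGe q hqs hqs' ((chartEquiv he hqs).symm (EuclideanSpace.single k 1))
      have h1 := h ((chartEquiv he hqs).symm (EuclideanSpace.single k 1))
      rw [h2] at h1
      simp only [ContinuousLinearEquiv.apply_symm_apply, PiLp.single_apply, hki.symm,
        if_false, mul_zero] at h1
      rw [h1] at hq
      exact lt_irrefl _ hq
    · have hc : ContinuousAt (fun q => (e' q).1 l) p :=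
        (PiLp.continuous_apply 2 _ l).continuousAt.comp
          (continuous_subtype_val.continuousAt.comp (e'.continuousAt hp'))
      filter_upwards [hc.eventually_ne hl0] with q hq _ _ h0
      exact absurd h0 hq
  have key' : ∀ᶠ q in 𝓝 p, ∀ l, l ≠ j → ∀ (hq : q ∈ e.source) (hq' : q ∈ e'.source),
      (e' q).1 l = 0 → ¬ ∃ c : ℝ, 0 < c ∧
        ∀ v, chartEquiv he' hq' v l = c * chartEquiv he hq v i := by
    rw [eventually_all]
    intro l
    by_cases hl : l = j
    · simp [hl]
    · filter_upwards [key l hl] with q hq _ using hq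
  filter_upwards [key', e.open_source.mem_nhds hp, e'.open_source.mem_nhds hp'] with q hq hqs hqs' hqi
  obtain ⟨l, hl, hex⟩ := exists_proportional_coord he he' hqs hqs' hqi
  by_cases hlj : l = j
  · rwa [← hlj]
  · exact absurd hex (hq l hlj hqs hqs' hl)

/-- Every local face of a chart is a local face of every other chart, and the corresponding
coordinates have proportional derivatives, with a positive factor. -/
theorem exists_sameFace (he : e ∈ maxAtlas P) (he' : e' ∈ maxAtlas P) (hp : p ∈ e.source)
    (hp' : p ∈ e'.source) {i : Fin n} (hi : (e p).1 i = 0) :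
    ∃ j, SameFace e i e' j p ∧ ∃ c : ℝ, 0 < c ∧
      ∀ v, chartComponent e' j p v = c * chartComponent e i p v := by
  obtain ⟨j, ⟨hj, c, hc, hcj⟩, hsub⟩ := exists_face_subset he he' hp hp' hi
  obtain ⟨k, -, hsub'⟩ := exists_face_subset he' he hp' hp hj
  have hik : i = k := eq_of_face_subset hp hi (by
    filter_upwards [hsub, hsub'] with q h1 h2 h using h2 (h1 h))
  subst hik
  refine ⟨j, ?_, c, hc, fun v => ?_⟩
  · filter_upwards [hsub, hsub'] with q h1 h2 using ⟨h1, h2⟩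
  · rw [chartComponent_eq he' hp', chartComponent_eq he hp, hcj]

theorem SameFace.component (he : e ∈ maxAtlas P) (he' : e' ∈ maxAtlas P) (hp : p ∈ e.source)
    (hp' : p ∈ e'.source) {i j : Fin n} (hi : (e p).1 i = 0) (h : SameFace e i e' j p) :
    ∃ c : ℝ, 0 < c ∧ ∀ v, chartComponent e' j p v = c * chartComponent e i p v := by
  obtain ⟨k, hk, hc⟩ := exists_sameFace he he' hp hp' hi
  obtain rfl := h.unique hp' hk (h.zero_iff.1 hi)
  exact hc

end Faces

/-! ### Geometric boundaries: uniqueness and compactness -/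

section Boundary

variable {n : ℕ} {B B' : CornerMfd n} {P : CornerMfd (n + 1)} {ι : B → P} {ι' : B' → P} {b : B}
  {b' : B'} {e e' : OpenPartialHomeomorph P (EuclideanQuadrant (n + 1))} {i i' : Fin (n + 1)}

/-- Near `b`, in suitable charts, `ι` is the inclusion of a face of the quadrant. -/
def IsLocalFaceAt (ι : B → P) (b : B) : Prop :=
  ∃ ψ ∈ maxAtlas B, ∃ e ∈ maxAtlas P, ∃ i : Fin (n + 1), b ∈ ψ.source ∧
    ∀ b' ∈ ψ.source, ι b' ∈ e.source ∧ (e (ι b')).1 i = 0 ∧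
      ∀ j : Fin n, (e (ι b')).1 (i.succAbove j) = (ψ b').1 j

theorem IsGeometricBoundary.isLocalFaceAt (h : IsGeometricBoundary ι) (b : B) :
    IsLocalFaceAt ι b := h.locally_face b

theorem eq_insertZero {x : EuclideanQuadrant (n + 1)} {y : EuclideanQuadrant n} (h0 : x.1 i = 0)
    (h : ∀ j, x.1 (i.succAbove j) = y.1 j) : x = insertZero i y := by
  rw [← insertZero_removeCoord h0]
  congr 1
  exact quadrant_ext h

theorem LiesOnFace.eventually (h : LiesOnFace ι b e i) : ∀ᶠ x in 𝓝 b, LiesOnFace ι x e i :=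
  eventually_eventually_nhds.2 h

theorem LiesOnFace.zero (h : LiesOnFace ι b e i) : (e (ι b)).1 i = 0 := h.self_of_nhds

theorem IsLocalFaceAt.contMDiffAt (h : IsLocalFaceAt ι b) :
    ContMDiffAt (Q n) (Q (n + 1)) ∞ ι b := by
  obtain ⟨ψ, hψ, e, he, i, hb, h⟩ := h
  have heq : ι =ᶠ[𝓝 b] fun x => e.symm (insertZero i (ψ x)) := by
    filter_upwards [ψ.open_source.mem_nhds hb] with x hx
    obtain ⟨h1, h2, h3⟩ := h x hx
    rw [← eq_insertZero h2 h3, e.left_inv h1]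
  refine ContMDiffAt.congr_of_eventuallyEq ?_ heq
  obtain ⟨h1, h2, h3⟩ := h b hb
  refine ContMDiffAt.comp b (?_ : ContMDiffAt _ _ _ _ (insertZero i (ψ b)))
    ((contMDiff_insertZero i).contMDiffAt.comp b (contMDiffAt_of_mem_maximalAtlas hψ hb))
  rw [← eq_insertZero h2 h3]
  exact contMDiffAt_symm_of_mem_maximalAtlas he (e.map_source h1)

theorem IsLocalFaceAt.continuousAt (h : IsLocalFaceAt ι b) : ContinuousAt ι b :=
  h.contMDiffAt.continuousAt

theorem IsGeometricBoundary.contMDiff (h : IsGeometricBoundary ι) :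
    ContMDiff (Q n) (Q (n + 1)) ∞ ι := fun b => (h.isLocalFaceAt b).contMDiffAt

theorem LiesOnFace.of_sameFace (hc : ContinuousAt ι b) (h : LiesOnFace ι b e i)
    (hs : SameFace e i e' i' (ι b)) : LiesOnFace ι b e' i' := by
  filter_upwards [h, hc.eventually hs] with x hx hx' using hx'.1 hx

/-- The local inverse of `ι`, from a face of a chart of `P` to the boundary. -/
theorem IsLocalFaceAt.exists_section_aux (h : IsLocalFaceAt ι b) :
    ∃ e ∈ maxAtlas P, ι b ∈ e.source ∧ ∃ i, LiesOnFace ι b e i ∧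
      ∃ s : P → B, ContMDiffAt (Q (n + 1)) (Q n) ∞ s (ι b) ∧ s (ι b) = b ∧
        ∀ᶠ q in 𝓝 (ι b), (e q).1 i = 0 → ι (s q) = q := by
  obtain ⟨ψ, hψ, e, he, i, hb, h⟩ := h
  obtain ⟨h1, h2, h3⟩ := h b hb
  have hpb : removeCoord i (e (ι b)) = ψ b := quadrant_ext h3
  have hcont : ContMDiffAt (Q (n + 1)) (Q n) ∞ (fun q => removeCoord i (e q)) (ι b) :=
    (contMDiff_removeCoord i).contMDiffAt.comp _ (contMDiffAt_of_mem_maximalAtlas he h1)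
  refine ⟨e, he, h1, i, ?_, fun q => ψ.symm (removeCoord i (e q)), ?_, ?_, ?_⟩
  · filter_upwards [ψ.open_source.mem_nhds hb] with x hx using (h x hx).2.1
  · refine ContMDiffAt.comp (ι b)
      (?_ : ContMDiffAt _ _ _ _ (removeCoord i (e (ι b)))) hcont
    rw [hpb]
    exact contMDiffAt_symm_of_mem_maximalAtlas hψ (ψ.map_source hb)
  · change ψ.symm (removeCoord i (e (ι b))) = b
    rw [hpb, ψ.left_inv hb]
  · have ht : ∀ᶠ q in 𝓝 (ι b), removeCoord i (e q) ∈ ψ.target := by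
      refine hcont.continuousAt.eventually ?_
      beta_reduce
      rw [hpb]
      exact ψ.open_target.mem_nhds (ψ.map_source hb)
    filter_upwards [ht, e.open_source.mem_nhds h1] with q hq hqe h0
    obtain ⟨h4, h5, h6⟩ := h _ (ψ.map_target hq)
    apply e.injOn h4 hqe
    rw [eq_insertZero h5 h6, ψ.right_inv hq, insertZero_removeCoord h0]

theorem LiesOnFace.sameFace (h : IsLocalFaceAt ι b) (he : e ∈ maxAtlas P) (hp : ι b ∈ e.source)
    (he' : e' ∈ maxAtlas P) (hp' : ι b ∈ e'.source) (hi : LiesOnFace ι b e i)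
    (hi' : LiesOnFace ι b e' i') : SameFace e i e' i' (ι b) := by
  obtain ⟨e₀, he₀, hp₀, i₀, h₀, s, hs, hsb, hsq⟩ := h.exists_section_aux
  have key : ∀ {e : OpenPartialHomeomorph P (EuclideanQuadrant (n + 1))} {i : Fin (n + 1)},
      e ∈ maxAtlas P → ι b ∈ e.source → LiesOnFace ι b e i → SameFace e₀ i₀ e i (ι b) := by
    intro e i he hp hi
    obtain ⟨j, hj, -⟩ := exists_sameFace he₀ he hp₀ hp h₀.zero
    have hev : ∀ᶠ q in 𝓝 (ι b), (e (ι (s q))).1 i = 0 := by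
      have := hs.continuousAt.tendsto
      rw [hsb] at this
      exact this.eventually hi
    have : j = i := by
      refine eq_of_face_subset hp (hj.zero_iff.1 h₀.zero) ?_
      filter_upwards [hj, hsq, hev] with q h1 h2 h3 h4
      rwa [h2 (h1.2 h4)] at h3
    rwa [← this]
  exact (key he hp hi).symm.trans (key he' hp' hi')

theorem LiesOnFace.unique (h : IsLocalFaceAt ι b) (he : e ∈ maxAtlas P) (hp : ι b ∈ e.source)
    (hi : LiesOnFace ι b e i) (hi' : LiesOnFace ι b e i') : i = i' :=
  (SameFace.refl e i (ι b)).unique hp (hi.sameFace h he hp he hp hi') hi.zero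

theorem IsLocalFaceAt.exists_liesOnFace (h : IsLocalFaceAt ι b) (he : e ∈ maxAtlas P)
    (hp : ι b ∈ e.source) : ∃ i, LiesOnFace ι b e i := by
  obtain ⟨e₀, he₀, hp₀, i₀, h₀, -⟩ := h.exists_section_aux
  obtain ⟨j, hj, -⟩ := exists_sameFace he₀ he hp₀ hp h₀.zero
  exact ⟨j, h₀.of_sameFace h.continuousAt hj⟩

theorem IsLocalFaceAt.exists_section (h : IsLocalFaceAt ι b) (he : e ∈ maxAtlas P)
    (hp : ι b ∈ e.source) (hi : LiesOnFace ι b e i) :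
    ∃ s : P → B, ContMDiffAt (Q (n + 1)) (Q n) ∞ s (ι b) ∧ s (ι b) = b ∧
      ∀ᶠ q in 𝓝 (ι b), (e q).1 i = 0 → ι (s q) = q := by
  obtain ⟨e₀, he₀, hp₀, i₀, h₀, s, hs, hsb, hsq⟩ := h.exists_section_aux
  refine ⟨s, hs, hsb, ?_⟩
  filter_upwards [hsq, hi.sameFace h he hp he₀ hp₀ h₀] with q h1 h2 h3 using h1 (h2.1 h3)

theorem IsGeometricBoundary.eq_of_liesOnFace (h : IsGeometricBoundary ι) (he : e ∈ maxAtlas P)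
    {x y : B} (hx : ι x ∈ e.source) (hxy : ι y = ι x) (h1 : LiesOnFace ι x e i)
    (h2 : LiesOnFace ι y e i) : x = y :=
  (h.existsUnique_face e he _ hx i h1.zero).unique ⟨rfl, h1⟩ ⟨hxy, h2⟩

/-- The bijectivity condition of a geometric boundary need only be checked in one chart around each
point. -/
theorem IsGeometricBoundary.of_exists_chart (h : ∀ b, IsLocalFaceAt ι b)
    (h' : ∀ p : P, ∃ e ∈ maxAtlas P, p ∈ e.source ∧
      ∀ i, (e p).1 i = 0 → ∃! b : B, ι b = p ∧ LiesOnFace ι b e i) :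
    IsGeometricBoundary ι where
  locally_face := h
  existsUnique_face e he p hp i hi := by
    obtain ⟨e₀, he₀, hp₀, H⟩ := h' p
    obtain ⟨j, hj, -⟩ := exists_sameFace he he₀ hp hp₀ hi
    obtain ⟨b, ⟨rfl, hb⟩, hu⟩ := H j (hj.zero_iff.1 hi)
    refine ⟨b, ⟨rfl, hb.of_sameFace (h b).continuousAt hj.symm⟩, fun y ⟨hy, hy'⟩ => hu y ⟨hy, ?_⟩⟩
    exact hy'.of_sameFace (h y).continuousAt (by rwa [hy])

/-- A relation that is locally the graph of smooth maps in both directions is the graph of a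
diffeomorphism, if it is the graph of a bijection. -/
theorem exists_diffeomorph_of_rel {m : ℕ} {D D' : CornerMfd m} (R : D → D' → Prop)
    (h1 : ∀ d, ∃! d', R d d') (h2 : ∀ d', ∃! d, R d d')
    (h3 : ∀ d d', R d d' → ∃ g, ContMDiffAt (Q m) (Q m) ∞ g d ∧ ∀ᶠ x in 𝓝 d, R x (g x))
    (h4 : ∀ d d', R d d' → ∃ g, ContMDiffAt (Q m) (Q m) ∞ g d' ∧ ∀ᶠ x in 𝓝 d', R (g x) x) :
    ∃ f : D ≃ₘ⟮Q m, Q m⟯ D', ∀ d, R d (f d) := by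
  choose f hf hfu using h1
  choose g hg hgu using h2
  refine ⟨{ toFun := f
            invFun := g
            left_inv := fun d => (hgu _ _ (hf d)).symm
            right_inv := fun d => (hfu _ _ (hg d)).symm
            contMDiff_toFun := fun d => ?_
            contMDiff_invFun := fun d => ?_ }, hf⟩
  · obtain ⟨k, hk, hkR⟩ := h3 d (f d) (hf d)
    refine hk.congr_of_eventuallyEq ?_
    filter_upwards [hkR] with x hx using (hfu _ _ hx).symm
  · obtain ⟨k, hk, hkR⟩ := h4 (g d) d (hg d)
    refine hk.congr_of_eventuallyEq ?_
    filter_upwards [hkR] with x hx using (hgu _ _ hx).symm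

/-- The points `b` and `b'` of two boundaries are the same local face of `P`. -/
def SameBoundaryPoint (ι : B → P) (ι' : B' → P) (b : B) (b' : B') : Prop :=
  ι' b' = ι b ∧ ∃ e ∈ maxAtlas P, ι b ∈ e.source ∧ ∃ i, LiesOnFace ι b e i ∧ LiesOnFace ι' b' e i

theorem SameBoundaryPoint.symm (h : SameBoundaryPoint ι ι' b b') :
    SameBoundaryPoint ι' ι b' b := by
  obtain ⟨h0, e, he, hp, i, h1, h2⟩ := h
  exact ⟨h0.symm, e, he, by rwa [h0], i, h2, h1⟩

theorem IsGeometricBoundary.existsUnique_sameBoundaryPoint (h : IsGeometricBoundary ι)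
    (h' : IsGeometricBoundary ι') (b : B) : ∃! b', SameBoundaryPoint ι ι' b b' := by
  have he := chart_mem_maxAtlas (ι b)
  have hp := mem_chart_source (EuclideanQuadrant (n + 1)) (ι b)
  obtain ⟨i, hi⟩ := (h.isLocalFaceAt b).exists_liesOnFace he hp
  obtain ⟨b', ⟨hb', hi'⟩, hu⟩ := h'.existsUnique_face _ he _ hp i hi.zero
  refine ⟨b', ⟨hb', _, he, hp, i, hi, hi'⟩, ?_⟩
  rintro y ⟨hy, e, hee, hpe, j, hj, hj'⟩
  refine hu y ⟨hy, hj'.of_sameFace (h'.isLocalFaceAt y).continuousAt ?_⟩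
  rw [hy]
  exact hj.sameFace (h.isLocalFaceAt b) hee hpe he hp hi

theorem SameBoundaryPoint.exists_local (h : IsGeometricBoundary ι) (h' : IsGeometricBoundary ι')
    (hbb : SameBoundaryPoint ι ι' b b') :
    ∃ g, ContMDiffAt (Q n) (Q n) ∞ g b ∧ ∀ᶠ x in 𝓝 b, SameBoundaryPoint ι ι' x (g x) := by
  obtain ⟨h0, e, he, hp, i, h1, h2⟩ := hbb
  obtain ⟨s, hs, hsb, hsq⟩ := (h'.isLocalFaceAt b').exists_section he (by rwa [h0]) h2
  rw [h0] at hs hsb hsq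
  have hι := h.contMDiff b
  have hsι : ContMDiffAt (Q n) (Q n) ∞ (fun x => s (ι x)) b := ContMDiffAt.comp b hs hι
  refine ⟨fun x => s (ι x), hsι, ?_⟩
  have ht : Tendsto (fun x => s (ι x)) (𝓝 b) (𝓝 b') := by
    have := hsι.continuousAt.tendsto
    rwa [hsb] at this
  filter_upwards [hι.continuousAt.eventually hsq, h1.eventually, ht.eventually h2.eventually,
    hι.continuousAt.eventually (e.open_source.mem_nhds hp)] with x hx1 hx2 hx3 hx4
  exact ⟨hx1 hx2.zero, e, he, hx4, i, hx2, hx3⟩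

/-- Two geometric boundaries of `P` are diffeomorphic over `P`. -/
theorem IsGeometricBoundary.exists_diffeomorph (h : IsGeometricBoundary ι)
    (h' : IsGeometricBoundary ι') :
    ∃ f : B ≃ₘ⟮Q n, Q n⟯ B', ∀ b, SameBoundaryPoint ι ι' b (f b) := by
  refine exists_diffeomorph_of_rel (SameBoundaryPoint ι ι')
    (h.existsUnique_sameBoundaryPoint h') (fun b' => ?_) (fun _ _ hR => hR.exists_local h h')
    fun _ _ hR => ?_
  · obtain ⟨b, hb, hu⟩ := h'.existsUnique_sameBoundaryPoint h b'
    exact ⟨b, hb.symm, fun y hy => hu y hy.symm⟩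
  · obtain ⟨g, hg, hR'⟩ := hR.symm.exists_local h' h
    exact ⟨g, hg, hR'.mono fun x hx => hx.symm⟩

/-- The geometric boundary of a compact manifold is compact. -/
theorem IsGeometricBoundary.compactSpace [CompactSpace P] (h : IsGeometricBoundary ι) :
    CompactSpace B := by
  refine ⟨isCompact_iff_ultrafilter_le_nhds.2 fun U _ => ?_⟩
  obtain ⟨p, -, hp⟩ := isCompact_iff_ultrafilter_le_nhds.1 (isCompact_univ (X := P)) (U.map ι)
    (by simp)
  have hp : Tendsto ι U (𝓝 p) := hp
  set e := chartAt (EuclideanQuadrant (n + 1)) p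
  have he : e ∈ maxAtlas P := chart_mem_maxAtlas p
  have hpe : p ∈ e.source := mem_chart_source _ p
  have hU : ∀ᶠ b in (U : Filter B), ι b ∈ e.source := hp.eventually (e.open_source.mem_nhds hpe)
  have hex : ∀ᶠ b in (U : Filter B), ∃ i, LiesOnFace ι b e i :=
    hU.mono fun b hb => (h.isLocalFaceAt b).exists_liesOnFace he hb
  obtain ⟨i, hi⟩ : ∃ i, ∀ᶠ b in (U : Filter B), LiesOnFace ι b e i :=
    Ultrafilter.eventually_exists_iff.1 hex
  have hzero : (e p).1 i = 0 := by
    have hc : ContinuousAt (fun q => (e q).1 i) p :=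
      (PiLp.continuous_apply 2 _ i).continuousAt.comp
        (continuous_subtype_val.continuousAt.comp (e.continuousAt hpe))
    refine tendsto_nhds_unique (hc.tendsto.comp hp) (tendsto_const_nhds.congr' ?_)
    exact hi.mono fun b hb => hb.zero.symm
  obtain ⟨b, ⟨hb, hbi⟩, -⟩ := h.existsUnique_face e he p hpe i hzero
  refine ⟨b, mem_univ b, ?_⟩
  subst hb
  obtain ⟨s, hs, hsb, hsq⟩ := (h.isLocalFaceAt b).exists_section he hpe hbi
  have ht : Tendsto (fun x => s (ι x)) U (𝓝 b) := by
    have := hs.continuousAt.tendsto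
    rw [hsb] at this
    exact this.comp hp
  have : Tendsto id (U : Filter B) (𝓝 b) := by
    refine ht.congr' ?_
    filter_upwards [hi, ht.eventually hbi.eventually, hp.eventually hsq, hU] with x h1 h2 h3 h4
    exact (h.eq_of_liesOnFace he h4 (h3 h1.zero) h1 h2).symm
  exact this

end Boundary

/-! ### Orientations and bases -/

section LinearAlgebra

open Module

variable {n : ℕ} {V W U : Type*} [AddCommGroup V] [Module ℝ V] [AddCommGroup W] [Module ℝ W]
  [AddCommGroup U] [Module ℝ U]

theorem orientation_neg_neg (o : Orientation ℝ V (Fin n)) : - -o = o := neg_neg o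

theorem orientation_eq_neg_iff (v : Basis (Fin n) ℝ V) (o : Orientation ℝ V (Fin n)) :
    v.orientation = -o ↔ ¬ v.orientation = o := by
  have h := v.orientation_ne_iff_eq_neg o
  constructor
  · intro h1 h2
    exact h.2 (by rw [h1, orientation_neg_neg]) h2.symm
  · intro h1
    rw [h.1 fun h2 => h1 h2.symm, orientation_neg_neg]

theorem orientation_eq_iff (v : Basis (Fin n) ℝ V) (o o' : Orientation ℝ V (Fin n)) :
    o = o' ↔ (v.orientation = o ↔ v.orientation = o') := by
  refine ⟨fun h => by rw [h], fun h => ?_⟩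
  by_cases h1 : v.orientation = o
  · rw [← h1, ← h.1 h1]
  · have h2 := (orientation_eq_neg_iff v o).2 h1
    rw [h] at h1
    have h4 := (orientation_eq_neg_iff v o').2 h1
    rw [← orientation_neg_neg o, ← h2, h4, orientation_neg_neg]

theorem orientation_map_eq_iff (v : Basis (Fin n) ℝ V) (f : V ≃ₗ[ℝ] W) (o : Orientation ℝ V (Fin n))
    (o' : Orientation ℝ W (Fin n)) :
    Orientation.map (Fin n) f o = o' ↔ (v.orientation = o ↔ (v.map f).orientation = o') := by
  rw [orientation_eq_iff (v.map f), Basis.orientation_map, (Orientation.map (Fin n) f).apply_eq_iff_eq]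

/-- Whether two bases determine the same orientation is the same question for their images. -/
theorem orientation_map_eq_map_iff (v w : Basis (Fin n) ℝ V) (f : V ≃ₗ[ℝ] W) :
    (v.map f).orientation = (w.map f).orientation ↔ v.orientation = w.orientation := by
  rw [Basis.orientation_map, Basis.orientation_map, (Orientation.map (Fin n) f).apply_eq_iff_eq]

/-- For two bases and an orientation, the signs of the bases are compared by their relative
orientation. -/
theorem orientation_eq_iff_iff (v w : Basis (Fin n) ℝ V) (o : Orientation ℝ V (Fin n)) :
    v.orientation = w.orientation ↔ (v.orientation = o ↔ w.orientation = o) := by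
  constructor
  · intro h; rw [h]
  · intro h
    by_cases hv : v.orientation = o
    · rw [hv, h.1 hv]
    · have hw := fun h' => hv (h.2 h')
      rw [(orientation_eq_neg_iff v o).2 hv, (orientation_eq_neg_iff w o).2 hw]

/-- The map `L` is (the underlying map of) a linear isomorphism carrying the orientation `o` to the
orientation `o'`. -/
def Carries (L : V → W) (o : Orientation ℝ V (Fin n)) (o' : Orientation ℝ W (Fin n)) : Prop :=
  ∃ A : V ≃ₗ[ℝ] W, (∀ x, A x = L x) ∧ Orientation.map (Fin n) A o = o'

theorem orientation_map_trans (f : V ≃ₗ[ℝ] W) (g : W ≃ₗ[ℝ] U) (o : Orientation ℝ V (Fin n)) :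
    Orientation.map (Fin n) (f.trans g) o = Orientation.map (Fin n) g (Orientation.map (Fin n) f o) := by
  induction o using Module.Ray.ind with
  | h v hv => rfl

theorem Carries.comp {L : V → W} {L' : W → U} {o : Orientation ℝ V (Fin n)}
    {o' : Orientation ℝ W (Fin n)} {o'' : Orientation ℝ U (Fin n)} (h' : Carries L' o' o'')
    (h : Carries L o o') : Carries (fun x => L' (L x)) o o'' := by
  obtain ⟨A, hA, hAo⟩ := h
  obtain ⟨A', hA', hAo'⟩ := h'
  exact ⟨A.trans A', fun x => by simp [hA, hA'], by rw [orientation_map_trans, hAo, hAo']⟩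

theorem Carries.neg {L : V → W} {o : Orientation ℝ V (Fin n)} {o' : Orientation ℝ W (Fin n)}
    (h : Carries L o o') : Carries L (-o) (-o') := by
  obtain ⟨A, hA, hAo⟩ := h
  exact ⟨A, hA, by rw [Orientation.map_neg, hAo]⟩

theorem Carries.id (o : Orientation ℝ V (Fin n)) : Carries (fun x => x) o o :=
  ⟨LinearEquiv.refl ℝ V, fun _ => rfl, by rw [Orientation.map_refl]; rfl⟩

theorem Carries.inverse {L : V → W} {L' : W → V} {o : Orientation ℝ V (Fin n)}
    {o' : Orientation ℝ W (Fin n)} (h : Carries L o o') (hL : ∀ x, L (L' x) = x) :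
    Carries L' o' o := by
  obtain ⟨A, hA, hAo⟩ := h
  refine ⟨A.symm, fun x => ?_, ?_⟩
  · rw [LinearEquiv.symm_apply_eq, hA, hL]
  · rw [← hAo, ← orientation_map_trans, LinearEquiv.self_trans_symm, Orientation.map_refl]
    rfl

theorem Carries.basis {L : V → W} {o : Orientation ℝ V (Fin n)} {o' : Orientation ℝ W (Fin n)}
    (h : Carries L o o') (v : Basis (Fin n) ℝ V) :
    ∃ w : Basis (Fin n) ℝ W, (∀ j, w j = L (v j)) ∧ (w.orientation = o' ↔ v.orientation = o) := by
  obtain ⟨A, hA, hAo⟩ := h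
  exact ⟨v.map A, fun j => by simp [hA], ((orientation_map_eq_iff v A o o').1 hAo).symm⟩

theorem carries_of_basis {L : V →ₗ[ℝ] W} {o : Orientation ℝ V (Fin n)} {o' : Orientation ℝ W (Fin n)}
    (v : Basis (Fin n) ℝ V) (w : Basis (Fin n) ℝ W) (h : ∀ j, w j = L (v j))
    (ho : w.orientation = o' ↔ v.orientation = o) : Carries L o o' := by
  refine ⟨v.equiv w (Equiv.refl _), fun x => ?_, ?_⟩
  · have : ((v.equiv w (Equiv.refl _) : V ≃ₗ[ℝ] W) : V →ₗ[ℝ] W) = L := v.ext fun j => by simp [h]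
    exact DFunLike.congr_fun this x
  · rw [orientation_map_eq_iff v]
    have : v.map (v.equiv w (Equiv.refl _)) = w := Basis.eq_of_apply_eq fun j => by simp
    rw [this, ho]

/-- The basis `(ν, L v₁, …, L vₙ)`, where `χ` vanishes on the image of `L` and is negative at `ν`. Its
orientation depends only on that of `v`, by expansion of the determinant along the row of `χ`. -/
theorem exists_basis_cons (χ : V →ₗ[ℝ] ℝ) (L : W →ₗ[ℝ] V) (w₀ : Basis (Fin (n + 1)) ℝ V)
    (v₀ v : Basis (Fin n) ℝ W) (ν : V) (h₀ : ∀ j : Fin n, w₀ j.succ = L (v₀ j))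
    (hχ₀ : χ (w₀ 0) < 0) (hχ : χ ν < 0) (hχL : ∀ x, χ (L x) = 0) :
    ∃ w : Basis (Fin (n + 1)) ℝ V, w 0 = ν ∧ (∀ j : Fin n, w j.succ = L (v j)) ∧
      (w.orientation = w₀.orientation ↔ v.orientation = v₀.orientation) := by
  have hrow : ∀ x, w₀.repr x 0 = χ x / χ (w₀ 0) := by
    intro x
    rw [eq_div_iff hχ₀.ne]
    conv_rhs => rw [← w₀.sum_repr x]
    rw [map_sum, Fin.sum_univ_succ]
    simp [h₀, hχL]
  have hsub : ∀ x i, w₀.repr (L x) i.succ = v₀.repr x i := by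
    intro x i
    conv_lhs => rw [← v₀.sum_repr x]
    simp only [map_sum, map_smul, ← h₀, Basis.repr_self, Finsupp.coe_finsetSum, Finset.sum_apply,
      Finsupp.coe_smul, Pi.smul_apply, smul_eq_mul]
    rw [Finset.sum_eq_single i (fun k _ hk => by simp [hk]) (by simp)]
    simp
  set f : Fin (n + 1) → V := Fin.cons ν fun j => L (v j) with hf
  have hdet : w₀.det f = χ ν / χ (w₀ 0) * v₀.det v := by
    rw [Basis.det_apply, Matrix.det_succ_row_zero, Fin.sum_univ_succ, Finset.sum_eq_zero]
    · simp only [Fin.val_zero, pow_zero, one_mul, add_zero, Basis.toMatrix_apply, hf, Fin.cons_zero,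
        hrow, Basis.det_apply]
      congr 2
      ext i j
      simp [Basis.toMatrix_apply, hsub]
    · intro j _
      simp [Basis.toMatrix_apply, hf, hrow, hχL]
  have hc : 0 < χ ν / χ (w₀ 0) := div_pos_of_neg_of_neg hχ hχ₀
  have hunit : IsUnit (w₀.det f) := by
    rw [hdet]
    exact (hc.ne'.isUnit).mul (v₀.isUnit_det v)
  obtain ⟨h1, h2⟩ := (Basis.is_basis_iff_det w₀).2 hunit
  refine ⟨Basis.mk h1 h2.ge, by simp [hf], fun j => by simp [hf], ?_⟩
  rw [eq_comm, Basis.orientation_eq_iff_det_pos, Basis.coe_mk, hdet, eq_comm,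
    Basis.orientation_eq_iff_det_pos]
  exact mul_pos_iff_of_pos_left hc

/-- Moving the first vector of a basis to the end. -/
def rotateBasis (w : Basis (Fin (n + 1)) ℝ V) : Basis (Fin (n + 1)) ℝ V :=
  w.reindex (finRotate (n + 1)).symm

@[simp] theorem rotateBasis_castSucc (w : Basis (Fin (n + 1)) ℝ V) (j : Fin n) :
    rotateBasis w j.castSucc = w j.succ := by
  simp [rotateBasis]

@[simp] theorem rotateBasis_last (w : Basis (Fin (n + 1)) ℝ V) :
    rotateBasis w (Fin.last n) = w 0 := by
  simp [rotateBasis]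

theorem rotateBasis_orientation_iff (w w' : Basis (Fin (n + 1)) ℝ V) :
    (rotateBasis w).orientation = (rotateBasis w').orientation ↔ w.orientation = w'.orientation := by
  rw [rotateBasis, rotateBasis, Basis.orientation_reindex, Basis.orientation_reindex,
    (Orientation.reindex ℝ V _).apply_eq_iff_eq]

/-- Moving the first of `n + 1` vectors to the end is a permutation of sign `(-1)ⁿ`. -/
theorem rotateBasis_orientation (w : Basis (Fin (n + 1)) ℝ V) :
    (rotateBasis w).orientation = w.orientation ↔ Even n := by
  rw [eq_comm, Basis.orientation_eq_iff_det_pos]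
  have : (rotateBasis w : Fin (n + 1) → V) = w ∘ finRotate (n + 1) := by
    ext j; simp [rotateBasis]
  rw [this, AlternatingMap.map_perm, Basis.det_self, sign_finRotate]
  rcases Nat.even_or_odd n with h | h
  · simp [h, h.neg_one_pow]
  · have h' := Nat.not_even_iff_odd.2 h
    simp [h', h.neg_one_pow]

/-- The basis `(v₁, …, vₙ, 1)` of a space identified with `W × ℝ` by the maps `A` and `τ`. -/
theorem exists_basis_snoc (A : V →ₗ[ℝ] W) (τ : V →ₗ[ℝ] ℝ) (w₀ : Basis (Fin (n + 1)) ℝ V)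
    (v₀ v : Basis (Fin n) ℝ W) (h₀ : ∀ j : Fin n, A (w₀ j.castSucc) = v₀ j ∧ τ (w₀ j.castSucc) = 0)
    (h₁ : A (w₀ (Fin.last n)) = 0) (h₂ : τ (w₀ (Fin.last n)) = 1) :
    ∃ w : Basis (Fin (n + 1)) ℝ V,
      (∀ j : Fin n, A (w j.castSucc) = v j ∧ τ (w j.castSucc) = 0) ∧
      A (w (Fin.last n)) = 0 ∧ τ (w (Fin.last n)) = 1 ∧
      (w.orientation = w₀.orientation ↔ v.orientation = v₀.orientation) := by
  set L : W →ₗ[ℝ] V := v₀.constr ℝ fun j => w₀ j.castSucc with hL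
  have hAL : ∀ x, A (L x) = x := by
    intro x
    have : A.comp L = LinearMap.id := v₀.ext fun j => by simp [hL, (h₀ j).1]
    exact DFunLike.congr_fun this x
  have hτL : ∀ x, τ (L x) = 0 := by
    intro x
    have : τ.comp L = 0 := v₀.ext fun j => by simp [hL, (h₀ j).2]
    exact DFunLike.congr_fun this x
  set w₁ : Basis (Fin (n + 1)) ℝ V := w₀.reindex (finRotate (n + 1)) with hw₁
  have hr : rotateBasis w₁ = w₀ := by
    apply Basis.eq_of_apply_eq
    intro j
    simp [rotateBasis, hw₁]
  have hs : ∀ j : Fin n, w₁ j.succ = L (v₀ j) := fun j => by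
    rw [← rotateBasis_castSucc, hr, hL, Basis.constr_basis]
  have hz : w₁ 0 = w₀ (Fin.last n) := by rw [← rotateBasis_last, hr]
  obtain ⟨w, hw0, hws, hwo⟩ := exists_basis_cons (-τ) L w₁ v₀ v (w₁ 0) hs (by simp [hz, h₂])
    (by simp [hz, h₂]) (by simp [hτL])
  refine ⟨rotateBasis w, fun j => ?_, ?_, ?_, ?_⟩
  · rw [rotateBasis_castSucc, hws]
    exact ⟨hAL _, hτL _⟩
  · rw [rotateBasis_last, hw0, hz, h₁]
  · rw [rotateBasis_last, hw0, hz, h₂]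
  · rw [← hr, rotateBasis_orientation_iff, hwo]

/-- The basis `(-eᵢ, …)` of `ℝⁿ⁺¹` whose last `n` vectors are the standard basis of the face
`{xᵢ = 0}`. -/
theorem exists_basis_outward (i : Fin (n + 1)) : ∃ w : Basis (Fin (n + 1)) ℝ (Vec (n + 1)),
    w 0 = -EuclideanSpace.single i 1 ∧
      ∀ j : Fin n, w j.succ = EuclideanSpace.single (i.succAbove j) 1 := by
  let σ : Fin (n + 1) ≃ Fin (n + 1) := (finSuccEquiv' 0).trans (finSuccEquiv' i).symm
  have h0 : σ 0 = i := by simp [σ]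
  have hs : ∀ j : Fin n, σ j.succ = i.succAbove j := fun j => by
    rw [← Fin.succAbove_zero_apply]
    simp only [σ, Equiv.trans_apply, finSuccEquiv'_succAbove, finSuccEquiv'_symm_some]
  refine ⟨((EuclideanSpace.basisFun (Fin (n + 1)) ℝ).toBasis.reindex σ.symm).unitsSMul
    (Fin.cons (-1) fun _ => 1), ?_, fun j => ?_⟩
  · simp [Basis.unitsSMul_apply, h0]
  · simp [Basis.unitsSMul_apply, hs]

end LinearAlgebra

/-! ### Orientation fields in charts, and the boundary orientation -/

section Frames

open Module

variable {n : ℕ} {P : CornerMfd n} {e e' : OpenPartialHomeomorph P (EuclideanQuadrant n)} {p : P}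

/-- The coordinate basis of the tangent space in a chart. -/
def frame (he : e ∈ maxAtlas P) (hp : p ∈ e.source) : Basis (Fin n) ℝ (TangentSpace (Q n) p) :=
  (EuclideanSpace.basisFun (Fin n) ℝ).toBasis.map (chartEquiv he hp).symm.toLinearEquiv

@[simp] theorem chartEquiv_frame (he : e ∈ maxAtlas P) (hp : p ∈ e.source) (j : Fin n) :
    chartEquiv he hp (frame he hp j) = EuclideanSpace.single j 1 := by
  simp [frame]

theorem frame_map (he : e ∈ maxAtlas P) (hp : p ∈ e.source) :
    (frame he hp).map (chartEquiv he hp).toLinearEquiv =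
      (EuclideanSpace.basisFun (Fin n) ℝ).toBasis :=
  Basis.eq_of_apply_eq fun j => by simp

theorem chartComponent_frame (he : e ∈ maxAtlas P) (hp : p ∈ e.source) (i j : Fin n) :
    chartComponent e i p (frame he hp j) = if i = j then 1 else 0 := by
  rw [chartComponent_eq he hp, chartEquiv_frame]
  simp

theorem eq_of_chartComponent (he : e ∈ maxAtlas P) (hp : p ∈ e.source) {v w : TangentSpace (Q n) p}
    (h : ∀ i, chartComponent e i p v = chartComponent e i p w) : v = w := by
  apply (chartEquiv he hp).injective
  ext i
  rw [← chartComponent_eq, ← chartComponent_eq, h]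

/-- The relative orientation of the coordinate bases of two charts is locally constant. -/
theorem frame_orientation_eventually (he : e ∈ maxAtlas P) (hp : p ∈ e.source)
    (he' : e' ∈ maxAtlas P) (hp' : p ∈ e'.source) :
    ∀ᶠ q in 𝓝 p, ∀ (hq : q ∈ e.source) (hq' : q ∈ e'.source),
      ((frame he hq).orientation = (frame he' hq').orientation ↔
        (frame he hp).orientation = (frame he' hp').orientation) := by
  obtain ⟨G, hG, hGe⟩ := exists_transition_deriv he he' hp hp'
  set b := (EuclideanSpace.basisFun (Fin n) ℝ).toBasis with hb
  set D : P → ℝ := fun q => b.det fun j => G q (EuclideanSpace.single j 1) with hD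
  have hmap : ∀ q (hq : q ∈ e.source) (hq' : q ∈ e'.source),
      ((frame he hq).map (chartEquiv he' hq').toLinearEquiv : Fin n → Vec n) =
        fun j => G q (EuclideanSpace.single j 1) := by
    intro q hq hq'
    ext1 j
    have := hGe q hq hq' (frame he hq j)
    rw [chartEquiv_frame] at this
    simpa using this
  have key : ∀ q (hq : q ∈ e.source) (hq' : q ∈ e'.source),
      ((frame he hq).orientation = (frame he' hq').orientation ↔ 0 < D q) := by
    intro q hq hq'
    rw [← orientation_map_eq_map_iff _ _ (chartEquiv he' hq').toLinearEquiv, frame_map, eq_comm,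
      Basis.orientation_eq_iff_det_pos, hmap]
  have hDc : ContinuousAt D p := by
    have h1 : ContinuousAt (fun q => Matrix.of fun i j => G q (EuclideanSpace.single j 1) i) p := by
      refine continuousAt_pi.2 fun i => continuousAt_pi.2 fun j => ?_
      have h1 : ContinuousAt (fun q => G q (EuclideanSpace.single j (1 : ℝ) : Vec n)) p :=
        hG.clm_apply continuousAt_const
      exact (PiLp.continuous_apply 2 _ i).continuousAt.comp h1
    have h2 := (continuous_id.matrix_det (R := ℝ) (n := Fin n)).continuousAt.comp h1
    refine h2.congr (Eventually.of_forall fun q => ?_)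
    simp only [hD, Basis.det_apply, Function.comp_apply, id]
    congr 1
  have hD0 : D p ≠ 0 := by
    have := b.isUnit_det ((frame he hp).map (chartEquiv he' hp').toLinearEquiv)
    rw [hmap] at this
    exact this.ne_zero
  rcases hD0.lt_or_gt with h | h
  · filter_upwards [hDc.eventually (gt_mem_nhds h)] with q hq hqe hqe'
    rw [key, key]
    constructor <;> intro h' <;> linarith
  · filter_upwards [hDc.eventually (lt_mem_nhds h)] with q hq hqe hqe'
    rw [key, key]
    exact ⟨fun _ => h, fun _ => hq⟩

theorem tangentTriv_eq_chartEquiv (x y : P) (hy) (hy' : y ∈ (chartAt (EuclideanQuadrant n) x).source)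
    (v : TangentSpace (Q n) y) :
    tangentTriv x y hy v = chartEquiv (chart_mem_maxAtlas x) hy' v := by
  rw [tangentTriv_apply, chartEquiv_apply, mfderiv_chartAt_eq_tangentCoordChange hy']
  rfl

theorem orientation_map_tangentTriv (o : OrientationField P) (c : Orientation ℝ (Vec n) (Fin n))
    (x y : P) (hy) (hy' : y ∈ (chartAt (EuclideanQuadrant n) x).source) :
    Orientation.map (Fin n) (tangentTriv x y hy) (o y) = c ↔
      ((frame (chart_mem_maxAtlas x) hy').orientation = o y ↔
        (EuclideanSpace.basisFun (Fin n) ℝ).toBasis.orientation = c) := by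
  rw [orientation_map_eq_iff (frame (chart_mem_maxAtlas x) hy')]
  have : (frame (chart_mem_maxAtlas x) hy').map (tangentTriv x y hy) =
      (EuclideanSpace.basisFun (Fin n) ℝ).toBasis := by
    rw [← frame_map (chart_mem_maxAtlas x) hy']
    refine Basis.eq_of_apply_eq fun j => ?_
    exact tangentTriv_eq_chartEquiv x y hy hy' _
  rw [this]

theorem frame_sign_change {o : OrientationField P} (he : e ∈ maxAtlas P) (hp : p ∈ e.source)
    (he' : e' ∈ maxAtlas P) (hp' : p ∈ e'.source)
    (h : ∀ᶠ q in 𝓝 p, ∀ hq : q ∈ e.source,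
      ((frame he hq).orientation = o q ↔ (frame he hp).orientation = o p)) :
    ∀ᶠ q in 𝓝 p, ∀ hq : q ∈ e'.source,
      ((frame he' hq).orientation = o q ↔ (frame he' hp').orientation = o p) := by
  filter_upwards [h, frame_orientation_eventually he hp he' hp', e.open_source.mem_nhds hp] with
    q h1 h2 h3 h4
  have h5 := h1 h3
  have h6 := h2 h3 h4
  rw [orientation_eq_iff_iff _ _ (o q), orientation_eq_iff_iff _ _ (o p)] at h6
  tauto

/-- A field of orientations is an orientation if the signs of coordinate bases are locally
constant, in one chart around each point. -/
theorem isOrientationField_of_frames {o : OrientationField P}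
    (h : ∀ p : P, ∃ e, ∃ (he : e ∈ maxAtlas P) (hp : p ∈ e.source), ∀ᶠ q in 𝓝 p,
      ∀ hq : q ∈ e.source, ((frame he hq).orientation = o q ↔ (frame he hp).orientation = o p)) :
    IsOrientationField o := by
  intro x
  obtain ⟨e, he, hx, hev⟩ := h x
  have hx' := mem_chart_source (EuclideanQuadrant n) x
  have hev' := frame_sign_change he hx (chart_mem_maxAtlas x) hx' hev
  have hb : x ∈ (trivializationAt (EuclideanSpace ℝ (Fin n))
      (TangentSpace (Q n) : P → Type) x).baseSet := hx'
  refine ⟨Orientation.map (Fin n) (tangentTriv x x hb) (o x), ?_⟩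
  filter_upwards [hev'] with y hy hyb
  have hys : y ∈ (chartAt (EuclideanQuadrant n) x).source := hyb
  rw [orientation_map_tangentTriv o _ x y hyb hys, hy hys,
    ← orientation_map_tangentTriv o _ x x hb hx']

theorem IsOrientationField.eventually_frame {o : OrientationField P} (ho : IsOrientationField o)
    (he : e ∈ maxAtlas P) (hp : p ∈ e.source) : ∀ᶠ q in 𝓝 p, ∀ hq : q ∈ e.source,
      ((frame he hq).orientation = o q ↔ (frame he hp).orientation = o p) := by
  have hp' := mem_chart_source (EuclideanQuadrant n) p
  refine frame_sign_change (chart_mem_maxAtlas p) hp' he hp ?_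
  obtain ⟨c, hc⟩ := ho p
  have h0 := hc.self_of_nhds hp'
  rw [orientation_map_tangentTriv o _ p p hp' hp'] at h0
  filter_upwards [hc] with q hq hqs
  have h1 := hq hqs
  rw [orientation_map_tangentTriv o _ p q hqs hqs] at h1
  tauto

end Frames

section BoundaryOrientation

open Module

variable {n : ℕ} {B : CornerMfd n} {P : CornerMfd (n + 1)} {ι : B → P} {b : B}
  {e e' : OpenPartialHomeomorph P (EuclideanQuadrant (n + 1))} {i i' : Fin (n + 1)}

/-- The pointwise condition of `IsBoundaryOrientation`. -/
def IsBoundaryOrientationAt (ι : B → P) (b : B)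
    (o : Orientation ℝ (TangentSpace (Q (n + 1)) (ι b)) (Fin (n + 1)))
    (o' : Orientation ℝ (TangentSpace (Q n) b) (Fin n)) : Prop :=
  ∀ ν : TangentSpace (Q (n + 1)) (ι b), IsOutward ι b ν →
    ∀ v : Basis (Fin n) ℝ (TangentSpace (Q n) b),
      ∃ w : Basis (Fin (n + 1)) ℝ (TangentSpace (Q (n + 1)) (ι b)),
        w 0 = ν ∧ (∀ j : Fin n, w j.succ = mfderiv (Q n) (Q (n + 1)) ι b (v j)) ∧
          (w.orientation = o ↔ v.orientation = o')

theorem IsLocalFaceAt.mdifferentiableAt (h : IsLocalFaceAt ι b) :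
    MDifferentiableAt (Q n) (Q (n + 1)) ι b := h.contMDiffAt.mdifferentiableAt (by simp)

theorem chartComponent_mfderiv {m n : ℕ} {X : CornerMfd m} {P : CornerMfd n} {f : X → P} {x : X}
    {e : OpenPartialHomeomorph P (EuclideanQuadrant n)}
    (hf : MDifferentiableAt (Q m) (Q n) f x) (he : e ∈ maxAtlas P) (hp : f x ∈ e.source)
    (k : Fin n) (v : TangentSpace (Q m) x) :
    chartComponent e k (f x) (mfderiv (Q m) (Q n) f x v) =
      mfderiv (Q m) 𝓘(ℝ) (fun y => (e (f y)).1 k) x v := by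
  have h := mfderiv_comp (I' := Q n) x (hasMFDerivAt_chart_coord he hp k).mdifferentiableAt hf
  exact (DFunLike.congr_fun h v).symm

theorem LiesOnFace.chartComponent_mfderiv (h : IsLocalFaceAt ι b) (he : e ∈ maxAtlas P)
    (hp : ι b ∈ e.source) (hi : LiesOnFace ι b e i) (v : TangentSpace (Q n) b) :
    chartComponent e i (ι b) (mfderiv (Q n) (Q (n + 1)) ι b v) = 0 := by
  rw [GeomHomology.chartComponent_mfderiv h.mdifferentiableAt he hp]
  have : (fun y => (e (ι y)).1 i) =ᶠ[𝓝 b] fun _ => (0 : ℝ) := hi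
  rw [this.mfderiv_eq, mfderiv_const]
  rfl

theorem chartComponent_linear (e : OpenPartialHomeomorph P (EuclideanQuadrant (n + 1)))
    (i : Fin (n + 1)) (p : P) : ∃ χ : TangentSpace (Q (n + 1)) p →ₗ[ℝ] ℝ,
      ∀ v, χ v = chartComponent e i p v :=
  ⟨(mfderiv (Q (n + 1)) 𝓘(ℝ) (fun x => (e x).1 i) p).toLinearMap, fun _ => rfl⟩

/-- Outward vectors have negative component in every chart. -/
theorem IsOutward.chartComponent_neg (h : IsLocalFaceAt ι b) {ν : TangentSpace (Q (n + 1)) (ι b)}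
    (hν : IsOutward ι b ν) (he : e ∈ maxAtlas P) (hp : ι b ∈ e.source) (hi : LiesOnFace ι b e i) :
    chartComponent e i (ι b) ν < 0 := by
  obtain ⟨e', he', hp', i', hi', hneg⟩ := hν
  obtain ⟨c, hc, h'⟩ := (hi'.sameFace h he' hp' he hp hi).component he' he hp' hp hi'.zero
  rw [h']
  exact mul_neg_of_pos_of_neg hc hneg

/-- The boundary orientation can be checked on one outward vector and one basis. -/
theorem isBoundaryOrientationAt_of_basis (h : IsLocalFaceAt ι b)
    {o : Orientation ℝ (TangentSpace (Q (n + 1)) (ι b)) (Fin (n + 1))}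
    {o' : Orientation ℝ (TangentSpace (Q n) b) (Fin n)}
    (v₀ : Basis (Fin n) ℝ (TangentSpace (Q n) b))
    (w₀ : Basis (Fin (n + 1)) ℝ (TangentSpace (Q (n + 1)) (ι b))) (h0 : IsOutward ι b (w₀ 0))
    (hs : ∀ j : Fin n, w₀ j.succ = mfderiv (Q n) (Q (n + 1)) ι b (v₀ j))
    (hw : w₀.orientation = o ↔ v₀.orientation = o') : IsBoundaryOrientationAt ι b o o' := by
  intro ν hν v
  obtain ⟨e, he, hp, i, hi, hneg⟩ := h0
  obtain ⟨χ, hχ⟩ := chartComponent_linear e i (ι b)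
  obtain ⟨w, h1, h2, h3⟩ := exists_basis_cons χ (mfderiv (Q n) (Q (n + 1)) ι b).toLinearMap w₀ v₀ v ν
    hs (by rwa [hχ]) (by rw [hχ]; exact hν.chartComponent_neg h he hp hi)
    fun x => by rw [hχ]; exact hi.chartComponent_mfderiv h he hp x
  refine ⟨w, h1, h2, ?_⟩
  rw [orientation_eq_iff_iff _ _ o, orientation_eq_iff_iff _ _ o'] at h3
  tauto

/-- Near a boundary point there are charts in which the derivative of `ι` is the inclusion of
coordinate vectors. -/
theorem IsLocalFaceAt.exists_frames (h : IsLocalFaceAt ι b) :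
    ∃ ψ, ∃ (hψ : ψ ∈ maxAtlas B) (e : _) (he : e ∈ maxAtlas P) (i : Fin (n + 1)), b ∈ ψ.source ∧
      ∀ x (hx : x ∈ ψ.source), ∃ hp : ι x ∈ e.source, IsLocalFaceAt ι x ∧ LiesOnFace ι x e i ∧
        ∀ j, mfderiv (Q n) (Q (n + 1)) ι x (frame hψ hx j) = frame he hp (i.succAbove j) := by
  obtain ⟨ψ, hψ, e, he, i, hb, h⟩ := h
  refine ⟨ψ, hψ, e, he, i, hb, fun x hx => ?_⟩
  have hloc : IsLocalFaceAt ι x := ⟨ψ, hψ, e, he, i, hx, h⟩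
  have hp := (h x hx).1
  have hi : LiesOnFace ι x e i := by
    filter_upwards [ψ.open_source.mem_nhds hx] with y hy using (h y hy).2.1
  refine ⟨hp, hloc, hi, fun j => eq_of_chartComponent he hp fun k => ?_⟩
  rw [chartComponent_frame]
  rcases Fin.eq_self_or_eq_succAbove i k with rfl | ⟨l, rfl⟩
  · rw [hi.chartComponent_mfderiv hloc he hp, if_neg (Fin.ne_succAbove _ _)]
  · rw [chartComponent_mfderiv hloc.mdifferentiableAt he hp]
    have heq : (fun y => (e (ι y)).1 (i.succAbove l)) =ᶠ[𝓝 x] fun y => (ψ y).1 l := by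
      filter_upwards [ψ.open_source.mem_nhds hx] with y hy using (h y hy).2.2 l
    rw [heq.mfderiv_eq]
    refine (chartComponent_frame hψ hx l j).trans ?_
    simp only [Fin.succAbove_right_inj]

/-- The basis formed by an outward vector and the coordinate vectors of a face. -/
theorem exists_outward_frame (he : e ∈ maxAtlas P) {p : P} (hp : p ∈ e.source) (i : Fin (n + 1)) :
    ∃ w : Basis (Fin (n + 1)) ℝ (TangentSpace (Q (n + 1)) p), w 0 = -frame he hp i ∧
      (∀ j : Fin n, w j.succ = frame he hp (i.succAbove j)) ∧
      (w.orientation = (frame he hp).orientation ↔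
        (exists_basis_outward i).choose.orientation =
          (EuclideanSpace.basisFun (Fin (n + 1)) ℝ).toBasis.orientation) := by
  obtain ⟨h0, hs⟩ := (exists_basis_outward i).choose_spec
  refine ⟨(exists_basis_outward i).choose.map (chartEquiv he hp).symm.toLinearEquiv, ?_,
    fun j => ?_, ?_⟩
  · rw [Basis.map_apply, h0]
    simp [frame]
  · rw [Basis.map_apply, hs]
    simp [frame]
  · rw [frame, orientation_map_eq_map_iff]

theorem isOutward_neg_frame (he : e ∈ maxAtlas P) (hp : ι b ∈ e.source) (hi : LiesOnFace ι b e i) :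
    IsOutward ι b (-frame he hp i) := by
  refine ⟨e, he, hp, i, hi, ?_⟩
  obtain ⟨χ, hχ⟩ := chartComponent_linear e i (ι b)
  rw [← hχ, map_neg, hχ, chartComponent_frame]
  simp

theorem IsLocalFaceAt.exists_isOutward (h : IsLocalFaceAt ι b) : ∃ ν, IsOutward ι b ν := by
  obtain ⟨ψ, hψ, e, he, i, hb, h⟩ := h.exists_frames
  obtain ⟨hp, -, hi, -⟩ := h b hb
  exact ⟨_, isOutward_neg_frame he hp hi⟩

/-- The orientation of the boundary exists. -/
theorem IsLocalFaceAt.exists_orientation (h : IsLocalFaceAt ι b)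
    (o : Orientation ℝ (TangentSpace (Q (n + 1)) (ι b)) (Fin (n + 1))) :
    ∃ o', IsBoundaryOrientationAt ι b o o' := by
  obtain ⟨ψ, hψ, e, he, i, hb, h'⟩ := h.exists_frames
  obtain ⟨hp, -, hi, hj⟩ := h' b hb
  obtain ⟨w, hw0, hws, -⟩ := exists_outward_frame he hp i
  have key : ∀ o', (w.orientation = o ↔ (frame hψ hb).orientation = o') →
      IsBoundaryOrientationAt ι b o o' := fun o' ho' =>
    isBoundaryOrientationAt_of_basis h (frame hψ hb) w
      (by rw [hw0]; exact isOutward_neg_frame he hp hi) (fun j => by rw [hws, hj]) ho'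
  by_cases hw : w.orientation = o
  · exact ⟨_, key (frame hψ hb).orientation (by simp [hw])⟩
  · refine ⟨_, key (-(frame hψ hb).orientation) ?_⟩
    have : ¬ (frame hψ hb).orientation = -(frame hψ hb).orientation := by
      rw [orientation_eq_neg_iff]
      simp
    simp [hw, this]

/-- The boundary orientation of an orientation is locally constant. -/
theorem isOrientationField_of_isBoundaryOrientation (h : ∀ b, IsLocalFaceAt ι b)
    {o : OrientationField P} (ho : IsOrientationField o) {o' : OrientationField B}
    (hb : IsBoundaryOrientation ι o o') : IsOrientationField o' := by
  refine isOrientationField_of_frames fun b => ?_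
  obtain ⟨ψ, hψ, e, he, i, hbψ, h'⟩ := (h b).exists_frames
  refine ⟨ψ, hψ, hbψ, ?_⟩
  have key : ∀ x (hx : x ∈ ψ.source) (hp : ι x ∈ e.source),
      ((frame hψ hx).orientation = o' x ↔ ((frame he hp).orientation = o (ι x) ↔
        (exists_basis_outward i).choose.orientation =
          (EuclideanSpace.basisFun (Fin (n + 1)) ℝ).toBasis.orientation)) := by
    intro x hx hp
    obtain ⟨_, -, hi, hj⟩ := h' x hx
    obtain ⟨w, hw0, hws, hwo⟩ := exists_outward_frame he hp i
    obtain ⟨w', hw'0, hw's, hw'o⟩ := hb x _ (isOutward_neg_frame he hp hi) (frame hψ hx)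
    have : w' = w := Basis.eq_of_apply_eq fun k => by
      refine Fin.cases ?_ (fun j => ?_) k
      · rw [hw'0, hw0]
      · rw [hw's, hws, hj]
    subst this
    rw [orientation_eq_iff_iff _ _ (o (ι x))] at hwo
    tauto
  obtain ⟨hp, hloc, -⟩ := h' b hbψ
  filter_upwards [hloc.continuousAt.eventually (ho.eventually_frame he hp)] with x hx hxs
  obtain ⟨hpx, -⟩ := h' x hxs
  rw [key x hxs hpx, key b hbψ hp, hx hpx]

/-- The boundary orientation is unique, also for different models of the boundary. -/
theorem carries_of_isBoundaryOrientationAt {B' : CornerMfd n} {ι' : B' → P} {f : B → B'}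
    (hf : MDifferentiableAt (Q n) (Q n) f b) (hff : ∀ x, ι' (f x) = ι x)
    (hinj : Function.Bijective (mfderiv (Q n) (Q n) f b)) (h : IsLocalFaceAt ι b)
    (h' : IsLocalFaceAt ι' (f b))
    (he : e ∈ maxAtlas P) (hp : ι b ∈ e.source) (hi : LiesOnFace ι b e i)
    (hi' : LiesOnFace ι' (f b) e i) {o : OrientationField P}
    {o₁ : Orientation ℝ (TangentSpace (Q n) b) (Fin n)}
    {o₂ : Orientation ℝ (TangentSpace (Q n) (f b)) (Fin n)}
    (h₁ : IsBoundaryOrientationAt ι b (o (ι b)) o₁)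
    (h₂ : IsBoundaryOrientationAt ι' (f b) (o (ι' (f b))) o₂) :
    Carries (mfderiv (Q n) (Q n) f b) o₁ o₂ := by
  obtain ⟨v⟩ : Nonempty (Basis (Fin n) ℝ (TangentSpace (Q n) b)) :=
    ⟨(EuclideanSpace.basisFun (Fin n) ℝ).toBasis⟩
  set A : TangentSpace (Q n) b ≃ₗ[ℝ] TangentSpace (Q n) (f b) :=
    LinearEquiv.ofBijective (mfderiv (Q n) (Q n) f b).toLinearMap hinj with hA
  refine carries_of_basis (L := (mfderiv (Q n) (Q n) f b).toLinearMap) v (v.map A) (fun j => rfl) ?_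
  have hcomp : (fun x => ι' (f x)) = ι := funext hff
  subst hcomp
  have hd : ∀ x, mfderiv (Q n) (Q (n + 1)) (fun x => ι' (f x)) b x =
      mfderiv (Q n) (Q (n + 1)) ι' (f b) (mfderiv (Q n) (Q n) f b x) := by
    intro x
    have := mfderiv_comp (I' := Q n) b h'.mdifferentiableAt hf
    exact DFunLike.congr_fun this x
  obtain ⟨w, hw0, hws, hwo⟩ := h₁ _ (isOutward_neg_frame (ι := fun x => ι' (f x)) he hp hi) v
  obtain ⟨w', hw'0, hw's, hw'o⟩ := h₂ _ (isOutward_neg_frame (ι := ι') he hp hi') (v.map A)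
  have : w' = w := Basis.eq_of_apply_eq fun k => by
    refine Fin.cases ?_ (fun j => ?_) k
    · rw [hw'0, hw0]
    · rw [hw's, hws, hd]
      rfl
  rw [← hwo, ← hw'o, this]

end BoundaryOrientation

/-! ### Existence of geometric boundaries -/

/-- A point of the geometric boundary of `P`: a point of `P` together with a face through it of the
preferred chart at this point. -/
structure FacePoint {n : ℕ} (P : CornerMfd (n + 1)) : Type where
  pt : P
  idx : Fin (n + 1)
  zero : (chartAt (EuclideanQuadrant (n + 1)) pt pt).1 idx = 0

namespace FacePoint

variable {n : ℕ} {P : CornerMfd (n + 1)}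
  {e e' : OpenPartialHomeomorph P (EuclideanQuadrant (n + 1))} {i i' : Fin (n + 1)}

/-- The local face `b` is the face `{xᵢ = 0}` of the chart `e`. -/
def OnFace (b : FacePoint P) (e : OpenPartialHomeomorph P (EuclideanQuadrant (n + 1)))
    (i : Fin (n + 1)) : Prop :=
  b.pt ∈ e.source ∧ SameFace (chartAt (EuclideanQuadrant (n + 1)) b.pt) b.idx e i b.pt

theorem onFace_self (b : FacePoint P) :
    b.OnFace (chartAt (EuclideanQuadrant (n + 1)) b.pt) b.idx :=
  ⟨mem_chart_source _ _, SameFace.refl _ _ _⟩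

theorem OnFace.zero {b : FacePoint P} (h : b.OnFace e i) : (e b.pt).1 i = 0 :=
  h.2.zero_iff.1 b.zero

theorem OnFace.eq {b b' : FacePoint P} (h : b.OnFace e i) (h' : b'.OnFace e i)
    (hpt : b.pt = b'.pt) : b = b' := by
  obtain ⟨p, k, hk⟩ := b
  obtain ⟨p', k', hk'⟩ := b'
  obtain rfl : p = p' := hpt
  obtain rfl : k = k' := (SameFace.refl _ k p).unique (mem_chart_source _ _) (h.2.trans h'.2.symm) hk
  rfl

theorem OnFace.iff {b : FacePoint P} (h : b.OnFace e i) :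
    b.OnFace e' i' ↔ b.pt ∈ e'.source ∧ SameFace e i e' i' b.pt :=
  ⟨fun h' => ⟨h'.1, h.2.symm.trans h'.2⟩, fun h' => ⟨h'.1, h.2.trans h'.2⟩⟩

theorem exists_onFace (he : e ∈ maxAtlas P) {p : P} (hp : p ∈ e.source) (hi : (e p).1 i = 0) :
    ∃ b : FacePoint P, b.pt = p ∧ b.OnFace e i := by
  obtain ⟨j, hj, -⟩ := exists_sameFace he (chart_mem_maxAtlas p) hp (mem_chart_source _ p) hi
  exact ⟨⟨p, j, hj.zero_iff.1 hi⟩, rfl, hp, hj.symm⟩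

theorem exists_onFace_symm (he : e ∈ maxAtlas P) {y : EuclideanQuadrant n}
    (hy : insertZero i y ∈ e.target) :
    ∃ b : FacePoint P, b.pt = e.symm (insertZero i y) ∧ b.OnFace e i :=
  exists_onFace he (e.map_target hy) (by rw [e.right_inv hy, insertZero_same])

open Classical in
/-- The chart of the boundary given by the face `{xᵢ = 0}` of the chart `e` of `P`. (The point `b₀`
only serves as a value outside the target.) -/
def faceChart (e : maxAtlas P) (i : Fin (n + 1)) (b₀ : FacePoint P) :
    PartialEquiv (FacePoint P) (EuclideanQuadrant n) where
  toFun b := removeCoord i (e.1 b.pt)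
  invFun y := if h : insertZero i y ∈ e.1.target then (exists_onFace_symm e.2 h).choose else b₀
  source := {b | b.OnFace e.1 i}
  target := {y | insertZero i y ∈ e.1.target}
  map_source' b hb := by
    change insertZero i (removeCoord i (e.1 b.pt)) ∈ e.1.target
    rw [insertZero_removeCoord hb.zero]
    exact e.1.map_source hb.1
  map_target' y hy := by
    have hy' : insertZero i y ∈ e.1.target := hy
    rw [dif_pos hy']
    exact (exists_onFace_symm e.2 hy').choose_spec.2
  left_inv' b hb := by
    have hb' : b.OnFace e.1 i := hb
    have hy' : insertZero i (removeCoord i (e.1 b.pt)) ∈ e.1.target := by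
      rw [insertZero_removeCoord hb'.zero]
      exact e.1.map_source hb'.1
    rw [dif_pos hy']
    obtain ⟨h1, h2⟩ := (exists_onFace_symm e.2 hy').choose_spec
    refine h2.eq hb' (h1.trans ?_)
    rw [insertZero_removeCoord hb'.zero, e.1.left_inv hb'.1]
  right_inv' y hy := by
    have hy' : insertZero i y ∈ e.1.target := hy
    rw [dif_pos hy', (exists_onFace_symm e.2 hy').choose_spec.1, e.1.right_inv hy',
      removeCoord_insertZero]

theorem faceChart_symm (e : maxAtlas P) (i : Fin (n + 1)) (b₀ : FacePoint P)
    {y : EuclideanQuadrant n} (hy : insertZero i y ∈ e.1.target) :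
    ((faceChart e i b₀).symm y).pt = e.1.symm (insertZero i y) ∧
      ((faceChart e i b₀).symm y).OnFace e.1 i := by
  have h := (exists_onFace_symm e.2 hy).choose_spec
  have heq : (faceChart e i b₀).symm y = (exists_onFace_symm e.2 hy).choose := dif_pos hy
  rw [heq]
  exact h

theorem faceChart_trans_source (e e' : maxAtlas P) (i i' : Fin (n + 1)) (b₀ b₀' : FacePoint P) :
    ((faceChart e i b₀).symm.trans (faceChart e' i' b₀')).source =
      (insertZero i ⁻¹' e.1.target) ∩ (fun y => e.1.symm (insertZero i y)) ⁻¹'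
        (e'.1.source ∩ {q | SameFace e.1 i e'.1 i' q}) := by
  ext y
  rw [PartialEquiv.trans_source]
  constructor
  · rintro ⟨h1, h2⟩
    have h1 : insertZero i y ∈ e.1.target := h1
    obtain ⟨h3, h4⟩ := faceChart_symm e i b₀ h1
    have h5 := h4.iff.1 h2
    rw [h3] at h5
    exact ⟨h1, h5⟩
  · rintro ⟨h1, h2⟩
    obtain ⟨h3, h4⟩ := faceChart_symm e i b₀ h1
    refine ⟨h1, h4.iff.2 ?_⟩
    rw [h3]
    exact h2

theorem contMDiffOn_symm_insertZero (e : maxAtlas P) (i : Fin (n + 1)) :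
    ContMDiffOn (Q n) (Q (n + 1)) ∞ (fun y => e.1.symm (insertZero i y))
      (insertZero i ⁻¹' e.1.target) :=
  (contMDiffOn_symm_of_mem_maximalAtlas e.2).comp (contMDiff_insertZero i).contMDiffOn
    fun _ hy => hy

theorem contMDiffOn_faceChart_trans (e e' : maxAtlas P) (i i' : Fin (n + 1))
    (b₀ b₀' : FacePoint P) :
    ContMDiffOn (Q n) (Q n) ∞ ((faceChart e i b₀).symm.trans (faceChart e' i' b₀'))
      ((faceChart e i b₀).symm.trans (faceChart e' i' b₀')).source := by
  rw [faceChart_trans_source]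
  have h : ContMDiffOn (Q n) (Q n) ∞
      (fun y => removeCoord i' (e'.1 (e.1.symm (insertZero i y)))) ((insertZero i ⁻¹' e.1.target) ∩
        (fun y => e.1.symm (insertZero i y)) ⁻¹' (e'.1.source ∩ {q | SameFace e.1 i e'.1 i' q})) := by
    refine (contMDiff_removeCoord i').comp_contMDiffOn ?_
    exact (contMDiffOn_of_mem_maximalAtlas e'.2).comp
      ((contMDiffOn_symm_insertZero e i).mono inter_subset_left) fun y hy => hy.2.1
  refine h.congr fun y hy => ?_
  change removeCoord i' (e'.1 ((faceChart e i b₀).symm y).pt) = _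
  rw [(faceChart_symm e i b₀ hy.1).1]

theorem isOpen_faceChart_trans_source (e e' : maxAtlas P) (i i' : Fin (n + 1))
    (b₀ b₀' : FacePoint P) :
    IsOpen ((faceChart e i b₀).symm.trans (faceChart e' i' b₀')).source := by
  rw [faceChart_trans_source]
  refine (contMDiffOn_symm_insertZero e i).continuousOn.isOpen_inter_preimage
    (e.1.open_target.preimage (contMDiff_insertZero i).continuous) ?_
  exact e'.1.open_source.inter isOpen_setOfPred_eventually_nhds

variable (P) in
/-- The atlas of the geometric boundary. -/
def core : ChartedSpaceCore (EuclideanQuadrant n) (FacePoint P) where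
  atlas := {f | ∃ e i b₀, f = faceChart e i b₀}
  chartAt b := faceChart ⟨_, chart_mem_maxAtlas b.pt⟩ b.idx b
  mem_chart_source b := b.onFace_self
  chart_mem_atlas b := ⟨_, _, _, rfl⟩
  open_source := by
    rintro _ _ ⟨e, i, b₀, rfl⟩ ⟨e', i', b₀', rfl⟩
    exact isOpen_faceChart_trans_source e e' i i' b₀ b₀'
  continuousOn_toFun := by
    rintro _ _ ⟨e, i, b₀, rfl⟩ ⟨e', i', b₀', rfl⟩
    exact (contMDiffOn_faceChart_trans e e' i i' b₀ b₀').continuousOn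

instance : TopologicalSpace (FacePoint P) := (core P).toTopologicalSpace

instance : ChartedSpace (EuclideanQuadrant n) (FacePoint P) := (core P).toChartedSpace

/-- The charts of the boundary as homeomorphisms. -/
def faceHomeo (e : maxAtlas P) (i : Fin (n + 1)) (b₀ : FacePoint P) :
    OpenPartialHomeomorph (FacePoint P) (EuclideanQuadrant n) :=
  (core P).openPartialHomeomorph (faceChart e i b₀) ⟨e, i, b₀, rfl⟩

theorem faceHomeo_mem_atlas (e : maxAtlas P) (i : Fin (n + 1)) (b₀ : FacePoint P) :
    faceHomeo e i b₀ ∈ atlas (EuclideanQuadrant n) (FacePoint P) := by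
  change faceHomeo e i b₀ ∈ ⋃ (f : PartialEquiv (FacePoint P) (EuclideanQuadrant n))
    (hf : f ∈ (core P).atlas), {(core P).openPartialHomeomorph f hf}
  simp only [mem_iUnion, mem_singleton_iff]
  exact ⟨_, ⟨e, i, b₀, rfl⟩, rfl⟩

theorem exists_eq_faceHomeo {f : OpenPartialHomeomorph (FacePoint P) (EuclideanQuadrant n)}
    (hf : f ∈ atlas (EuclideanQuadrant n) (FacePoint P)) : ∃ e i b₀, f = faceHomeo e i b₀ := by
  change f ∈ ⋃ (f : PartialEquiv (FacePoint P) (EuclideanQuadrant n))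
    (hf : f ∈ (core P).atlas), {(core P).openPartialHomeomorph f hf} at hf
  simp only [mem_iUnion, mem_singleton_iff] at hf
  obtain ⟨_, ⟨e, i, b₀, rfl⟩, rfl⟩ := hf
  exact ⟨e, i, b₀, rfl⟩

instance : IsManifold (Q n) ∞ (FacePoint P) := by
  refine isManifold_of_contDiffOn (Q n) ∞ (FacePoint P) fun f f' hf hf' => ?_
  obtain ⟨e, i, b₀, rfl⟩ := exists_eq_faceHomeo hf
  obtain ⟨e', i', b₀', rfl⟩ := exists_eq_faceHomeo hf'
  rw [← contMDiffOn_iff_contDiffOn]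
  refine (Q n).contMDiff.comp_contMDiffOn ?_
  exact (contMDiffOn_faceChart_trans e e' i i' b₀ b₀').comp
    ((Q n).contMDiffOn_symm.mono inter_subset_right) fun y hy => hy.1

theorem isOpen_onFace (he : e ∈ maxAtlas P) (i : Fin (n + 1)) :
    IsOpen {b : FacePoint P | b.OnFace e i} := by
  by_cases h : Nonempty (FacePoint P)
  · exact (faceHomeo ⟨e, he⟩ i h.some).open_source
  · convert! isOpen_empty
    ext b
    exact absurd ⟨b⟩ h

theorem continuous_pt : Continuous (pt : FacePoint P → P) := by
  rw [continuous_iff_continuousAt]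
  intro b
  let e : maxAtlas P := ⟨_, chart_mem_maxAtlas b.pt⟩
  have hb : b ∈ (faceHomeo e b.idx b).source := b.onFace_self
  have heq : ∀ x ∈ (faceHomeo e b.idx b).source,
      e.1.symm (insertZero b.idx (faceHomeo e b.idx b x)) = x.pt := by
    intro x hx
    have hx' : x.OnFace e.1 b.idx := hx
    change e.1.symm (insertZero b.idx (removeCoord b.idx (e.1 x.pt))) = x.pt
    rw [insertZero_removeCoord hx'.zero, e.1.left_inv hx'.1]
  have h1 : ContinuousAt (fun x => e.1.symm (insertZero b.idx (faceHomeo e b.idx b x))) b := by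
    have hc := (faceHomeo e b.idx b).map_source hb
    refine ContinuousAt.comp (f := faceHomeo e b.idx b)
      (g := fun y => e.1.symm (insertZero b.idx y)) ?_ ((faceHomeo e b.idx b).continuousAt hb)
    exact (contMDiffOn_symm_insertZero e b.idx).continuousOn.continuousAt
      ((e.1.open_target.preimage (contMDiff_insertZero b.idx).continuous).mem_nhds hc)
  refine h1.congr ?_
  filter_upwards [(faceHomeo e b.idx b).open_source.mem_nhds hb] with x hx using heq x hx

instance : T2Space (FacePoint P) := by
  refine ⟨fun b b' hne => ?_⟩
  by_cases hpt : b.pt = b'.pt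
  · -- two faces of the same chart are disjoint
    set e := chartAt (EuclideanQuadrant (n + 1)) b.pt with he
    have hb' : b'.OnFace e b'.idx := by
      have := b'.onFace_self
      rwa [← hpt] at this
    refine ⟨_, _, isOpen_onFace (chart_mem_maxAtlas b.pt) b.idx,
      isOpen_onFace (chart_mem_maxAtlas b.pt) b'.idx, b.onFace_self, hb', ?_⟩
    refine Set.disjoint_left.2 fun x hx hx' => hne ?_
    have hx : x.OnFace e b.idx := hx
    have hx' : x.OnFace e b'.idx := hx'
    have hidx : b.idx = b'.idx :=
      (SameFace.refl e b.idx x.pt).unique hx.1 (hx.2.symm.trans hx'.2) hx.zero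
    exact b.onFace_self.eq (by rwa [← hidx] at hb') hpt
  · obtain ⟨U, V, hU, hV, hbU, hbV, hUV⟩ := t2_separation hpt
    exact ⟨_, _, hU.preimage continuous_pt, hV.preimage continuous_pt, hbU, hbV,
      hUV.preimage pt⟩

instance : SecondCountableTopology (FacePoint P) := by
  obtain ⟨s, hs, hcov⟩ := TopologicalSpace.countable_cover_nhds (α := P)
    (f := fun p => (chartAt (EuclideanQuadrant (n + 1)) p).source) fun p => chart_source_mem_nhds _ p
  have : Countable s := hs
  by_cases hne : Nonempty (FacePoint P)
  swap
  · have : IsEmpty (FacePoint P) := not_nonempty_iff.1 hne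
    infer_instance
  have : SecondCountableTopology (EuclideanQuadrant n) :=
    inferInstanceAs (SecondCountableTopology {x : Vec n // ∀ i : Fin n, 0 ≤ x i})
  let U : s × Fin (n + 1) → Set (FacePoint P) := fun a =>
    (faceHomeo ⟨_, chart_mem_maxAtlas a.1.1⟩ a.2 hne.some).source
  have : ∀ a, SecondCountableTopology (U a) := fun a =>
    (faceHomeo ⟨_, chart_mem_maxAtlas a.1.1⟩ a.2 hne.some).secondCountableTopology_source
  refine TopologicalSpace.secondCountableTopology_of_countable_cover (U := U)
    (fun a => (faceHomeo _ _ _).open_source) (eq_univ_of_forall fun b => ?_)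
  have hb : b.pt ∈ ⋃ p ∈ s, (chartAt (EuclideanQuadrant (n + 1)) p).source := by
    rw [hcov]; trivial
  simp only [mem_iUnion, exists_prop] at hb
  obtain ⟨p, hp, hbp⟩ := hb
  obtain ⟨j, hj, -⟩ := exists_sameFace (chart_mem_maxAtlas b.pt) (chart_mem_maxAtlas p)
    (mem_chart_source _ _) hbp b.zero
  exact mem_iUnion.2 ⟨⟨⟨p, hp⟩, j⟩, hbp, hj⟩

end FacePoint

/-- The geometric boundary of a manifold with corners. -/
def boundaryMfd {n : ℕ} (P : CornerMfd (n + 1)) : CornerMfd n where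
  carrier := FacePoint P

theorem isGeometricBoundary_pt {n : ℕ} (P : CornerMfd (n + 1)) :
    IsGeometricBoundary (B := boundaryMfd P) (P := P) FacePoint.pt := by
  have hlies : ∀ (e : maxAtlas P) (i : Fin (n + 1)) (b : FacePoint P), b.OnFace e.1 i →
      LiesOnFace (B := boundaryMfd P) (P := P) FacePoint.pt b e.1 i := by
    intro e i b hb
    filter_upwards [(FacePoint.isOpen_onFace e.2 i).mem_nhds hb] with x hx
    exact FacePoint.OnFace.zero hx
  have hloc : ∀ b : boundaryMfd P, IsLocalFaceAt (B := boundaryMfd P) (P := P) FacePoint.pt b := by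
    intro (b : FacePoint P)
    refine ⟨FacePoint.faceHomeo ⟨_, chart_mem_maxAtlas b.pt⟩ b.idx b,
      IsManifold.subset_maximalAtlas (FacePoint.faceHomeo_mem_atlas _ _ _), _,
      chart_mem_maxAtlas b.pt, b.idx, b.onFace_self, fun x hx => ?_⟩
    have hx : FacePoint.OnFace x _ b.idx := hx
    exact ⟨hx.1, hx.zero, fun j => rfl⟩
  refine IsGeometricBoundary.of_exists_chart hloc fun p =>
    ⟨_, chart_mem_maxAtlas p, mem_chart_source _ p, fun i hi => ?_⟩
  let b : FacePoint P := ⟨p, i, hi⟩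
  refine ⟨b, ⟨rfl, hlies ⟨_, chart_mem_maxAtlas p⟩ i b b.onFace_self⟩, ?_⟩
  rintro y ⟨rfl, hy2⟩
  have h1 := hlies ⟨_, chart_mem_maxAtlas _⟩ _ y (FacePoint.onFace_self y)
  have h2 := h1.unique (hloc y) (chart_mem_maxAtlas _) (mem_chart_source _ _) hy2
  subst h2
  rfl

/-! ### Local diffeomorphisms, faces and boundary orientations -/

section LocalDiffeo

open Module

/-- A local diffeomorphism transports charts of the source to charts of the target. -/
theorem exists_chart_of_isLocalDiffeomorphAt {n : ℕ} {X Y : CornerMfd n} {j : X → Y} {x₀ : X}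
    (hj : IsLocalDiffeomorphAt (Q n) (Q n) ∞ j x₀) {ψ : OpenPartialHomeomorph X (EuclideanQuadrant n)}
    (hψ : ψ ∈ maxAtlas X) (hx : x₀ ∈ ψ.source) :
    ∃ ψ' ∈ maxAtlas Y, j x₀ ∈ ψ'.source ∧ (∀ᶠ x in 𝓝 x₀, ψ' (j x) = ψ x) ∧
      ∃ s : Y → X, ∀ y ∈ ψ'.source, s y ∈ ψ.source ∧ j (s y) = y ∧ ψ' y = ψ (s y) := by
  obtain ⟨Φ, hxΦ, hΦ⟩ := hj
  let Ψ := Φ.toOpenPartialHomeomorph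
  refine ⟨Ψ.symm.trans ψ, ?_, ?_, ?_, Ψ.symm, ?_⟩
  · have h := (IsManifold.mem_maximalAtlas_iff_contMDiffOn (I := Q n) (n := ∞) ψ).1 hψ
    refine OpenPartialHomeomorph.mem_maximalAtlas_of_contMDiffOn _ ?_ ?_
    · refine h.1.comp (Φ.contMDiffOn_invFun.mono fun y hy => ?_) fun y hy => ?_
      · exact (OpenPartialHomeomorph.trans_source Ψ.symm ψ ▸ hy).1
      · exact (OpenPartialHomeomorph.trans_source Ψ.symm ψ ▸ hy).2
    · refine Φ.contMDiffOn_toFun.comp (h.2.mono fun y hy => ?_) fun y hy => ?_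
      · exact (OpenPartialHomeomorph.trans_target Ψ.symm ψ ▸ hy).1
      · exact (OpenPartialHomeomorph.trans_target Ψ.symm ψ ▸ hy).2
  · rw [hΦ hxΦ]
    refine (OpenPartialHomeomorph.trans_source Ψ.symm ψ).symm ▸ ⟨Ψ.map_source hxΦ, ?_⟩
    change Ψ.symm (Ψ x₀) ∈ ψ.source
    rwa [Ψ.left_inv hxΦ]
  · filter_upwards [Φ.open_source.mem_nhds hxΦ] with x hx
    rw [hΦ hx]
    exact congrArg ψ (Ψ.left_inv hx)
  · intro y hy
    rw [OpenPartialHomeomorph.trans_source] at hy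
    refine ⟨hy.2, ?_, rfl⟩
    rw [hΦ (Ψ.symm.map_source hy.1)]
    exact Ψ.right_inv hy.1

theorem map_nhds_of_isLocalDiffeomorphAt {n : ℕ} {X Y : CornerMfd n} {j : X → Y} {x₀ : X}
    (hj : IsLocalDiffeomorphAt (Q n) (Q n) ∞ j x₀) : map j (𝓝 x₀) = 𝓝 (j x₀) := by
  obtain ⟨Φ, hxΦ, hΦ⟩ := hj
  have h := Φ.toOpenPartialHomeomorph.map_nhds_eq hxΦ
  have h2 : map j (𝓝 x₀) = map Φ.toOpenPartialHomeomorph (𝓝 x₀) :=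
    map_congr (by filter_upwards [Φ.open_source.mem_nhds hxΦ] with x hx using hΦ hx)
  rw [h2, h, hΦ hxΦ]
  rfl

theorem isLocalDiffeomorphAt_inl {n : ℕ} {X Y : CornerMfd n} (x₀ : X) :
    IsLocalDiffeomorphAt (Q n) (Q n) ∞ (Sum.inl : X → X ⊕ Y) x₀ :=
  ⟨{ toFun := Sum.inl
     invFun := Sum.elim id fun _ => x₀
     source := univ
     target := range Sum.inl
     map_source' := fun x _ => ⟨x, rfl⟩
     map_target' := fun _ _ => trivial
     left_inv' := fun _ _ => rfl
     right_inv' := by rintro _ ⟨x, rfl⟩; rfl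
     open_source := isOpen_univ
     open_target := isOpen_range_inl
     contMDiffOn_toFun := ContMDiff.inl.contMDiffOn
     contMDiffOn_invFun := (contMDiff_id.sumElim contMDiff_const).contMDiffOn },
    trivial, fun _ _ => rfl⟩

theorem isLocalDiffeomorphAt_inr {n : ℕ} {X Y : CornerMfd n} (y₀ : Y) :
    IsLocalDiffeomorphAt (Q n) (Q n) ∞ (Sum.inr : Y → X ⊕ Y) y₀ :=
  ⟨{ toFun := Sum.inr
     invFun := Sum.elim (fun _ => y₀) id
     source := univ
     target := range Sum.inr
     map_source' := fun x _ => ⟨x, rfl⟩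
     map_target' := fun _ _ => trivial
     left_inv' := fun _ _ => rfl
     right_inv' := by rintro _ ⟨x, rfl⟩; rfl
     open_source := isOpen_univ
     open_target := isOpen_range_inr
     contMDiffOn_toFun := ContMDiff.inr.contMDiffOn
     contMDiffOn_invFun := (contMDiff_const.sumElim contMDiff_id).contMDiffOn },
    trivial, fun _ _ => rfl⟩

/-- The disjoint union of manifolds with corners. -/
abbrev sumMfd {n : ℕ} (X Y : CornerMfd n) : CornerMfd n := { carrier := X ⊕ Y }

theorem carries_inl {n : ℕ} {X Y : CornerMfd n} (x : X)
    (o : Orientation ℝ (TangentSpace (Q n) x) (Fin n)) :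
    Carries (mfderiv (Q n) (Q n) (Sum.inl : X → sumMfd X Y) x) o
      (o : Orientation ℝ (TangentSpace (Q n) (Sum.inl x : X ⊕ Y)) (Fin n)) := by
  have h := (hasMFDerivAt_inl (I := Q n) (M := X) (M' := Y) (q := x) (p := Sum.inl x)).mfderiv
  refine ⟨LinearEquiv.refl ℝ _, fun v => ?_, ?_⟩
  · exact (congrArg (fun L : Vec n →L[ℝ] Vec n => L v) h).symm
  · exact congrFun (congrArg _ (Orientation.map_refl (ι := Fin n) (R := ℝ) (M := Vec n))) o

theorem carries_inr {n : ℕ} {X Y : CornerMfd n} (y : Y)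
    (o : Orientation ℝ (TangentSpace (Q n) y) (Fin n)) :
    Carries (mfderiv (Q n) (Q n) (Sum.inr : Y → sumMfd X Y) y) o
      (o : Orientation ℝ (TangentSpace (Q n) (Sum.inr y : X ⊕ Y)) (Fin n)) := by
  have h := (hasMFDerivAt_inr (I := Q n) (M := X) (M' := Y) (q' := y) (p := Sum.inr y)).mfderiv
  refine ⟨LinearEquiv.refl ℝ _, fun v => ?_, ?_⟩
  · exact (congrArg (fun L : Vec n →L[ℝ] Vec n => L v) h).symm
  · exact congrFun (congrArg _ (Orientation.map_refl (ι := Fin n) (R := ℝ) (M := Vec n))) o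

variable {n : ℕ} {B B' : CornerMfd n} {P P' : CornerMfd (n + 1)} {ι : B → P} {b : B}
  {e : OpenPartialHomeomorph P (EuclideanQuadrant (n + 1))}
  {e' : OpenPartialHomeomorph P' (EuclideanQuadrant (n + 1))} {i : Fin (n + 1)}

/-- To be the inclusion of a local face it suffices to be so near the given point. -/
theorem IsLocalFaceAt.of_eventually (h : ∃ ψ ∈ maxAtlas B, ∃ e ∈ maxAtlas P, ∃ i : Fin (n + 1),
    b ∈ ψ.source ∧ ∀ᶠ b' in 𝓝 b, ι b' ∈ e.source ∧ (e (ι b')).1 i = 0 ∧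
      ∀ j : Fin n, (e (ι b')).1 (i.succAbove j) = (ψ b').1 j) : IsLocalFaceAt ι b := by
  obtain ⟨ψ, hψ, e, he, i, hb, h⟩ := h
  obtain ⟨U, hU, hUo, hbU⟩ := eventually_nhds_iff.1 h
  refine ⟨ψ.restr U, restr_mem_maximalAtlas _ hψ hUo, e, he, i, ?_, fun b' hb' => ?_⟩
  · rw [ψ.restr_source' U hUo]; exact ⟨hb, hbU⟩
  · rw [ψ.restr_source' U hUo] at hb'
    exact hU _ hb'.2

theorem IsLocalFaceAt.of_comp {j : B → B'} {κ : B' → P} (hj : IsLocalDiffeomorphAt (Q n) (Q n) ∞ j b)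
    (h : IsLocalFaceAt (fun x => κ (j x)) b) : IsLocalFaceAt κ (j b) := by
  obtain ⟨ψ, hψ, e, he, i, hb, h⟩ := h
  obtain ⟨ψ', hψ', hb', -, s, hs⟩ := exists_chart_of_isLocalDiffeomorphAt hj hψ hb
  refine ⟨ψ', hψ', e, he, i, hb', fun y hy => ?_⟩
  obtain ⟨h1, h2, h3⟩ := hs y hy
  have := h _ h1
  beta_reduce at this
  rw [h2] at this
  rwa [h3]

theorem IsLocalFaceAt.comp {k : P → P'} (hk : IsLocalDiffeomorphAt (Q (n + 1)) (Q (n + 1)) ∞ k (ι b))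
    (h : IsLocalFaceAt ι b) : IsLocalFaceAt (fun x => k (ι x)) b := by
  have hc := h.continuousAt
  obtain ⟨ψ, hψ, e, he, i, hb, h⟩ := h
  obtain ⟨e', he', hb', hee, -⟩ := exists_chart_of_isLocalDiffeomorphAt hk he (h b hb).1
  refine .of_eventually ⟨ψ, hψ, e', he', i, hb, ?_⟩
  have hk' := hc.eventually (((map_nhds_of_isLocalDiffeomorphAt hk).le
    (e'.open_source.mem_nhds hb') : _))
  filter_upwards [ψ.open_source.mem_nhds hb, hc.eventually hee, hk'] with x hx hx2 hx3
  refine ⟨hx3, ?_⟩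
  rw [hx2]
  exact (h x hx).2

theorem liesOnFace_comp_iff {j : B → B'} {κ : B' → P}
    (hj : IsLocalDiffeomorphAt (Q n) (Q n) ∞ j b) :
    LiesOnFace (fun x => κ (j x)) b e i ↔ LiesOnFace κ (j b) e i := by
  unfold LiesOnFace
  rw [← map_nhds_of_isLocalDiffeomorphAt hj, eventually_map]

theorem liesOnFace_iff_of_eventually {k : P → P'} (hc : ContinuousAt ι b)
    (h : ∀ᶠ x in 𝓝 (ι b), e' (k x) = e x) :
    LiesOnFace (fun x => k (ι x)) b e' i ↔ LiesOnFace ι b e i := by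
  refine eventually_congr ?_
  filter_upwards [hc.eventually h] with x hx
  rw [hx]

theorem IsOutward.comp {k : P → P'} (hk : IsLocalDiffeomorphAt (Q (n + 1)) (Q (n + 1)) ∞ k (ι b))
    (hc : ContinuousAt ι b) {ν : TangentSpace (Q (n + 1)) (ι b)} (h : IsOutward ι b ν) :
    IsOutward (fun x => k (ι x)) b (mfderiv (Q (n + 1)) (Q (n + 1)) k (ι b) ν) := by
  obtain ⟨e, he, hp, i, hi, hν⟩ := h
  obtain ⟨e', he', hb', hee, -⟩ := exists_chart_of_isLocalDiffeomorphAt hk he hp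
  refine ⟨e', he', hb', i, (liesOnFace_iff_of_eventually hc hee).2 hi, ?_⟩
  rw [chartComponent_mfderiv (hk.mdifferentiableAt (by simp)) he' hb']
  have : (fun y => (e' (k y)).1 i) =ᶠ[𝓝 (ι b)] fun y => (e y).1 i := by
    filter_upwards [hee] with y hy
    rw [hy]
  rw [this.mfderiv_eq]
  exact hν

theorem isOutward_comp_iff {j : B → B'} {κ : B' → P} (hj : IsLocalDiffeomorphAt (Q n) (Q n) ∞ j b)
    {ν : TangentSpace (Q (n + 1)) (κ (j b))} :
    IsOutward (fun x => κ (j x)) b ν ↔ IsOutward κ (j b) ν := by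
  simp only [IsOutward, liesOnFace_comp_iff hj]

theorem IsBoundaryOrientationAt.comp {k : P → P'}
    (hk : IsLocalDiffeomorphAt (Q (n + 1)) (Q (n + 1)) ∞ k (ι b)) (hι : IsLocalFaceAt ι b)
    {o : Orientation ℝ (TangentSpace (Q (n + 1)) (ι b)) (Fin (n + 1))}
    {o' : Orientation ℝ (TangentSpace (Q (n + 1)) (k (ι b))) (Fin (n + 1))}
    {o₁ : Orientation ℝ (TangentSpace (Q n) b) (Fin n)}
    (ho : Carries (mfderiv (Q (n + 1)) (Q (n + 1)) k (ι b)) o o')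
    (h : IsBoundaryOrientationAt ι b o o₁) :
    IsBoundaryOrientationAt (fun x => k (ι x)) b o' o₁ := by
  obtain ⟨ν, hν⟩ := hι.exists_isOutward
  let v := frame (chart_mem_maxAtlas b) (mem_chart_source _ b)
  obtain ⟨w, hw0, hws, hwo⟩ := h ν hν v
  obtain ⟨w', hw', hwo'⟩ := ho.basis w
  refine isBoundaryOrientationAt_of_basis (hι.comp hk) v w' ?_ (fun j => ?_) (hwo'.trans hwo)
  · rw [hw', hw0]; exact hν.comp hk hι.continuousAt
  · rw [hw', hws]
    have := mfderiv_comp (I'' := Q (n + 1)) b (hk.mdifferentiableAt (by simp)) hι.mdifferentiableAt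
    exact (congrArg (fun L : Vec n →L[ℝ] Vec (n + 1) => L (v j)) this).symm

theorem isBoundaryOrientationAt_comp_iff {j : B → B'} {κ : B' → P}
    (hj : IsLocalDiffeomorphAt (Q n) (Q n) ∞ j b)
    (hκ : IsLocalFaceAt (fun x => κ (j x)) b)
    {o : Orientation ℝ (TangentSpace (Q (n + 1)) (κ (j b))) (Fin (n + 1))}
    {o₁ : Orientation ℝ (TangentSpace (Q n) b) (Fin n)}
    {o₁' : Orientation ℝ (TangentSpace (Q n) (j b)) (Fin n)}
    (ho : Carries (mfderiv (Q n) (Q n) j b) o₁ o₁') :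
    IsBoundaryOrientationAt (fun x => κ (j x)) b o o₁ ↔ IsBoundaryOrientationAt κ (j b) o o₁' := by
  have hκ' := hκ.of_comp (κ := κ) hj
  obtain ⟨ν, hν⟩ := hκ'.exists_isOutward
  let v := frame (chart_mem_maxAtlas b) (mem_chart_source _ b)
  obtain ⟨v', hv', hvo⟩ := ho.basis v
  have hd : ∀ i, mfderiv (Q n) (Q (n + 1)) (fun x => κ (j x)) b (v i) =
      mfderiv (Q n) (Q (n + 1)) κ (j b) (v' i) := fun i => by
    rw [hv']
    have := mfderiv_comp (I'' := Q (n + 1)) b hκ'.mdifferentiableAt (hj.mdifferentiableAt (by simp))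
    exact (congrArg (fun L : Vec n →L[ℝ] Vec (n + 1) => L (v i)) this)
  constructor
  · intro h
    obtain ⟨w, hw0, hws, hwo⟩ := h ν ((isOutward_comp_iff hj).2 hν) v
    refine isBoundaryOrientationAt_of_basis hκ' v' w (hw0 ▸ hν) (fun i => ?_) (hwo.trans hvo.symm)
    rw [hws, hd]
  · intro h
    obtain ⟨w, hw0, hws, hwo⟩ := h ν hν v'
    refine isBoundaryOrientationAt_of_basis hκ v w ?_ (fun i => ?_) (hwo.trans hvo)
    · exact (isOutward_comp_iff hj).2 (hw0 ▸ hν)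
    · rw [hws]; exact (hd i).symm

theorem IsBoundaryOrientation.neg {o : OrientationField P} {o₁ : OrientationField B}
    (h : IsBoundaryOrientation ι o o₁) :
    IsBoundaryOrientation ι (fun p => -o p) (fun b => -o₁ b) := fun b ν hν v => by
  obtain ⟨w, h0, hs, ho⟩ := h b ν hν v
  refine ⟨w, h0, hs, ?_⟩
  rw [orientation_eq_neg_iff, orientation_eq_neg_iff, ho]

theorem IsGeometricBoundary.comp_diffeomorph (h : IsGeometricBoundary ι)
    (k : P ≃ₘ⟮Q (n + 1), Q (n + 1)⟯ P') : IsGeometricBoundary fun b => k (ι b) := by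
  refine .of_exists_chart (fun b => (h.isLocalFaceAt b).comp (k.isLocalDiffeomorph _)) fun p => ?_
  have hs := mem_chart_source (EuclideanQuadrant (n + 1)) (k.symm p)
  obtain ⟨e', he', hb', hee, -⟩ := exists_chart_of_isLocalDiffeomorphAt
    (k.isLocalDiffeomorph (k.symm p)) (chart_mem_maxAtlas _) hs
  rw [k.apply_symm_apply] at hb'
  refine ⟨e', he', hb', fun i hi => ?_⟩
  have h0 := hee.self_of_nhds
  rw [k.apply_symm_apply] at h0
  rw [h0] at hi
  refine (existsUnique_congr fun b => ?_).1 (h.existsUnique_face _ (chart_mem_maxAtlas _) _ hs i hi)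
  rw [show ι b = k.symm p ↔ k (ι b) = p from k.toEquiv.eq_symm_apply]
  refine and_congr_right fun hb => ?_
  have hb' : ι b = k.symm p := k.toEquiv.eq_symm_apply.2 hb
  rw [← hb'] at hee ⊢
  exact (liesOnFace_iff_of_eventually (h.isLocalFaceAt b).continuousAt hee).symm

theorem IsGeometricBoundary.precomp_diffeomorph (h : IsGeometricBoundary ι)
    (j : B' ≃ₘ⟮Q n, Q n⟯ B) : IsGeometricBoundary fun b => ι (j b) := by
  have hl : ∀ b, IsLocalFaceAt (fun b => ι (j b)) b := fun b => by
    have := IsLocalFaceAt.of_comp (κ := fun b => ι (j b)) (j.symm.isLocalDiffeomorph (j b))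
      (by simpa using h.isLocalFaceAt (j b))
    simpa using this
  refine .of_exists_chart hl fun p => ?_
  have hs := mem_chart_source (EuclideanQuadrant (n + 1)) p
  refine ⟨_, chart_mem_maxAtlas p, hs, fun i hi => ?_⟩
  obtain ⟨b, hb, hu⟩ := h.existsUnique_face _ (chart_mem_maxAtlas _) _ hs i hi
  simp only [liesOnFace_comp_iff (j.isLocalDiffeomorph _)]
  refine ⟨j.symm b, by simpa using hb, fun b' hb' => ?_⟩
  rw [← hu _ hb']; simp

/-- The geometric boundary of a disjoint union is the disjoint union of the geometric boundaries. -/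
theorem IsGeometricBoundary.sum {κ : B' → P'} (h : IsGeometricBoundary ι)
    (h' : IsGeometricBoundary κ) :
    IsGeometricBoundary (B := sumMfd B B') (P := sumMfd P P') (Sum.map ι κ) := by
  have hl : ∀ b : B, IsLocalFaceAt (P := sumMfd P P') (fun b => Sum.inl (ι b)) b := fun b =>
    (h.isLocalFaceAt b).comp (isLocalDiffeomorphAt_inl _)
  have hr : ∀ b : B', IsLocalFaceAt (P := sumMfd P P') (fun b => Sum.inr (κ b)) b := fun b =>
    (h'.isLocalFaceAt b).comp (isLocalDiffeomorphAt_inr _)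
  refine .of_exists_chart ?_ ?_
  · rintro (b | b)
    · exact @IsLocalFaceAt.of_comp n _ (sumMfd B B') (sumMfd P P') b Sum.inl (Sum.map ι κ)
        (isLocalDiffeomorphAt_inl b) (hl b)
    · exact @IsLocalFaceAt.of_comp n _ (sumMfd B B') (sumMfd P P') b Sum.inr (Sum.map ι κ)
        (isLocalDiffeomorphAt_inr b) (hr b)
  · rintro (p | p)
    · have hs := mem_chart_source (EuclideanQuadrant (n + 1)) p
      obtain ⟨e', he', hb', hee, -⟩ := exists_chart_of_isLocalDiffeomorphAt (Y := sumMfd P P')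
        (isLocalDiffeomorphAt_inl p) (chart_mem_maxAtlas _) hs
      refine ⟨e', he', hb', fun i hi => ?_⟩
      rw [hee.self_of_nhds] at hi
      have key : ∀ b : B, ι b = p → (LiesOnFace (B := sumMfd B B') (P := sumMfd P P') (Sum.map ι κ)
          (Sum.inl b) e' i ↔ LiesOnFace ι b (chartAt _ p) i) := fun b hb => by
        rw [← liesOnFace_iff_of_eventually (P' := sumMfd P P') (h.isLocalFaceAt b).continuousAt
          (by rw [hb]; exact hee)]
        exact (liesOnFace_comp_iff (B' := sumMfd B B') (P := sumMfd P P') (κ := Sum.map ι κ)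
          (isLocalDiffeomorphAt_inl b)).symm
      obtain ⟨b, ⟨hb, hb2⟩, hu⟩ := h.existsUnique_face _ (chart_mem_maxAtlas _) _ hs i hi
      refine ⟨Sum.inl b, ⟨congrArg Sum.inl hb, (key b hb).2 hb2⟩, ?_⟩
      rintro (b' | b') ⟨h1, h2⟩
      · have := Sum.inl_injective h1
        exact congrArg Sum.inl (hu b' ⟨this, (key b' this).1 h2⟩)
      · cases h1
    · have hs := mem_chart_source (EuclideanQuadrant (n + 1)) p
      obtain ⟨e', he', hb', hee, -⟩ := exists_chart_of_isLocalDiffeomorphAt (Y := sumMfd P P')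
        (isLocalDiffeomorphAt_inr p) (chart_mem_maxAtlas _) hs
      refine ⟨e', he', hb', fun i hi => ?_⟩
      rw [hee.self_of_nhds] at hi
      have key : ∀ b : B', κ b = p → (LiesOnFace (B := sumMfd B B') (P := sumMfd P P') (Sum.map ι κ)
          (Sum.inr b) e' i ↔ LiesOnFace κ b (chartAt _ p) i) := fun b hb => by
        rw [← liesOnFace_iff_of_eventually (P' := sumMfd P P') (h'.isLocalFaceAt b).continuousAt
          (by rw [hb]; exact hee)]
        exact (liesOnFace_comp_iff (B' := sumMfd B B') (P := sumMfd P P') (κ := Sum.map ι κ)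
          (isLocalDiffeomorphAt_inr b)).symm
      obtain ⟨b, ⟨hb, hb2⟩, hu⟩ := h'.existsUnique_face _ (chart_mem_maxAtlas _) _ hs i hi
      refine ⟨Sum.inr b, ⟨congrArg Sum.inr hb, (key b hb).2 hb2⟩, ?_⟩
      rintro (b' | b') ⟨h1, h2⟩
      · cases h1
      · have := Sum.inr_injective h1
        exact congrArg Sum.inr (hu b' ⟨this, (key b' this).1 h2⟩)

theorem IsBoundaryOrientation.sum {κ : B' → P'} (h : ∀ b, IsLocalFaceAt ι b)
    (h' : ∀ b, IsLocalFaceAt κ b) {o : OrientationField P} {o₁ : OrientationField B}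
    {o' : OrientationField P'} {o₁' : OrientationField B'}
    (ho : IsBoundaryOrientation ι o o₁) (ho' : IsBoundaryOrientation κ o' o₁') :
    IsBoundaryOrientation (B := sumMfd B B') (P := sumMfd P P') (Sum.map ι κ)
      (sumOrientation o o') (sumOrientation o₁ o₁') := by
  rintro (b | b)
  · have h1 := IsBoundaryOrientationAt.comp (P' := sumMfd P P') (isLocalDiffeomorphAt_inl (ι b))
      (h b) (carries_inl (Y := P') (ι b) (o (ι b))) (ho b)
    exact (isBoundaryOrientationAt_comp_iff (B' := sumMfd B B') (P := sumMfd P P')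
      (κ := Sum.map ι κ) (isLocalDiffeomorphAt_inl b)
      ((h b).comp (isLocalDiffeomorphAt_inl _)) (carries_inl b (o₁ b))).1 h1
  · have h1 := IsBoundaryOrientationAt.comp (P' := sumMfd P P') (isLocalDiffeomorphAt_inr (κ b))
      (h' b) (carries_inr (X := P) (κ b) (o' (κ b))) (ho' b)
    exact (isBoundaryOrientationAt_comp_iff (B' := sumMfd B B') (P := sumMfd P P')
      (κ := Sum.map ι κ) (isLocalDiffeomorphAt_inr b)
      ((h' b).comp (isLocalDiffeomorphAt_inr _)) (carries_inr b (o₁' b))).1 h1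

end LocalDiffeo

/-! ### Isomorphisms of chains and boundary chains -/

theorem Carries.neg_neg {n : ℕ} {V W : Type*} [AddCommGroup V] [Module ℝ V] [AddCommGroup W]
    [Module ℝ W] {L : V → W} {o : Orientation ℝ V (Fin n)} {o' : Orientation ℝ W (Fin n)}
    (h : Carries L o o') : Carries L (- -o) o' := by
  rwa [orientation_neg_neg]

section Diffeo

variable {n : ℕ} {X Y Z : CornerMfd n}

theorem carries_mfderiv_comp {f : X → Y} {g : Y → Z} {x : X}
    (hg : MDifferentiableAt (Q n) (Q n) g (f x)) (hf : MDifferentiableAt (Q n) (Q n) f x)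
    {o : Orientation ℝ (TangentSpace (Q n) x) (Fin n)}
    {o' : Orientation ℝ (TangentSpace (Q n) (f x)) (Fin n)}
    {o'' : Orientation ℝ (TangentSpace (Q n) (g (f x))) (Fin n)}
    (h' : Carries (mfderiv (Q n) (Q n) g (f x)) o' o'')
    (h : Carries (mfderiv (Q n) (Q n) f x) o o') :
    Carries (mfderiv (Q n) (Q n) (fun y => g (f y)) x) o o'' := by
  have := mfderiv_comp (I'' := Q n) x hg hf
  obtain ⟨A, hA, hAo⟩ := h'.comp h
  exact ⟨A, fun v => (hA v).trans (congrArg (fun L : Vec n →L[ℝ] Vec n => L v) this).symm, hAo⟩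

theorem carries_sum_inl {F : X ⊕ Y → Z} {x : X}
    (hF : MDifferentiableAt (Q n) (Q n) F (Sum.inl x))
    {o : Orientation ℝ (TangentSpace (Q n) x) (Fin n)}
    {o' : Orientation ℝ (TangentSpace (Q n) (F (Sum.inl x))) (Fin n)}
    (h : Carries (mfderiv (Q n) (Q n) (fun y : X => F (Sum.inl y)) x) o o') :
    Carries (mfderiv (Q n) (Q n) F (Sum.inl x)) o o' := by
  have hd := hasMFDerivAt_inl (I := Q n) (M := X) (M' := Y) (q := x) (p := Sum.inl x)
  have := mfderiv_comp (I'' := Q n) x hF hd.mdifferentiableAt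
  rw [hd.mfderiv] at this
  obtain ⟨A, hA, hAo⟩ := h
  exact ⟨A, fun v => (hA v).trans (congrArg (fun L : Vec n →L[ℝ] Vec n => L v) this), hAo⟩

theorem carries_sum_inr {F : X ⊕ Y → Z} {y : Y}
    (hF : MDifferentiableAt (Q n) (Q n) F (Sum.inr y))
    {o : Orientation ℝ (TangentSpace (Q n) y) (Fin n)}
    {o' : Orientation ℝ (TangentSpace (Q n) (F (Sum.inr y))) (Fin n)}
    (h : Carries (mfderiv (Q n) (Q n) (fun z : Y => F (Sum.inr z)) y) o o') :
    Carries (mfderiv (Q n) (Q n) F (Sum.inr y)) o o' := by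
  have hd := hasMFDerivAt_inr (I := Q n) (M := X) (M' := Y) (q' := y) (p := Sum.inr y)
  have := mfderiv_comp (I'' := Q n) y hF hd.mdifferentiableAt
  rw [hd.mfderiv] at this
  obtain ⟨A, hA, hAo⟩ := h
  exact ⟨A, fun v => (hA v).trans (congrArg (fun L : Vec n →L[ℝ] Vec n => L v) this), hAo⟩

theorem Diffeomorph.carries_symm (f : X ≃ₘ⟮Q n, Q n⟯ Y) {o : OrientationField X}
    {o' : OrientationField Y}
    (h : ∀ x, Carries (mfderiv (Q n) (Q n) f x) (o x) (o' (f x))) (y : Y) :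
    Carries (mfderiv (Q n) (Q n) f.symm y) (o' y) (o (f.symm y)) := by
  have h1 := h (f.symm y)
  have h2 : (o' (f (f.symm y)) : Orientation ℝ (Vec n) (Fin n)) = o' y :=
    congrArg (fun z => (show Orientation ℝ (Vec n) (Fin n) from o' z)) (f.apply_symm_apply y)
  have h3 : Carries (V := Vec n) (W := Vec n) (mfderiv (Q n) (Q n) f (f.symm y)) (o (f.symm y))
      (o' y) := h2 ▸ h1
  refine h3.inverse fun v => ?_
  have := mfderiv_comp (I'' := Q n) y (f.mdifferentiable (by simp) (f.symm y))
    (f.symm.mdifferentiable (by simp) y)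
  have h4 : f ∘ f.symm = id := funext f.apply_symm_apply
  rw [h4, mfderiv_id] at this
  exact (congrArg (fun L : Vec n →L[ℝ] Vec n => L v) this).symm

theorem preservesOrientation_iff {f : X ≃ₘ⟮Q n, Q n⟯ Y} {o : OrientationField X}
    {o' : OrientationField Y} :
    PreservesOrientation f o o' ↔ ∀ x, Carries (mfderiv (Q n) (Q n) f x) (o x) (o' (f x)) := by
  refine forall_congr' fun x => ⟨fun h => ⟨_, fun v => rfl, h⟩, fun ⟨A, hA, h⟩ => ?_⟩
  have hA' : (f.mfderivToContinuousLinearEquiv (by simp) x).toLinearEquiv = A :=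
    LinearEquiv.ext fun v => (hA v).symm
  rw [hA', h]

end Diffeo

namespace GeomChain

variable {n : ℕ} {M N : SmoothMfd.{u}} {σ σ' τ τ' υ : GeomChain n M}

theorem isomorphic_iff : σ.Isomorphic τ ↔ ∃ f : σ.dom ≃ₘ⟮Q n, Q n⟯ τ.dom,
    (∀ x, Carries (mfderiv (Q n) (Q n) f x) (σ.orient x) (τ.orient (f x))) ∧
      ∀ p, τ.map (f p) = σ.map p := by
  simp only [Isomorphic, preservesOrientation_iff]

theorem carries_id {X : CornerMfd n} (x : X) (o : Orientation ℝ (TangentSpace (Q n) x) (Fin n)) :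
    Carries (mfderiv (Q n) (Q n) (fun x : X => x) x) o o := by
  have h : mfderiv (Q n) (Q n) (fun x : X => x) x = _ := mfderiv_id
  rw [h]
  exact Carries.id o

theorem Isomorphic.refl (σ : GeomChain n M) : σ.Isomorphic σ :=
  isomorphic_iff.2 ⟨Diffeomorph.refl _ _ _, fun x => carries_id x _, fun _ => rfl⟩

theorem Isomorphic.symm (h : σ.Isomorphic τ) : τ.Isomorphic σ := by
  obtain ⟨f, h1, h2⟩ := isomorphic_iff.1 h
  exact isomorphic_iff.2 ⟨f.symm, Diffeomorph.carries_symm f h1, fun p => by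
    rw [← h2, f.apply_symm_apply]⟩

theorem Isomorphic.trans (h : σ.Isomorphic τ) (h' : τ.Isomorphic υ) : σ.Isomorphic υ := by
  obtain ⟨f, h1, h2⟩ := isomorphic_iff.1 h
  obtain ⟨g, h3, h4⟩ := isomorphic_iff.1 h'
  exact isomorphic_iff.2 ⟨f.trans g, fun x => carries_mfderiv_comp
    (g.mdifferentiable (by simp) _) (f.mdifferentiable (by simp) _) (h3 _) (h1 x), fun p =>
    (h4 _).trans (h2 p)⟩

theorem Isomorphic.neg (h : σ.Isomorphic τ) : σ.neg.Isomorphic τ.neg := by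
  obtain ⟨f, h1, h2⟩ := isomorphic_iff.1 h
  exact isomorphic_iff.2 ⟨f, fun x => Carries.neg (h1 x), h2⟩

theorem Isomorphic.push (f : SmoothMap M N) (h : σ.Isomorphic τ) :
    (σ.push f).Isomorphic (τ.push f) := by
  obtain ⟨g, h1, h2⟩ := h
  exact ⟨g, h1, fun p => congrArg f (h2 p)⟩

theorem neg_neg (σ : GeomChain n M) : σ.neg.neg.Isomorphic σ :=
  isomorphic_iff.2 ⟨Diffeomorph.refl _ _ _, fun x =>
    Carries.neg_neg (carries_id (X := σ.dom) x (σ.orient x)), fun _ => rfl⟩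

/-- A chain is trivial if and only if it is isomorphic to its opposite. -/
theorem isTrivial_iff : σ.IsTrivial ↔ σ.Isomorphic σ.neg := Iff.rfl

theorem Isomorphic.sum (h : σ.Isomorphic τ) (h' : σ'.Isomorphic τ') :
    (σ.sum σ').Isomorphic (τ.sum τ') := by
  obtain ⟨f, h1, h2⟩ := isomorphic_iff.1 h
  obtain ⟨g, h3, h4⟩ := isomorphic_iff.1 h'
  let F : (σ.sum σ').dom ≃ₘ⟮Q n, Q n⟯ (τ.sum τ').dom := Diffeomorph.sumCongr f g
  refine isomorphic_iff.2 ⟨F, ?_, ?_⟩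
  · rintro (x | x)
    · exact carries_sum_inl (Z := sumMfd τ.dom τ'.dom) (F.mdifferentiable (by simp) _)
        (carries_mfderiv_comp (Z := sumMfd τ.dom τ'.dom)
          (ContMDiff.inl.mdifferentiable (n := ∞) (by simp) _)
          (f.mdifferentiable (by simp) _) (carries_inl _ _) (h1 x))
    · exact carries_sum_inr (Z := sumMfd τ.dom τ'.dom) (F.mdifferentiable (by simp) _)
        (carries_mfderiv_comp (Z := sumMfd τ.dom τ'.dom)
          (ContMDiff.inr.mdifferentiable (n := ∞) (by simp) _)
          (g.mdifferentiable (by simp) _) (carries_inr _ _) (h3 x))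
  · rintro (x | x)
    exacts [h2 x, h4 x]

theorem sum_comm (σ τ : GeomChain n M) : (σ.sum τ).Isomorphic (τ.sum σ) := by
  let F : (σ.sum τ).dom ≃ₘ⟮Q n, Q n⟯ (τ.sum σ).dom := Diffeomorph.sumComm (Q n) σ.dom ∞ τ.dom
  refine isomorphic_iff.2 ⟨F, ?_, ?_⟩
  · rintro (x | x)
    · exact carries_sum_inl (Z := sumMfd τ.dom σ.dom) (F.mdifferentiable (by simp) _) (carries_inr _ _)
    · exact carries_sum_inr (Z := sumMfd τ.dom σ.dom) (F.mdifferentiable (by simp) _) (carries_inl _ _)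
  · rintro (x | x) <;> rfl

theorem sum_assoc (σ τ υ : GeomChain n M) :
    ((σ.sum τ).sum υ).Isomorphic (σ.sum (τ.sum υ)) := by
  let F : ((σ.sum τ).sum υ).dom ≃ₘ⟮Q n, Q n⟯ (σ.sum (τ.sum υ)).dom :=
    Diffeomorph.sumAssoc (Q n) σ.dom ∞ τ.dom υ.dom
  have hF : MDifferentiable (Q n) (Q n) F := F.mdifferentiable (by simp)
  have hi : MDifferentiable (Q n) (Q n) (Sum.inl : σ.dom ⊕ τ.dom → (σ.dom ⊕ τ.dom) ⊕ υ.dom) :=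
    ContMDiff.inl.mdifferentiable (n := ∞) (by simp)
  have hr : MDifferentiable (Q n) (Q n) (Sum.inr : τ.dom ⊕ υ.dom → σ.dom ⊕ (τ.dom ⊕ υ.dom)) :=
    ContMDiff.inr.mdifferentiable (n := ∞) (by simp)
  let Z := sumMfd σ.dom (sumMfd τ.dom υ.dom)
  refine isomorphic_iff.2 ⟨F, ?_, ?_⟩
  · rintro ((x | x) | x)
    · refine carries_sum_inl (X := sumMfd σ.dom τ.dom) (Z := Z) (hF _) ?_
      refine carries_sum_inl (F := fun y => F (Sum.inl y)) (Z := Z) ((hF _).comp _ (hi _)) ?_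
      exact carries_inl (X := σ.dom) (Y := sumMfd τ.dom υ.dom) x (σ.orient x)
    · refine carries_sum_inl (X := sumMfd σ.dom τ.dom) (Z := Z) (hF _) ?_
      refine carries_sum_inr (F := fun y => F (Sum.inl y)) (Z := Z) ((hF _).comp _ (hi _)) ?_
      exact carries_mfderiv_comp (X := τ.dom) (Y := sumMfd τ.dom υ.dom) (Z := Z) (g := Sum.inr)
        (f := Sum.inl) (hr _) (ContMDiff.inl.mdifferentiable (n := ∞) (by simp) _)
        (carries_inr (X := σ.dom) (Y := sumMfd τ.dom υ.dom) _ _) (carries_inl _ _)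
    · refine carries_sum_inr (X := sumMfd σ.dom τ.dom) (Z := Z) (hF _) ?_
      exact carries_mfderiv_comp (X := υ.dom) (Y := sumMfd τ.dom υ.dom) (Z := Z) (g := Sum.inr)
        (f := Sum.inr) (hr _) (ContMDiff.inr.mdifferentiable (n := ∞) (by simp) _)
        (carries_inr (X := σ.dom) (Y := sumMfd τ.dom υ.dom) _ _) (carries_inr _ _)
  · rintro ((x | x) | x) <;> rfl

theorem sum_empty (σ : GeomChain n M) (h : IsEmpty τ.dom) : (σ.sum τ).Isomorphic σ := by
  let F : (σ.sum τ).dom ≃ₘ⟮Q n, Q n⟯ σ.dom := Diffeomorph.sumEmpty (Q n) σ.dom (M' := τ.dom) ∞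
  refine isomorphic_iff.2 ⟨F, ?_, ?_⟩
  · rintro (x | x)
    · exact carries_sum_inl (F.mdifferentiable (by simp) _) (carries_id x _)
    · exact h.elim x
  · rintro (x | x)
    · rfl
    · exact h.elim x

theorem neg_sum (σ τ : GeomChain n M) : (σ.sum τ).neg.Isomorphic (σ.neg.sum τ.neg) := by
  refine isomorphic_iff.2 ⟨Diffeomorph.refl _ _ _, ?_, fun _ => rfl⟩
  rintro (x | x)
  · exact carries_id (X := sumMfd σ.dom τ.dom) (Sum.inl x) _
  · exact carries_id (X := sumMfd σ.dom τ.dom) (Sum.inr x) _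

theorem push_sum (f : SmoothMap M N) (σ τ : GeomChain n M) :
    ((σ.sum τ).push f).Isomorphic ((σ.push f).sum (τ.push f)) := by
  refine isomorphic_iff.2 ⟨Diffeomorph.refl _ _ _, fun x => carries_id x _, ?_⟩
  rintro (x | x) <;> rfl

variable (n M) in
/-- The empty chain. -/
def empty : GeomChain n M :=
  letI : ChartedSpace (EuclideanQuadrant n) Empty := ChartedSpace.empty _ _
  { dom := { carrier := Empty }
    compact := inferInstanceAs (CompactSpace Empty)
    orient := fun x => x.elim
    isOrientation := fun x => x.elim
    map := fun x => x.elim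
    smooth := fun x => x.elim }

instance : IsEmpty (empty n M).dom := inferInstanceAs (IsEmpty Empty)

section Boundary

variable {σ σ' : GeomChain (n + 1) M} {τ τ' : GeomChain n M}

theorem exists_isBoundary (σ : GeomChain (n + 1) M) : ∃ τ, σ.IsBoundary τ := by
  have hb := isGeometricBoundary_pt σ.dom
  choose o ho using fun b => (hb.isLocalFaceAt b).exists_orientation (σ.orient (FacePoint.pt b))
  have := hb.compactSpace
  exact ⟨{ dom := boundaryMfd σ.dom
           orient := o
           isOrientation := isOrientationField_of_isBoundaryOrientation hb.isLocalFaceAt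
            σ.isOrientation ho
           map := fun b => σ.map (FacePoint.pt b)
           smooth := σ.smooth.comp hb.contMDiff }, _, hb, ho, fun _ => rfl⟩

theorem IsBoundary.isomorphic (h : σ.IsBoundary τ) (h' : σ.IsBoundary τ') : τ.Isomorphic τ' := by
  obtain ⟨ι, hι, ho, hm⟩ := h
  obtain ⟨ι', hι', ho', hm'⟩ := h'
  obtain ⟨f, hf⟩ := hι.exists_diffeomorph hι'
  refine isomorphic_iff.2 ⟨f, fun b => ?_, fun b => ?_⟩
  · obtain ⟨-, e, he, hp, i, hi, hi'⟩ := hf b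
    exact carries_of_isBoundaryOrientationAt (f.mdifferentiable (by simp) b) (fun x => (hf x).1)
      (f.mfderivToContinuousLinearEquiv (by simp) b).bijective (hι.isLocalFaceAt b)
      (hι'.isLocalFaceAt _) he hp hi hi' (ho b) (ho' _)
  · rw [hm, hm', (hf b).1]

theorem IsBoundary.congr_left (hσ : σ.Isomorphic σ') (h : σ.IsBoundary τ) : σ'.IsBoundary τ := by
  obtain ⟨ι, hι, ho, hm⟩ := h
  obtain ⟨f, h1, h2⟩ := isomorphic_iff.1 hσ
  exact ⟨fun b => f (ι b), hι.comp_diffeomorph f, fun b =>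
    IsBoundaryOrientationAt.comp (f.isLocalDiffeomorph _) (hι.isLocalFaceAt b) (h1 _) (ho b),
    fun b => (hm b).trans (h2 _).symm⟩

theorem IsBoundary.congr_right (hτ : τ'.Isomorphic τ) (h : σ.IsBoundary τ) : σ.IsBoundary τ' := by
  obtain ⟨ι, hι, ho, hm⟩ := h
  obtain ⟨f, h1, h2⟩ := isomorphic_iff.1 hτ
  have hι' := hι.precomp_diffeomorph f
  exact ⟨fun b => ι (f b), hι', fun b =>
    (isBoundaryOrientationAt_comp_iff (f.isLocalDiffeomorph b) (hι'.isLocalFaceAt b) (h1 b)).2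
      (ho (f b)), fun b => (h2 b).symm.trans (hm _)⟩

theorem IsBoundary.neg (h : σ.IsBoundary τ) : σ.neg.IsBoundary τ.neg := by
  obtain ⟨ι, hι, ho, hm⟩ := h
  exact ⟨ι, hι, ho.neg, hm⟩

theorem IsBoundary.push (f : SmoothMap M N) (h : σ.IsBoundary τ) :
    (σ.push f).IsBoundary (τ.push f) := by
  obtain ⟨ι, hι, ho, hm⟩ := h
  exact ⟨ι, hι, ho, fun b => congrArg f (hm b)⟩

theorem IsBoundary.sum (h : σ.IsBoundary τ) (h' : σ'.IsBoundary τ') :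
    (σ.sum σ').IsBoundary (τ.sum τ') := by
  obtain ⟨ι, hι, ho, hm⟩ := h
  obtain ⟨ι', hι', ho', hm'⟩ := h'
  refine ⟨Sum.map ι ι', hι.sum hι', .sum hι.isLocalFaceAt hι'.isLocalFaceAt ho ho', ?_⟩
  rintro (b | b)
  exacts [hm b, hm' b]

end Boundary

end GeomChain

/-! ### The orientation reversing involution of the boundary of a boundary -/

section Corner

open Module

variable {n : ℕ} {D : CornerMfd n} {B : CornerMfd (n + 1)} {P : CornerMfd (n + 1 + 1)} {κ : D → B}
  {ι : B → P} {e e' : OpenPartialHomeomorph P (EuclideanQuadrant (n + 1 + 1))}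
  {i k i' k' : Fin (n + 1 + 1)} {d : D}

/-- For `κ : D → B` and `ι : B → P`, the point `d` of `D` is the point of `∂∂P` that belongs to the
pair of faces `({xᵢ = 0}, {xₖ = 0})` of the chart `e`: the map `ι` runs in `{xᵢ = 0}` near `κ d`,
and `ι ∘ κ` runs in `{xₖ = 0}` near `d`. -/
def LiesOnCorner (κ : D → B) (ι : B → P) (d : D)
    (e : OpenPartialHomeomorph P (EuclideanQuadrant (n + 1 + 1))) (i k : Fin (n + 1 + 1)) : Prop :=
  LiesOnFace ι (κ d) e i ∧ ∀ᶠ x in 𝓝 d, (e (ι (κ x))).1 k = 0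

/-- Two points of `∂∂P` over the same point of `P` that belong to the same pair of faces, taken in
opposite orders. -/
def OppositeCorner (κ : D → B) (ι : B → P) (d d' : D) : Prop :=
  ι (κ d') = ι (κ d) ∧ ∃ e ∈ maxAtlas P, ι (κ d) ∈ e.source ∧ ∃ i k, i ≠ k ∧
    LiesOnCorner κ ι d e i k ∧ LiesOnCorner κ ι d' e k i

theorem OppositeCorner.symm {d' : D} (h : OppositeCorner κ ι d d') : OppositeCorner κ ι d' d := by
  obtain ⟨h1, e, he, hp, i, k, hik, h2, h3⟩ := h
  exact ⟨h1.symm, e, he, h1 ▸ hp, k, i, hik.symm, h3, h2⟩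

variable (hι : IsGeometricBoundary ι) (hκ : IsGeometricBoundary κ)
include hι hκ

theorem LiesOnCorner.of_sameFace (h : LiesOnCorner κ ι d e i k)
    (h1 : SameFace e i e' i' (ι (κ d))) (h2 : SameFace e k e' k' (ι (κ d))) :
    LiesOnCorner κ ι d e' i' k' := by
  have hc := (hι.isLocalFaceAt (κ d)).continuousAt
  refine ⟨h.1.of_sameFace hc h1, ?_⟩
  filter_upwards [h.2, (hc.comp (hκ.isLocalFaceAt d).continuousAt).eventually h2] with x hx hx2
  exact hx2.1 hx

omit hι in
theorem LiesOnCorner.eventually (h : LiesOnCorner κ ι d e i k) :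
    ∀ᶠ x in 𝓝 d, LiesOnCorner κ ι x e i k := by
  filter_upwards [(hκ.isLocalFaceAt d).continuousAt.eventually h.1.eventually,
    eventually_eventually_nhds.2 h.2] with x h1 h2 using ⟨h1, h2⟩

omit hκ in
/-- In a chart of `P` around a boundary point `b`, the faces other than the one of `b` restrict to
the faces of a chart of the boundary. -/
theorem exists_restricted_face {b : B} (he : e ∈ maxAtlas P) (hp : ι b ∈ e.source)
    (hi : LiesOnFace ι b e i) (hik : k ≠ i) (hk : (e (ι b)).1 k = 0) :
    ∃ ψ ∈ maxAtlas B, b ∈ ψ.source ∧ ∃ j, (ψ b).1 j = 0 ∧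
      ∀ᶠ x in 𝓝 b, (e (ι x)).1 k = 0 ↔ (ψ x).1 j = 0 := by
  have hl := hι.isLocalFaceAt b
  obtain ⟨ψ, hψ, e₀, he₀, i₀, hb, h⟩ := hι.locally_face b
  have hp₀ := (h b hb).1
  have hi₀ : LiesOnFace ι b e₀ i₀ := by
    filter_upwards [ψ.open_source.mem_nhds hb] with x hx using (h x hx).2.1
  have hs := hi.sameFace hl he hp he₀ hp₀ hi₀
  obtain ⟨k₀, hk₀, -⟩ := exists_sameFace he he₀ hp hp₀ hk
  have hne : k₀ ≠ i₀ := by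
    rintro rfl
    exact hik (hk₀.symm.unique hp hs.symm hk)
  obtain ⟨j, rfl⟩ := Fin.exists_succAbove_eq hne
  refine ⟨ψ, hψ, hb, j, ?_, ?_⟩
  · rw [← (h b hb).2.2]; exact hk₀.zero_iff.1 hk
  · filter_upwards [ψ.open_source.mem_nhds hb, hl.continuousAt.eventually hk₀] with x hx hx2
    rw [hx2, (h x hx).2.2]

theorem existsUnique_liesOnCorner (he : e ∈ maxAtlas P) {p : P} (hp : p ∈ e.source) (hik : i ≠ k)
    (hi : (e p).1 i = 0) (hk : (e p).1 k = 0) :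
    ∃! d : D, ι (κ d) = p ∧ LiesOnCorner κ ι d e i k := by
  obtain ⟨b, ⟨rfl, hb⟩, hu⟩ := hι.existsUnique_face e he p hp i hi
  obtain ⟨ψ, hψ, hbψ, j, hj, hj'⟩ := exists_restricted_face hι he hp hb hik.symm hk
  have key : ∀ d : D, κ d = b → ((∀ᶠ x in 𝓝 d, (e (ι (κ x))).1 k = 0) ↔ LiesOnFace κ d ψ j) :=
    fun d hd => by
      have := (hκ.isLocalFaceAt d).continuousAt.eventually (hd ▸ hj')
      exact eventually_congr this
  obtain ⟨d, ⟨rfl, hd⟩, hud⟩ := hκ.existsUnique_face ψ hψ b hbψ j hj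
  refine ⟨d, ⟨rfl, hb, (key d rfl).2 hd⟩, fun d' hd' => ?_⟩
  have h1 := hu _ ⟨hd'.1, hd'.2.1⟩
  exact hud _ ⟨h1, (key d' h1).1 hd'.2.2⟩

/-- Every point of `∂∂P` belongs to exactly one ordered pair of faces of a suitable chart. Outward
tangent vectors at `d` have negative component in the direction of the second face. -/
theorem exists_adapted_corner (d : D) : ∃ e ∈ maxAtlas P, ι (κ d) ∈ e.source ∧ ∃ i k, i ≠ k ∧
    LiesOnCorner κ ι d e i k ∧
    (∀ i' k', i' ≠ k' → LiesOnCorner κ ι d e i' k' → i' = i ∧ k' = k) ∧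
    ∀ μ, IsOutward κ d μ →
      chartComponent e k (ι (κ d)) (mfderiv (Q (n + 1)) (Q (n + 1 + 1)) ι (κ d) μ) < 0 := by
  have hl := hι.isLocalFaceAt (κ d)
  obtain ⟨ψ, hψ, e, he, i, hb, h⟩ := hι.locally_face (κ d)
  have hnb := ψ.open_source.mem_nhds hb
  have hi : LiesOnFace ι (κ d) e i := by
    filter_upwards [hnb] with x hx using (h x hx).2.1
  obtain ⟨j, hj⟩ := (hκ.isLocalFaceAt d).exists_liesOnFace hψ hb
  have hd := (hκ.isLocalFaceAt d).continuousAt.eventually hnb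
  refine ⟨e, he, (h _ hb).1, i, i.succAbove j, (Fin.succAbove_ne i j).symm, ⟨hi, ?_⟩, ?_, ?_⟩
  · filter_upwards [hd, hj] with x hx hx2
    rw [(h _ hx).2.2, hx2]
  · intro i' k' hik hc
    obtain rfl : i' = i := LiesOnFace.unique hl he (h _ hb).1 hc.1 hi
    obtain ⟨j', rfl⟩ := Fin.exists_succAbove_eq hik.symm
    refine ⟨rfl, ?_⟩
    congr 1
    refine LiesOnFace.unique (hκ.isLocalFaceAt d) hψ hb ?_ hj
    filter_upwards [hd, hc.2] with x hx hx2
    rw [← (h _ hx).2.2, hx2]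
  · intro μ hμ
    rw [chartComponent_mfderiv hl.mdifferentiableAt he (h _ hb).1]
    have : (fun y => (e (ι y)).1 (i.succAbove j)) =ᶠ[𝓝 (κ d)] fun y => (ψ y).1 j := by
      filter_upwards [hnb] with y hy using (h _ hy).2.2 j
    rw [this.mfderiv_eq]
    exact hμ.chartComponent_neg (hκ.isLocalFaceAt d) hψ hb hj

theorem existsUnique_oppositeCorner (d : D) : ∃! d', OppositeCorner κ ι d d' := by
  obtain ⟨e, he, hp, i, k, hik, hd, hu, -⟩ := exists_adapted_corner hι hκ d
  obtain ⟨d', ⟨h1, h2⟩, hu'⟩ := existsUnique_liesOnCorner hι hκ he hp hik.symm hd.2.self_of_nhds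
    hd.1.zero
  refine ⟨d', ⟨h1, e, he, hp, i, k, hik, hd, h2⟩, ?_⟩
  rintro d₂ ⟨h3, e', he', hp', i', k', hik', hd1, hd2⟩
  obtain ⟨i₂, hi₂, -⟩ := exists_sameFace he' he hp' hp hd1.1.zero
  obtain ⟨k₂, hk₂, -⟩ := exists_sameFace he' he hp' hp hd1.2.self_of_nhds
  have h4 := hd1.of_sameFace hι hκ hi₂ hk₂
  have h5 := hd2.of_sameFace hι hκ (h3 ▸ hk₂) (h3 ▸ hi₂)
  have hne : i₂ ≠ k₂ := by
    rintro rfl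
    exact hik' (hi₂.symm.unique hp' hk₂.symm hd1.1.zero)
  obtain ⟨rfl, rfl⟩ := hu _ _ hne h4
  exact hu' _ ⟨h3, h5⟩

theorem OppositeCorner.exists_local {d' : D} (h : OppositeCorner κ ι d d') :
    ∃ g, ContMDiffAt (Q n) (Q n) ∞ g d ∧ ∀ᶠ x in 𝓝 d, OppositeCorner κ ι x (g x) := by
  obtain ⟨h1, e, he, hp, i, k, hik, hd, hd'⟩ := h
  have hlι := hι.isLocalFaceAt (κ d)
  have hlκ := hκ.isLocalFaceAt d
  have hp' : ι (κ d') ∈ e.source := h1 ▸ hp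
  obtain ⟨s, hs, hs1, hs2⟩ := (hι.isLocalFaceAt (κ d')).exists_section he hp' hd'.1
  obtain ⟨ψ, hψ, hbψ, j, hj, hj'⟩ := exists_restricted_face hι he hp' hd'.1 hik
    hd'.2.self_of_nhds
  have hdj : LiesOnFace κ d' ψ j := by
    filter_upwards [hd'.2, (hκ.isLocalFaceAt d').continuousAt.eventually hj'] with x hx hx2
    exact hx2.1 hx
  obtain ⟨t, ht, ht1, ht2⟩ := (hκ.isLocalFaceAt d').exists_section hψ hbψ hdj
  rw [h1] at hs hs1 hs2
  have hq : ContMDiffAt (Q n) (Q (n + 1 + 1)) ∞ (fun x => ι (κ x)) d :=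
    hlι.contMDiffAt.comp d hlκ.contMDiffAt
  have hy : ContMDiffAt (Q n) (Q (n + 1)) ∞ (fun x => s (ι (κ x))) d := hs.comp d hq
  rw [← hs1] at ht ht2
  have hg : ContMDiffAt (Q n) (Q n) ∞ (fun x => t (s (ι (κ x)))) d := ContMDiffAt.comp d ht hy
  have hgd : t (s (ι (κ d))) = d' := by rw [hs1, ht1]
  have hg' : Tendsto (fun x => t (s (ι (κ x)))) (𝓝 d) (𝓝 d') := by
    have := hg.continuousAt.tendsto
    rwa [hgd] at this
  have hy' : Tendsto (fun x => s (ι (κ x))) (𝓝 d) (𝓝 (κ d')) := by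
    have := hy.continuousAt.tendsto
    rwa [hs1] at this
  refine ⟨_, hg, ?_⟩
  filter_upwards [hd.eventually hκ, hg'.eventually (hd'.eventually hκ),
    hq.continuousAt.eventually hs2, hy.continuousAt.eventually ht2, hy'.eventually hj',
    hq.continuousAt.eventually (e.open_source.mem_nhds hp)] with x h3 h4 h5 h6 h7 h8
  have h9 := h5 h3.2.self_of_nhds
  have h10 := h6 (h7.1 (by rw [h9]; exact h3.1.zero))
  exact ⟨by rw [h10, h9], e, he, h8, i, k, hik, h3, h4⟩

omit hι hκ in
theorem chartComponent_congr_point {m : ℕ} {X : CornerMfd m}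
    (e : OpenPartialHomeomorph X (EuclideanQuadrant m)) (i : Fin m) {p p' : X} (h : p = p')
    (v : Vec m) : chartComponent e i p v = chartComponent e i p' v := by
  subst h; rfl

omit hι hκ in
theorem orientation_swap {V : Type*} [AddCommGroup V] [Module ℝ V]
    (w w' : Basis (Fin (n + 1 + 1)) ℝ V) (h0 : w' 0 = w 1) (h1 : w' 1 = w 0)
    (h : ∀ j : Fin n, w' j.succ.succ = w j.succ.succ) (o : Orientation ℝ V (Fin (n + 1 + 1))) :
    w'.orientation = o ↔ ¬ w.orientation = o := by
  have hw : w' = w.reindex (Equiv.swap 0 1) := by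
    refine Basis.eq_of_apply_eq fun j => ?_
    rw [Basis.reindex_apply, Equiv.symm_swap]
    refine Fin.cases ?_ (fun j => ?_) j
    · rw [h0, Equiv.swap_apply_left]
    refine Fin.cases ?_ (fun j => ?_) j
    · exact h1.trans (congrArg w (Equiv.swap_apply_right _ _).symm)
    · rw [h, Equiv.swap_apply_of_ne_of_ne (by simp) (by simp [Fin.ext_iff])]
  have hdet : ¬ w'.orientation = w.orientation := by
    have : (w' : Fin (n + 1 + 1) → V) = w ∘ Equiv.swap 0 1 := by
      rw [hw, Basis.coe_reindex, Equiv.symm_swap]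
    rw [eq_comm, Basis.orientation_eq_iff_det_pos, this, AlternatingMap.map_perm, Basis.det_self,
      Equiv.Perm.sign_swap (by simp)]
    simp
  rw [orientation_eq_iff_iff w' w o] at hdet
  tauto

/-- Exchanging the two faces reverses the orientation of the boundary of the boundary, since
`(ν, ν', v)` and `(ν', ν, v)` have opposite orientations. -/
theorem carries_neg_of_oppositeCorner {f : D → D} (hf : MDifferentiable (Q n) (Q n) f)
    (hbij : Function.Bijective (mfderiv (Q n) (Q n) f d))
    (hff : ∀ x, OppositeCorner κ ι x (f x)) {oP : OrientationField P} {oB : OrientationField B}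
    {oD : OrientationField D} (hoB : IsBoundaryOrientation ι oP oB)
    (hoD : IsBoundaryOrientation κ oB oD) :
    Carries (mfderiv (Q n) (Q n) f d) (oD d) (-oD (f d)) := by
  have hR := hff d
  have hpp := hR.1
  -- a vector which is outward at `κ d` through the first face of `f d`, and conversely
  have key : ∀ d d' : D, OppositeCorner κ ι d d' → ∀ μ, IsOutward κ d μ →
      IsOutward ι (κ d') (mfderiv (Q (n + 1)) (Q (n + 1 + 1)) ι (κ d) μ : Vec (n + 1 + 1)) := by
    intro d d' hdd μ hμ
    obtain ⟨e, he, hp, i, k, hik, hd, hu, hneg⟩ := exists_adapted_corner hι hκ d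
    obtain ⟨h3, e', he', hp', i', k', hik', hd1, hd2⟩ := hdd
    obtain ⟨i₂, hi₂, -⟩ := exists_sameFace he' he hp' hp hd1.1.zero
    obtain ⟨k₂, hk₂, -⟩ := exists_sameFace he' he hp' hp hd1.2.self_of_nhds
    have h4 := hd1.of_sameFace hι hκ hi₂ hk₂
    have h5 := hd2.of_sameFace hι hκ (h3 ▸ hk₂) (h3 ▸ hi₂)
    have hne : i₂ ≠ k₂ := by
      rintro rfl
      exact hik' (hi₂.symm.unique hp' hk₂.symm hd1.1.zero)
    obtain ⟨rfl, rfl⟩ := hu _ _ hne h4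
    refine ⟨e, he, h3 ▸ hp, k₂, h5.1, ?_⟩
    exact (chartComponent_congr_point e k₂ h3 _).trans_lt (hneg μ hμ)
  obtain ⟨μ, hμ⟩ := (hκ.isLocalFaceAt d).exists_isOutward
  obtain ⟨μ', hμ'⟩ := (hκ.isLocalFaceAt (f d)).exists_isOutward
  let v := frame (chart_mem_maxAtlas d) (mem_chart_source _ d)
  let A : TangentSpace (Q n) d ≃ₗ[ℝ] TangentSpace (Q n) (f d) :=
    LinearEquiv.ofBijective (mfderiv (Q n) (Q n) f d).toLinearMap hbij
  obtain ⟨w, hw0, hws, hwo⟩ := hoD d μ hμ v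
  obtain ⟨w', hw0', hws', hwo'⟩ := hoD (f d) μ' hμ' (v.map A)
  obtain ⟨W, hW0, hWs, hWo⟩ := hoB (κ d) _ (key _ _ hR.symm μ' hμ') w
  obtain ⟨W', hW0', hWs', hWo'⟩ := hoB (κ (f d)) _ (key _ _ hR μ hμ) w'
  have hoP : (oP (ι (κ (f d))) : Orientation ℝ (Vec (n + 1 + 1)) (Fin (n + 1 + 1))) =
      oP (ι (κ d)) :=
    congrArg (fun z => (show Orientation ℝ (Vec (n + 1 + 1)) (Fin (n + 1 + 1)) from oP z)) hpp
  have hd2 : ∀ x, mfderiv (Q n) (Q (n + 1 + 1)) (fun x => ι (κ x)) d x =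
      mfderiv (Q (n + 1)) (Q (n + 1 + 1)) ι (κ d) (mfderiv (Q n) (Q (n + 1)) κ d x) := fun x =>
    congrArg (fun L : Vec n →L[ℝ] Vec (n + 1 + 1) => L x)
      (mfderiv_comp (I'' := Q (n + 1 + 1)) d (hι.isLocalFaceAt (κ d)).mdifferentiableAt
        (hκ.isLocalFaceAt d).mdifferentiableAt)
  have hd3 : ∀ x, mfderiv (Q n) (Q (n + 1 + 1)) (fun x => ι (κ x)) (f d) x =
      mfderiv (Q (n + 1)) (Q (n + 1 + 1)) ι (κ (f d)) (mfderiv (Q n) (Q (n + 1)) κ (f d) x) :=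
    fun x => congrArg (fun L : Vec n →L[ℝ] Vec (n + 1 + 1) => L x)
      (mfderiv_comp (I'' := Q (n + 1 + 1)) (f d) (hι.isLocalFaceAt (κ (f d))).mdifferentiableAt
        (hκ.isLocalFaceAt (f d)).mdifferentiableAt)
  have hd4 : ∀ x, (mfderiv (Q n) (Q (n + 1 + 1)) (fun x => ι (κ x)) d x : Vec (n + 1 + 1)) =
      mfderiv (Q n) (Q (n + 1 + 1)) (fun x => ι (κ x)) (f d) (mfderiv (Q n) (Q n) f d x) := by
    intro x
    have h1 : (fun x => ι (κ x)) ∘ f = fun x => ι (κ x) := funext fun x => (hff x).1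
    have h2 := mfderiv_comp (I'' := Q (n + 1 + 1)) d
      ((hι.isLocalFaceAt (κ (f d))).mdifferentiableAt.comp (f d)
        (hκ.isLocalFaceAt (f d)).mdifferentiableAt) (hf d)
    have h3 : ((fun x => ι (κ x)) ∘ f) = ((ι ∘ κ) ∘ f) := rfl
    rw [← h3, h1] at h2
    exact congrArg (fun L : Vec n →L[ℝ] Vec (n + 1 + 1) => L x) h2
  have hO := orientation_swap (V := Vec (n + 1 + 1)) W W'
    (hW0'.trans ((hWs 0).trans (congrArg _ hw0)).symm)
    (((hWs' 0).trans (congrArg _ hw0')).trans hW0.symm)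
    (fun j => by
      refine (hWs' j.succ).trans (Eq.trans ?_ (hWs j.succ).symm)
      rw [hws, hws', ← hd2, ← hd3]
      exact (hd4 (v j)).symm) (oP (ι (κ d)))
  refine carries_of_basis (L := (mfderiv (Q n) (Q n) f d).toLinearMap) v (v.map A)
    (fun j => rfl) ?_
  rw [orientation_eq_neg_iff, ← hwo', ← hWo', ← hwo, ← hWo]
  have hO' : W'.orientation = oP (ι (κ (f d))) ↔ ¬ W.orientation = oP (ι (κ d)) := by
    refine Iff.trans ?_ hO
    exact ⟨fun h => h.trans hoP, fun h => h.trans hoP.symm⟩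
  rw [hO', not_not]

end Corner

/-- The boundary of a boundary is trivial. -/
theorem GeomChain.IsBoundary.isTrivial {n : ℕ} {M : SmoothMfd.{u}} {σ : GeomChain (n + 2) M}
    {τ : GeomChain (n + 1) M} {υ : GeomChain n M} (h : σ.IsBoundary τ) (h' : τ.IsBoundary υ) :
    υ.IsTrivial := by
  obtain ⟨ι, hι, ho, hm⟩ := h
  obtain ⟨κ, hκ, ho', hm'⟩ := h'
  have hs : ∀ d d', OppositeCorner κ ι d d' ↔ OppositeCorner κ ι d' d := fun d d' =>
    ⟨.symm, .symm⟩
  obtain ⟨f, hf⟩ := exists_diffeomorph_of_rel (OppositeCorner κ ι)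
    (existsUnique_oppositeCorner hι hκ)
    (fun d' => by simpa only [hs _ d'] using existsUnique_oppositeCorner hι hκ d')
    (fun d d' h => h.exists_local hι hκ)
    (fun d d' h => by simpa only [hs _ (_ : υ.dom)] using h.symm.exists_local hι hκ)
  refine isTrivial_iff.2 (isomorphic_iff.2 ⟨f, fun d => ?_, fun d => ?_⟩)
  · exact carries_neg_of_oppositeCorner hι hκ (f.mdifferentiable (by simp))
      (f.mfderivToContinuousLinearEquiv (by simp) d).bijective hf ho ho'
  · change υ.map (f d) = υ.map d
    rw [hm', hm', hm, hm, (hf d).1]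

/-! ### Cancellation for disjoint unions -/

section Cancellation

/-- For `f : X ⊕ Y → X ⊕ Z`, apply `f` to the points of `X` and leave the points of `Z` fixed. -/
def reinsert {X Y Z : Type*} (f : X ⊕ Y → X ⊕ Z) : X ⊕ Z → X ⊕ Z :=
  Sum.elim (fun x => f (Sum.inl x)) Sum.inr

theorem reinsert_iterate_inr {X Y Z : Type*} (f : X ⊕ Y → X ⊕ Z) (N : ℕ) (z : Z) :
    (reinsert f)^[N] (Sum.inr z) = Sum.inr z := Function.iterate_fixed rfl N

/-- Running the procedure for the inverse of `f` undoes it. -/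
theorem reinsert_symm_iterate {X Y Z : Type*} (f : X ⊕ Y ≃ X ⊕ Z) (y : Y) (N : ℕ) :
    (reinsert f.symm)^[N] (f.symm ((reinsert f)^[N] (f (Sum.inr y)))) = Sum.inr y := by
  induction N with
  | zero => simp
  | succ N ih =>
    rw [Function.iterate_succ_apply' (reinsert f)]
    rcases h : (reinsert f)^[N] (f (Sum.inr y)) with x | z
    · rw [h] at ih
      change (reinsert f.symm)^[N + 1] (f.symm (f (Sum.inl x))) = _
      rw [f.symm_apply_apply, Function.iterate_succ_apply]
      exact ih
    · rw [h] at ih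
      change (reinsert f.symm)^[N + 1] (f.symm (Sum.inr z)) = _
      rw [Function.iterate_succ_apply', ih]
      rfl

variable {X Y Z : Type*} [TopologicalSpace X] [TopologicalSpace Y] [TopologicalSpace Z]

/-- A point of `Y` cannot be sent to `X` more often than `X` has connected components: the components
it runs through are distinct, as a repetition could be traced back to the component of a point of
`Y`. -/
theorem reinsert_iterate_eq_inr (f : X ⊕ Y ≃ₜ X ⊕ Z) [Finite (ConnectedComponents X)] {N : ℕ}
    (hN : Nat.card (ConnectedComponents X) ≤ N) (y : Y) :
    ∃ z, (reinsert f)^[N] (f (Sum.inr y)) = Sum.inr z := by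
  by_contra! hcon
  set w : ℕ → X ⊕ Z := fun k => (reinsert f)^[k] (f (Sum.inr y)) with hw
  have hinl : ∀ k : Fin (N + 1), ∃ x, w k = Sum.inl x := by
    intro k
    rcases h : w k with x | z
    · exact ⟨x, rfl⟩
    · refine absurd ?_ (hcon z)
      have hk : N = (N - k) + k := by omega
      rw [hk, Function.iterate_add_apply]
      exact (congrArg _ h).trans (reinsert_iterate_inr _ _ _)
  choose x hx using hinl
  have hcomp : ∀ {x x' : X} {y y' : X ⊕ Y}, f y = Sum.inl x → f y' = Sum.inl x' →
      connectedComponent x = connectedComponent x' →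
      (ConnectedComponents.mk y : ConnectedComponents (X ⊕ Y)) = ConnectedComponents.mk y' := by
    intro x x' y y' h h' hxx
    have := (ConnectedComponents.continuous_coe.comp
      (f.symm.continuous.comp (continuous_inl (X := X) (Y := Z)))).image_eq_of_connectedComponent_eq
      x x' hxx
    simpa [← h, ← h'] using this
  have hstep : ∀ a b : ℕ, ∀ (ha : a < N + 1) (hb : b < N + 1), a < b →
      connectedComponent (x ⟨a, ha⟩) ≠ connectedComponent (x ⟨b, hb⟩) := by
    have hsucc : ∀ b (hb : b + 1 < N + 1), f (Sum.inl (x ⟨b, by omega⟩)) =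
        Sum.inl (x ⟨b + 1, hb⟩) := fun b hb => by
      rw [← hx ⟨b + 1, hb⟩, hw]
      change _ = (reinsert f)^[b + 1] _
      rw [Function.iterate_succ_apply']
      exact (congrArg (reinsert f) (hx ⟨b, by omega⟩)).symm
    intro a
    induction a with
    | zero =>
      rintro (_ | b) ha hb hab h
      · exact absurd hab (lt_irrefl _)
      have h1 := hcomp (hx ⟨0, ha⟩) (hsucc b hb) h
      have hc : Continuous (Sum.isLeft : X ⊕ Y → Bool) :=
        continuous_sum_dom.2 ⟨continuous_const, continuous_const⟩
      have := hc.image_eq_of_connectedComponent_eq _ _ (ConnectedComponents.coe_eq_coe.1 h1)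
      cases this
    | succ a ih =>
      rintro (_ | b) ha hb hab h
      · omega
      have h1 := hcomp (hsucc a ha) (hsucc b hb) h
      have hc : Continuous (Sum.elim id (fun _ => x ⟨a, by omega⟩) : X ⊕ Y → X) :=
        continuous_id.sumElim continuous_const
      have := (ConnectedComponents.continuous_coe.comp hc).image_eq_of_connectedComponent_eq _ _
        (ConnectedComponents.coe_eq_coe.1 h1)
      exact ih b (by omega) (by omega) (by omega) (ConnectedComponents.coe_eq_coe.1 this)
  have hinj : Function.Injective fun k : Fin (N + 1) =>
      (ConnectedComponents.mk (x k) : ConnectedComponents X) := by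
    intro a b hab
    have hab' := ConnectedComponents.coe_eq_coe.1 hab
    rcases lt_trichotomy a.1 b.1 with h | h | h
    · exact absurd hab' (hstep _ _ a.2 b.2 h)
    · exact Fin.ext h
    · exact absurd hab'.symm (hstep _ _ b.2 a.2 h)
  have := Nat.card_le_card_of_injective _ hinj
  rw [Nat.card_eq_fintype_card, Fintype.card_fin] at this
  omega

theorem finite_connectedComponents {n : ℕ} (X : CornerMfd n) [CompactSpace X] :
    Finite (ConnectedComponents X) := by
  have := ChartedSpace.locallyConnectedSpace (EuclideanQuadrant n) X
  have : DiscreteTopology (ConnectedComponents X) :=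
    ConnectedComponents.discreteTopology_iff.2 fun x => isOpen_connectedComponent
  have : CompactSpace (ConnectedComponents X) := Quotient.compactSpace
  exact finite_of_compact_of_discrete

end Cancellation

namespace GeomChain

variable {n : ℕ} {M : SmoothMfd.{u}}

/-- A map of chains: smooth, compatible with the maps to `M` and, at each point, an orientation
preserving isomorphism of tangent spaces. -/
structure IsEtale (σ τ : GeomChain n M) (f : σ.dom → τ.dom) : Prop where
  contMDiff : ContMDiff (Q n) (Q n) ∞ f
  carries : ∀ x, Carries (mfderiv (Q n) (Q n) f x) (σ.orient x) (τ.orient (f x))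
  map : ∀ x, τ.map (f x) = σ.map x

variable {σ τ υ : GeomChain n M}

theorem IsEtale.comp {f : σ.dom → τ.dom} {g : τ.dom → υ.dom} (hg : IsEtale τ υ g)
    (hf : IsEtale σ τ f) : IsEtale σ υ fun x => g (f x) where
  contMDiff := hg.contMDiff.comp hf.contMDiff
  carries x := carries_mfderiv_comp (hg.contMDiff.mdifferentiable (by simp) _)
    (hf.contMDiff.mdifferentiable (by simp) _) (hg.carries _) (hf.carries x)
  map x := (hg.map _).trans (hf.map x)

theorem IsEtale.inl (σ τ : GeomChain n M) : IsEtale σ (σ.sum τ) Sum.inl :=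
  ⟨ContMDiff.inl, fun x => carries_inl x _, fun _ => rfl⟩

theorem IsEtale.inr (σ τ : GeomChain n M) : IsEtale τ (σ.sum τ) Sum.inr :=
  ⟨ContMDiff.inr, fun x => carries_inr x _, fun _ => rfl⟩

theorem IsEtale.sumElim {f : σ.dom → υ.dom} {g : τ.dom → υ.dom} (hf : IsEtale σ υ f)
    (hg : IsEtale τ υ g) : IsEtale (σ.sum τ) υ (Sum.elim f g) where
  contMDiff := hf.contMDiff.sumElim hg.contMDiff
  carries := by
    have h : MDifferentiable (Q n) (Q n) (Sum.elim f g) :=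
      (hf.contMDiff.sumElim hg.contMDiff).mdifferentiable (by simp)
    rintro (x | x)
    · exact carries_sum_inl (h _) (hf.carries x)
    · exact carries_sum_inr (h _) (hg.carries x)
  map := by
    rintro (x | x)
    exacts [hf.map x, hg.map x]

theorem IsEtale.iterate {f : σ.dom → σ.dom} (hf : IsEtale σ σ f) (N : ℕ) :
    IsEtale σ σ f^[N] := by
  induction N with
  | zero => exact ⟨contMDiff_id, fun x => carries_id x _, fun _ => rfl⟩
  | succ N ih =>
    rw [Function.iterate_succ']
    exact hf.comp ih

theorem IsEtale.of_inr {f : σ.dom → υ.dom} (hf : IsEtale σ (τ.sum υ) fun x => Sum.inr (f x)) :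
    IsEtale σ υ f := by
  have hc : ContMDiff (Q n) (Q n) ∞ f := by
    intro x
    have h : ContMDiff (Q n) (Q n) ∞
        (Sum.elim (fun _ => f x) id : τ.dom ⊕ υ.dom → υ.dom) :=
      contMDiff_const.sumElim contMDiff_id
    exact (h.comp hf.contMDiff) x
  refine ⟨hc, fun x => ?_, hf.map⟩
  have hd := hasMFDerivAt_inr (I := Q n) (M := τ.dom) (M' := υ.dom) (q' := f x) (p := Sum.inr (f x))
  have := mfderiv_comp (I'' := Q n) x hd.mdifferentiableAt (hc.mdifferentiable (by simp) x)
  rw [hd.mfderiv] at this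
  obtain ⟨A, hA, hAo⟩ := hf.carries x
  exact ⟨A, fun v => (hA v).trans (congrArg (fun L : Vec n →L[ℝ] Vec n => L v) this), hAo⟩

theorem exists_isEtale_of_sum (h : (σ.sum τ).Isomorphic (σ.sum υ)) :
    ∃ (f : σ.dom ⊕ τ.dom ≃ₜ σ.dom ⊕ υ.dom), IsEtale (σ.sum τ) (σ.sum υ) f ∧
      IsEtale (σ.sum υ) (σ.sum τ) f.symm := by
  obtain ⟨f, h1, h2⟩ := isomorphic_iff.1 h
  exact ⟨f.toHomeomorph, ⟨f.contMDiff, h1, h2⟩, ⟨f.symm.contMDiff, Diffeomorph.carries_symm f h1,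
    fun p => by
      have := h2 (f.symm p)
      rw [f.apply_symm_apply] at this
      exact this.symm⟩⟩

/-- Chains up to isomorphism form a cancellative monoid under disjoint union. -/
theorem Isomorphic.sum_left_cancel (h : (σ.sum τ).Isomorphic (σ.sum υ)) : τ.Isomorphic υ := by
  obtain ⟨f, hf, hf'⟩ := exists_isEtale_of_sum h
  have := finite_connectedComponents σ.dom
  have key : ∀ (τ υ : GeomChain n M) (f : σ.dom ⊕ τ.dom ≃ₜ σ.dom ⊕ υ.dom),
      IsEtale (σ.sum τ) (σ.sum υ) f → ∃ g : τ.dom → υ.dom, IsEtale τ υ g ∧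
        ∀ y, (reinsert f)^[Nat.card (ConnectedComponents σ.dom)] (f (Sum.inr y)) =
          Sum.inr (g y) := by
    intro τ υ f hf
    choose g hg using reinsert_iterate_eq_inr f le_rfl
    refine ⟨g, IsEtale.of_inr (τ := σ) ?_, hg⟩
    have hS : IsEtale (σ.sum υ) (σ.sum υ) (reinsert f) :=
      (hf.comp (IsEtale.inl σ τ)).sumElim (IsEtale.inr σ υ)
    have := (hS.iterate (Nat.card (ConnectedComponents σ.dom))).comp (hf.comp (IsEtale.inr σ τ))
    exact (funext hg : (fun y => _) = fun y => _) ▸ this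
  obtain ⟨g, hg, hg1⟩ := key τ υ f hf
  obtain ⟨g', hg', hg1'⟩ := key υ τ f.symm hf'
  have hl : ∀ y, g' (g y) = y := fun y => Sum.inr_injective (α := σ.dom) <| by
    rw [← hg1', ← hg1]
    exact reinsert_symm_iterate f.toEquiv y _
  have hr : ∀ y, g (g' y) = y := fun y => Sum.inr_injective (α := σ.dom) <| by
    rw [← hg1, ← hg1']
    exact reinsert_symm_iterate f.toEquiv.symm y _
  exact isomorphic_iff.2 ⟨⟨⟨g, g', hl, hr⟩, hg.contMDiff, hg'.contMDiff⟩, hg.carries, hg.map⟩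

end GeomChain

/-! ### The product of a manifold with corners and the unit interval -/

section Cylinder

open Module

theorem contMDiff_halfSpace_coord :
    ContMDiff (𝓡∂ 1) 𝓘(ℝ) ∞ fun x : EuclideanHalfSpace 1 => x.1 0 :=
  ((PiLp.proj 2 (fun _ : Fin 1 => ℝ) 0 : EuclideanSpace ℝ (Fin 1) →L[ℝ] ℝ).contMDiff).comp
    (𝓡∂ 1).contMDiff

theorem contMDiffAt_halfSpace {E H X : Type*} [NormedAddCommGroup E] [NormedSpace ℝ E]
    [TopologicalSpace H] {I : ModelWithCorners ℝ E H} [TopologicalSpace X] [ChartedSpace H X]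
    {f : X → EuclideanHalfSpace 1} {x : X} (h : ContMDiffAt I 𝓘(ℝ) ∞ (fun x => (f x).1 0) x) :
    ContMDiffAt I (𝓡∂ 1) ∞ f x := by
  have h2 : ContMDiffAt I 𝓘(ℝ, EuclideanSpace ℝ (Fin 1)) ∞ (fun x => (f x).1) x := by
    have h1 : ContMDiffAt I 𝓘(ℝ, Fin 1 → ℝ) ∞ (fun x => WithLp.ofLp (f x).1) x :=
      contMDiffAt_pi_space.2 fun i => by rw [Subsingleton.elim i 0]; exact h
    exact ((PiLp.continuousLinearEquiv 2 ℝ fun _ : Fin 1 => ℝ).symm.contDiff.contMDiff _).comp x h1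
  rw [contMDiffAt_iff_target]
  exact ⟨(Topology.IsInducing.subtypeVal.continuousAt_iff).2 h2.continuousAt, h2⟩

/-- The identification of `[0,∞)ⁿ × [0,∞)` with `[0,∞)ⁿ⁺¹`. -/
def snocEquiv (n : ℕ) : (EuclideanQuadrant n × EuclideanHalfSpace 1) ≃ EuclideanQuadrant (n + 1) where
  toFun x := ⟨WithLp.toLp 2 (Fin.snoc (fun i => x.1.1 i) (x.2.1 0)), fun i => by
    refine Fin.lastCases ?_ (fun i => ?_) i
    · simpa using x.2.2
    · simpa using x.1.2 i⟩
  invFun y := (⟨WithLp.toLp 2 fun i => y.1 i.castSucc, fun i => y.2 _⟩,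
    ⟨WithLp.toLp 2 fun _ => y.1 (Fin.last n), y.2 _⟩)
  left_inv x := by
    refine Prod.ext (quadrant_ext fun i => by simp) (Subtype.ext (PiLp.ext fun i => ?_))
    rw [Subsingleton.elim i 0]
    simp
  right_inv y := quadrant_ext fun i => by
    refine Fin.lastCases ?_ (fun i => ?_) i <;> simp

theorem contMDiff_snocEquiv (n : ℕ) : ContMDiff ((Q n).prod (𝓡∂ 1)) (Q (n + 1)) ∞
    (snocEquiv n) := fun x => contMDiffAt_coords fun i => by
  refine Fin.lastCases ?_ (fun i => ?_) i
  · simpa [snocEquiv] using! (contMDiff_halfSpace_coord.comp contMDiff_snd) x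
  · simpa [snocEquiv] using! ((contMDiff_coord i).comp contMDiff_fst) x

theorem contMDiff_snocEquiv_symm (n : ℕ) : ContMDiff (Q (n + 1)) ((Q n).prod (𝓡∂ 1)) ∞
    (snocEquiv n).symm := fun y =>
  ContMDiffAt.prodMk (contMDiffAt_coords fun i => contMDiff_coord i.castSucc y)
    (contMDiffAt_halfSpace (contMDiff_coord (Fin.last n) y))

/-- The identification of `[0,∞)ⁿ × [0,∞)` with `[0,∞)ⁿ⁺¹` as a diffeomorphism of model spaces. -/
def snocDiffeo (n : ℕ) : ModelProd (EuclideanQuadrant n) (EuclideanHalfSpace 1) ≃ₘ⟮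
    (Q n).prod (𝓡∂ 1), Q (n + 1)⟯ EuclideanQuadrant (n + 1) where
  toEquiv := snocEquiv n
  contMDiff_toFun := by
    have h := contMDiff_snocEquiv n
    rwa [chartedSpaceSelf_prod] at h
  contMDiff_invFun := by
    have h := contMDiff_snocEquiv_symm n
    rwa [chartedSpaceSelf_prod] at h

@[simp] theorem snocDiffeo_castSucc {n : ℕ} (x : EuclideanQuadrant n × EuclideanHalfSpace 1)
    (i : Fin n) : (snocDiffeo n x).1 i.castSucc = x.1.1 i := by
  change (Fin.snoc (α := fun _ => ℝ) _ _ : Fin (n + 1) → ℝ) _ = _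
  simp

@[simp] theorem snocDiffeo_last {n : ℕ} (x : EuclideanQuadrant n × EuclideanHalfSpace 1) :
    (snocDiffeo n x).1 (Fin.last n) = x.2.1 0 := by
  change (Fin.snoc (α := fun _ => ℝ) _ _ : Fin (n + 1) → ℝ) _ = _
  simp

/-- The points of `P × [0,1]`. -/
def CylinderPoint {n : ℕ} (P : CornerMfd n) : Type := P × Icc (0 : ℝ) 1

namespace CylinderPoint

variable {n : ℕ} {P : CornerMfd n}

instance : TopologicalSpace (CylinderPoint P) := inferInstanceAs (TopologicalSpace (P × Icc (0 : ℝ) 1))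
instance : T2Space (CylinderPoint P) := inferInstanceAs (T2Space (P × Icc (0 : ℝ) 1))
instance : SecondCountableTopology (CylinderPoint P) :=
  inferInstanceAs (SecondCountableTopology (P × Icc (0 : ℝ) 1))

/-- A chart of the product, with values in `[0,∞)ⁿ⁺¹`. -/
def chart (f : OpenPartialHomeomorph (P × Icc (0 : ℝ) 1)
    (ModelProd (EuclideanQuadrant n) (EuclideanHalfSpace 1))) :
    OpenPartialHomeomorph (CylinderPoint P) (EuclideanQuadrant (n + 1)) :=
  f.transHomeomorph (snocDiffeo n).toHomeomorph

instance : ChartedSpace (EuclideanQuadrant (n + 1)) (CylinderPoint P) where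
  atlas := chart '' atlas (ModelProd (EuclideanQuadrant n) (EuclideanHalfSpace 1))
    (P × Icc (0 : ℝ) 1)
  chartAt x := chart (chartAt (ModelProd (EuclideanQuadrant n) (EuclideanHalfSpace 1))
    (x : P × Icc (0 : ℝ) 1))
  mem_chart_source x := by
    exact mem_chart_source (ModelProd (EuclideanQuadrant n) (EuclideanHalfSpace 1))
      (show P × Icc (0 : ℝ) 1 from x)
  chart_mem_atlas x := ⟨_, chart_mem_atlas _ _, rfl⟩

instance : IsManifold (Q (n + 1)) ∞ (CylinderPoint P) := by
  refine isManifold_of_contDiffOn (Q (n + 1)) ∞ (CylinderPoint P) fun e e' he he' => ?_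
  obtain ⟨f, hf, rfl⟩ : ∃ f ∈ _, chart f = e := he
  obtain ⟨f', hf', rfl⟩ : ∃ f ∈ _, chart f = e' := he'
  rw [← contMDiffOn_iff_contDiffOn]
  have hf := IsManifold.subset_maximalAtlas (I := (Q n).prod (𝓡∂ 1)) (n := ∞) hf
  have hf' := IsManifold.subset_maximalAtlas (I := (Q n).prod (𝓡∂ 1)) (n := ∞) hf'
  have h1 : ContMDiffOn ((Q n).prod (𝓡∂ 1)) ((Q n).prod (𝓡∂ 1)) ∞ (fun x => f' (f.symm x))
      (f.symm.trans f').source :=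
    (contMDiffOn_of_mem_maximalAtlas hf').comp
      ((contMDiffOn_symm_of_mem_maximalAtlas hf).mono fun x hx => hx.1) fun x hx => hx.2
  refine (Q (n + 1)).contMDiff.comp_contMDiffOn ?_
  refine (snocDiffeo n).contMDiff.comp_contMDiffOn ?_
  refine h1.comp (((snocDiffeo n).symm.contMDiff.comp_contMDiffOn
    ((Q (n + 1)).contMDiffOn_symm.mono inter_subset_right))) fun x hx => ?_
  exact hx.1

end CylinderPoint

open CylinderPoint

variable {n : ℕ} {P : CornerMfd n}

/-- The manifold with corners `P × [0,1]`. -/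
def cylinderMfd (P : CornerMfd n) : CornerMfd (n + 1) where
  carrier := CylinderPoint P

theorem mem_chart_source_cylinder (x : P × Icc (0 : ℝ) 1) :
    x ∈ (chart (chartAt (ModelProd (EuclideanQuadrant n) (EuclideanHalfSpace 1)) x)).source :=
  mem_chart_source (ModelProd (EuclideanQuadrant n) (EuclideanHalfSpace 1)) x

theorem chart_chartAt_mem_maxAtlas (x : P × Icc (0 : ℝ) 1) :
    chart (chartAt (ModelProd (EuclideanQuadrant n) (EuclideanHalfSpace 1)) x) ∈
      maxAtlas (cylinderMfd P) :=
  chart_mem_maxAtlas (P := cylinderMfd P) x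

/-- The underlying map is the identity. -/
def cylinderDiffeo (P : CornerMfd n) :
    cylinderMfd P ≃ₘ⟮Q (n + 1), (Q n).prod (𝓡∂ 1)⟯ (P × Icc (0 : ℝ) 1) where
  toFun x := x
  invFun x := x
  left_inv _ := rfl
  right_inv _ := rfl
  contMDiff_toFun x := by
    let f := chartAt (ModelProd (EuclideanQuadrant n) (EuclideanHalfSpace 1))
      (show P × Icc (0 : ℝ) 1 from x)
    have hx := mem_chart_source_cylinder (P := P) x
    have h1 := contMDiffAt_of_mem_maximalAtlas (chart_chartAt_mem_maxAtlas (P := P) x) hx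
    have hx' : x ∈ f.source := hx
    have h2 : ContMDiffAt ((Q n).prod (𝓡∂ 1)) ((Q n).prod (𝓡∂ 1)) ∞ f.symm (f x) :=
      contMDiffAt_symm_of_mem_maximalAtlas (IsManifold.chart_mem_maximalAtlas _) (f.map_source hx')
    have h3 := (snocDiffeo n).symm.contMDiff.contMDiffAt.comp x h1
    have h4 : (snocDiffeo n).symm (chart f x) = f x := (snocDiffeo n).symm_apply_apply (f x)
    have h5 := ContMDiffAt.comp x (h4.symm ▸ h2) h3
    refine h5.congr_of_eventuallyEq ?_
    filter_upwards [(chart f).open_source.mem_nhds hx] with y hy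
    have hy' : y ∈ f.source := hy
    exact ((congrArg f.symm ((snocDiffeo n).symm_apply_apply (f y))).trans (f.left_inv hy')).symm
  contMDiff_invFun x := by
    let f := chartAt (ModelProd (EuclideanQuadrant n) (EuclideanHalfSpace 1)) x
    have hx := mem_chart_source_cylinder (P := P) x
    have h1 : ContMDiffAt ((Q n).prod (𝓡∂ 1)) ((Q n).prod (𝓡∂ 1)) ∞ f x :=
      contMDiffAt_of_mem_maximalAtlas (IsManifold.chart_mem_maximalAtlas _) hx
    have h2 := contMDiffAt_symm_of_mem_maximalAtlas (chart_chartAt_mem_maxAtlas (P := P) x)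
      ((chart f).map_source hx)
    have h3 := (snocDiffeo n).contMDiff.contMDiffAt.comp x h1
    have h5 := ContMDiffAt.comp x h2 h3
    refine h5.congr_of_eventuallyEq ?_
    filter_upwards [f.open_source.mem_nhds hx] with y hy
    exact ((chart f).left_inv hy).symm

theorem chart_mem_maxAtlas_cylinder {f : OpenPartialHomeomorph (P × Icc (0 : ℝ) 1)
    (ModelProd (EuclideanQuadrant n) (EuclideanHalfSpace 1))}
    (hf : f ∈ IsManifold.maximalAtlas ((Q n).prod (𝓡∂ 1)) ∞ (P × Icc (0 : ℝ) 1)) :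
    chart f ∈ maxAtlas (cylinderMfd P) := by
  refine OpenPartialHomeomorph.mem_maximalAtlas_of_contMDiffOn _ ?_ ?_
  · exact (snocDiffeo n).contMDiff.comp_contMDiffOn ((contMDiffOn_of_mem_maximalAtlas hf).comp
      (cylinderDiffeo P).contMDiff.contMDiffOn fun x hx => hx)
  · exact (cylinderDiffeo P).symm.contMDiff.comp_contMDiffOn
      ((contMDiffOn_symm_of_mem_maximalAtlas hf).comp (snocDiffeo n).symm.contMDiff.contMDiffOn
        fun x hx => hx)

/-- The projection `P × [0,1] → P`. -/
def cylinderFst (x : cylinderMfd P) : P := (cylinderDiffeo P x).1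

/-- The projection `P × [0,1] → [0,1]`, as a real valued function. -/
def cylinderSnd (x : cylinderMfd P) : ℝ := (cylinderDiffeo P x).2

theorem contMDiff_cylinderFst : ContMDiff (Q (n + 1)) (Q n) ∞ (cylinderFst (P := P)) :=
  contMDiff_fst.comp (cylinderDiffeo P).contMDiff

theorem contMDiff_cylinderSnd : ContMDiff (Q (n + 1)) 𝓘(ℝ) ∞ (cylinderSnd (P := P)) :=
  contMDiff_subtypeVal_Icc.comp (contMDiff_snd.comp (cylinderDiffeo P).contMDiff)

/-- Around each point of `[0,1]` there is a chart given by `t ↦ t` or by `t ↦ 1 - t`. -/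
theorem exists_interval_chart (t : Icc (0 : ℝ) 1) :
    ∃ c ∈ IsManifold.maximalAtlas (𝓡∂ 1) ∞ (Icc (0 : ℝ) 1), t ∈ c.source ∧
      ∃ a s : ℝ, (a = 0 ∧ s = 1 ∧ t < 1 ∨ a = 1 ∧ s = -1 ∧ t = 1) ∧
        ∀ y, (c y).1 0 = a + s * y := by
  rcases t.2.2.lt_or_eq with h | h
  · refine ⟨IccLeftChart 0 1, IsManifold.subset_maximalAtlas (Or.inl rfl), h, 0, 1,
      Or.inl ⟨rfl, rfl, h⟩, fun y => ?_⟩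
    rw [IccLeftChart_apply]
    simp
  · refine ⟨IccRightChart 0 1, IsManifold.subset_maximalAtlas (Or.inr rfl), ?_, 1, -1,
      Or.inr ⟨rfl, rfl, Subtype.ext h⟩, fun y => ?_⟩
    · change 0 < t.1
      rw [h]; exact one_pos
    · rw [IccRightChart_apply]
      simp [sub_eq_add_neg]

/-- Product charts: the first coordinates are those of a given chart of `P`, the last one is `t` or
`1 - t`. -/
theorem exists_product_chart {e : OpenPartialHomeomorph P (EuclideanQuadrant n)} (he : e ∈ maxAtlas P)
    (t : Icc (0 : ℝ) 1) :
    ∃ E ∈ maxAtlas (cylinderMfd P), (∀ x : cylinderMfd P, x ∈ E.source →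
        cylinderFst x ∈ e.source) ∧
      (∀ x : P, x ∈ e.source → (cylinderDiffeo P).symm (x, t) ∈ E.source) ∧
      (∀ (x : cylinderMfd P) j, (E x).1 j.castSucc = (e (cylinderFst x)).1 j) ∧
      ∃ a s : ℝ, (a = 0 ∧ s = 1 ∧ t < 1 ∨ a = 1 ∧ s = -1 ∧ t = 1) ∧
        ∀ x : cylinderMfd P, (E x).1 (Fin.last n) = a + s * cylinderSnd x := by
  obtain ⟨c, hc, htc, a, s, has, hcs⟩ := exists_interval_chart t
  refine ⟨chart (e.prod c), chart_mem_maxAtlas_cylinder (IsManifold.mem_maximalAtlas_prod he hc),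
    fun x hx => hx.1, fun x hx => ⟨hx, htc⟩, fun x j => ?_, a, s, has, fun x => ?_⟩
  · exact snocDiffeo_castSucc _ j
  · exact (snocDiffeo_last _).trans (hcs _)

end Cylinder

/-! ### Product orientations -/

section SnocBasis

open Module

variable {n : ℕ} {V W V' W' : Type*} [AddCommGroup V] [Module ℝ V] [AddCommGroup W] [Module ℝ W]
  [AddCommGroup V'] [Module ℝ V'] [AddCommGroup W'] [Module ℝ W']

/-- For a space `V` identified with `W × ℝ` by the maps `A` and `τ`: the family `w` is `(v, ∂ₜ)`. -/
def IsSnoc (A : V → W) (τ : V → ℝ) (v : Fin n → W) (w : Fin (n + 1) → V) : Prop :=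
  (∀ j : Fin n, A (w j.castSucc) = v j ∧ τ (w j.castSucc) = 0) ∧
    A (w (Fin.last n)) = 0 ∧ τ (w (Fin.last n)) = 1

/-- The orientation `O` of `V = W × ℝ` is the product orientation: a basis `(v, ∂ₜ)` is positive if
and only if the basis `v` of `W` is positive. -/
def IsProductOrientation (A : V → W) (τ : V → ℝ) (o : Orientation ℝ W (Fin n))
    (O : Orientation ℝ V (Fin (n + 1))) : Prop :=
  ∀ v : Basis (Fin n) ℝ W, ∃ w : Basis (Fin (n + 1)) ℝ V, IsSnoc A τ v w ∧
    (w.orientation = O ↔ v.orientation = o)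

theorem IsSnoc.ext {A : V →ₗ[ℝ] W} {τ : V →ₗ[ℝ] ℝ} {v : Basis (Fin n) ℝ W}
    {w : Basis (Fin (n + 1)) ℝ V} (h : IsSnoc A τ v w) {x y : V} (hA : A x = A y) (hτ : τ x = τ y) :
    x = y := by
  obtain ⟨h1, h2, h3⟩ := h
  have hz : ∀ x, A x = 0 → τ x = 0 → x = 0 := by
    intro x hA hτ
    have hx := w.sum_repr x
    rw [Fin.sum_univ_castSucc] at hx
    have hl : w.repr x (Fin.last n) = 0 := by
      have := congrArg τ hx
      simpa [h3, (h1 _).2, hτ] using this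
    have hc : ∀ j : Fin n, w.repr x j.castSucc = 0 := by
      have := congrArg A hx
      simp only [map_add, map_sum, map_smul, (h1 _).1, h2, smul_zero, add_zero, hA] at this
      exact Fintype.linearIndependent_iff.1 v.linearIndependent _ this
    rw [← w.sum_repr x, Fin.sum_univ_castSucc]
    simp [hl, hc]
  exact sub_eq_zero.1 (hz _ (by rw [map_sub, hA, sub_self]) (by rw [map_sub, hτ, sub_self]))

theorem isProductOrientation_of_basis {A : V →ₗ[ℝ] W} {τ : V →ₗ[ℝ] ℝ} {v₀ : Basis (Fin n) ℝ W}
    {w₀ : Basis (Fin (n + 1)) ℝ V} (h : IsSnoc A τ v₀ w₀) {o : Orientation ℝ W (Fin n)}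
    {O : Orientation ℝ V (Fin (n + 1))} (ho : w₀.orientation = O ↔ v₀.orientation = o) :
    IsProductOrientation A τ o O := by
  intro v
  obtain ⟨w, h1, h2, h3, h4⟩ := exists_basis_snoc A τ w₀ v₀ v h.1 h.2.1 h.2.2
  refine ⟨w, ⟨h1, h2, h3⟩, ?_⟩
  rw [orientation_eq_iff_iff w w₀ O, orientation_eq_iff_iff v v₀ o, ho] at h4
  tauto

theorem exists_isProductOrientation {A : V →ₗ[ℝ] W} {τ : V →ₗ[ℝ] ℝ} {v₀ : Basis (Fin n) ℝ W}
    {w₀ : Basis (Fin (n + 1)) ℝ V} (h : IsSnoc A τ v₀ w₀) (o : Orientation ℝ W (Fin n)) :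
    ∃ O, IsProductOrientation A τ o O := by
  by_cases h1 : v₀.orientation = o
  · exact ⟨w₀.orientation, isProductOrientation_of_basis h (by simp [h1])⟩
  · refine ⟨-w₀.orientation, isProductOrientation_of_basis h ?_⟩
    rw [orientation_eq_neg_iff]
    simp [h1]

theorem IsProductOrientation.iff {A : V →ₗ[ℝ] W} {τ : V →ₗ[ℝ] ℝ} {v : Basis (Fin n) ℝ W}
    {w : Basis (Fin (n + 1)) ℝ V} (h : IsSnoc A τ v w) {o : Orientation ℝ W (Fin n)}
    {O : Orientation ℝ V (Fin (n + 1))} (ho : IsProductOrientation A τ o O) :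
    w.orientation = O ↔ v.orientation = o := by
  obtain ⟨w', hw', ho'⟩ := ho v
  have : w = w' := by
    refine Basis.eq_of_apply_eq fun j => ?_
    refine Fin.lastCases ?_ (fun j => ?_) j
    · exact h.ext (h.2.1.trans hw'.2.1.symm) (h.2.2.trans hw'.2.2.symm)
    · exact h.ext ((h.1 j).1.trans (hw'.1 j).1.symm) ((h.1 j).2.trans (hw'.1 j).2.symm)
  rw [this, ho']

theorem IsProductOrientation.neg {A : V → W} {τ : V → ℝ} {o : Orientation ℝ W (Fin n)}
    {O : Orientation ℝ V (Fin (n + 1))} (ho : IsProductOrientation A τ o O) :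
    IsProductOrientation A τ (-o) (-O) := fun v => by
  obtain ⟨w, h1, h2⟩ := ho v
  refine ⟨w, h1, ?_⟩
  rw [orientation_eq_neg_iff, orientation_eq_neg_iff, h2]

/-- Product orientations are natural. -/
theorem IsProductOrientation.carries {A : V →ₗ[ℝ] W} {τ : V →ₗ[ℝ] ℝ} {A' : V' →ₗ[ℝ] W'}
    {τ' : V' →ₗ[ℝ] ℝ} {o : Orientation ℝ W (Fin n)} {O : Orientation ℝ V (Fin (n + 1))}
    {o' : Orientation ℝ W' (Fin n)} {O' : Orientation ℝ V' (Fin (n + 1))}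
    (h : IsProductOrientation A τ o O) (h' : IsProductOrientation A' τ' o' O')
    {L : V →ₗ[ℝ] V'} {f : W →ₗ[ℝ] W'} (hf : Carries f o o') (hA : ∀ x, A' (L x) = f (A x))
    (hτ : ∀ x, τ' (L x) = τ x) (v : Basis (Fin n) ℝ W) : Carries L O O' := by
  obtain ⟨w, hw, hwo⟩ := h v
  obtain ⟨v', hv', hvo⟩ := hf.basis v
  obtain ⟨w', hw', hwo'⟩ := h' v'
  refine carries_of_basis w w' (fun j => ?_) (by rw [hwo', hvo, hwo])
  refine Fin.lastCases ?_ (fun j => ?_) j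
  · refine hw'.ext ?_ ?_
    · rw [hA, hw.2.1, hw'.2.1, map_zero]
    · rw [hτ, hw.2.2, hw'.2.2]
  · refine hw'.ext ?_ ?_
    · rw [hA, (hw.1 j).1, (hw'.1 j).1, hv']
    · rw [hτ, (hw.1 j).2, (hw'.1 j).2]

end SnocBasis

section CylinderOrientation

open Module

variable {n : ℕ} {P : CornerMfd n}

/-- The derivative of the projection `P × [0,1] → P`. -/
def tangentFst (x : cylinderMfd P) :
    TangentSpace (Q (n + 1)) x →ₗ[ℝ] TangentSpace (Q n) (cylinderFst x) :=
  (mfderiv (Q (n + 1)) (Q n) cylinderFst x).toLinearMap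

/-- The derivative of the projection `P × [0,1] → [0,1]`. -/
def tangentSnd (x : cylinderMfd P) : TangentSpace (Q (n + 1)) x →ₗ[ℝ] ℝ :=
  (show TangentSpace (Q (n + 1)) x →L[ℝ] ℝ from
    mfderiv (Q (n + 1)) 𝓘(ℝ) cylinderSnd x).toLinearMap

variable {e : OpenPartialHomeomorph P (EuclideanQuadrant n)}
  {E : OpenPartialHomeomorph (cylinderMfd P) (EuclideanQuadrant (n + 1))}

theorem chartComponent_castSucc (he : e ∈ maxAtlas P) {x : cylinderMfd P}
    (hx : cylinderFst x ∈ e.source)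
    (hEe : ∀ (x : cylinderMfd P) j, (E x).1 j.castSucc = (e (cylinderFst x)).1 j) (j : Fin n)
    (w : TangentSpace (Q (n + 1)) x) :
    chartComponent E j.castSucc x w = chartComponent e j (cylinderFst x) (tangentFst x w) := by
  refine Eq.trans ?_ (chartComponent_mfderiv
    (contMDiff_cylinderFst.mdifferentiable (by simp) x) he hx j w).symm
  exact congrArg (fun f => (mfderiv (Q (n + 1)) 𝓘(ℝ) f x : Vec (n + 1) →L[ℝ] ℝ) w)
    (funext fun y => hEe y j : (fun y => (E y).1 j.castSucc) = _)

theorem chartComponent_last {x : cylinderMfd P} {a s : ℝ}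
    (hEs : ∀ x : cylinderMfd P, (E x).1 (Fin.last n) = a + s * cylinderSnd x)
    (w : TangentSpace (Q (n + 1)) x) :
    chartComponent E (Fin.last n) x w = s * tangentSnd x w := by
  have h := (contMDiff_cylinderSnd (P := P)).mdifferentiable (by simp) x
  have h1 : HasMFDerivAt (Q (n + 1)) 𝓘(ℝ) (fun x : cylinderMfd P => a + s * cylinderSnd x) x
      (s • (mfderiv (Q (n + 1)) 𝓘(ℝ) cylinderSnd x : Vec (n + 1) →L[ℝ] ℝ)) := by
    have h2 : HasFDerivAt (fun t : ℝ => a + s * t) (s • ContinuousLinearMap.id ℝ ℝ)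
        (cylinderSnd x) := by
      simpa using ((hasFDerivAt_id (𝕜 := ℝ) (cylinderSnd x)).const_smul s).const_add a
    have h3 := (h2.hasMFDerivAt).comp x h.hasMFDerivAt
    convert! h3 using 1
  exact (congrArg (fun f => (mfderiv (Q (n + 1)) 𝓘(ℝ) f x : Vec (n + 1) →L[ℝ] ℝ) w)
    (funext hEs : (fun y => (E y).1 (Fin.last n)) = _)).trans
    (congrArg (fun L : Vec (n + 1) →L[ℝ] ℝ => L w) h1.mfderiv)

/-- The basis of `ℝⁿ⁺¹` that corresponds to `(∂₁, …, ∂ₙ, ∂ₜ)` in a product chart with last coordinate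
`t` (for `s = 1`) or `1 - t` (for `s = -1`). -/
theorem exists_basis_last (n : ℕ) {s : ℝ} (hs : s * s = 1) :
    ∃ F : Basis (Fin (n + 1)) ℝ (Vec (n + 1)), ∀ i j : Fin (n + 1),
      F i j = if i = j then (if j = Fin.last n then s else 1) else 0 := by
  let u : ℝˣ := ⟨s, s, hs, hs⟩
  let U : Fin (n + 1) → ℝˣ := fun j => if j = Fin.last n then u else 1
  refine ⟨(EuclideanSpace.basisFun (Fin (n + 1)) ℝ).toBasis.unitsSMul U, fun i j => ?_⟩
  rw [Basis.unitsSMul_apply]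
  simp only [OrthonormalBasis.coe_toBasis, EuclideanSpace.basisFun_apply]
  by_cases hij : i = j
  · subst hij
    by_cases hl : i = Fin.last n
    · simp [U, u, hl, Units.smul_def]
    · simp [U, hl]
  · simp [hij, Units.smul_def, Ne.symm hij]

theorem isSnoc_frame (he : e ∈ maxAtlas P) {x : cylinderMfd P} (hx : cylinderFst x ∈ e.source)
    (hE : E ∈ maxAtlas (cylinderMfd P)) (hxE : x ∈ E.source)
    (hEe : ∀ (x : cylinderMfd P) j, (E x).1 j.castSucc = (e (cylinderFst x)).1 j) {a s : ℝ}
    (hs : s * s = 1)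
    (hEs : ∀ x : cylinderMfd P, (E x).1 (Fin.last n) = a + s * cylinderSnd x)
    {F : Basis (Fin (n + 1)) ℝ (Vec (n + 1))}
    (hF : ∀ i j : Fin (n + 1), F i j = if i = j then (if j = Fin.last n then s else 1) else 0) :
    IsSnoc (tangentFst x) (tangentSnd x) (frame he hx)
      (F.map (chartEquiv hE hxE).symm.toLinearEquiv) := by
  have hcomp : ∀ i j, chartComponent E j x (F.map (chartEquiv hE hxE).symm.toLinearEquiv i) =
      F i j := fun i j => by
    rw [chartComponent_eq hE hxE]
    simp
  have hcast := chartComponent_castSucc he hx hEe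
  have hlast : ∀ w, tangentSnd x w = s * chartComponent E (Fin.last n) x w := fun w => by
    rw [chartComponent_last hEs, ← mul_assoc, hs, one_mul]
  refine ⟨fun j => ⟨eq_of_chartComponent he hx fun i => ?_, ?_⟩,
    eq_of_chartComponent he hx fun i => ?_, ?_⟩
  · rw [← hcast, hcomp, hF, chartComponent_frame]
    simp [eq_comm]
  · rw [hlast, hcomp, hF]
    simp [Fin.castSucc_ne_last]
  · rw [← hcast, hcomp, hF, chartComponent_eq he hx, map_zero]
    simp [(Fin.castSucc_ne_last i).symm]
  · rw [hlast, hcomp, hF]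
    simpa using hs

theorem exists_product_frame (x : cylinderMfd P) : ∃ (v₀ : Basis (Fin n) ℝ _)
    (w₀ : Basis (Fin (n + 1)) ℝ _), IsSnoc (tangentFst x) (tangentSnd x) v₀ w₀ := by
  have he := chart_mem_maxAtlas (cylinderFst x)
  obtain ⟨E, hE, h1, h2, h3, a, s, has, h4⟩ := exists_product_chart he (cylinderDiffeo P x).2
  have hs : s * s = 1 := by rcases has with h | h <;> rw [h.2.1] <;> norm_num
  obtain ⟨F, hF⟩ := exists_basis_last n hs
  exact ⟨_, _, isSnoc_frame he (mem_chart_source _ _) hE (h2 _ (mem_chart_source _ (cylinderFst x)))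
    h3 hs h4 hF⟩

theorem frame_orientation_iff {n : ℕ} {P : CornerMfd n}
    {e : OpenPartialHomeomorph P (EuclideanQuadrant n)} (he : e ∈ maxAtlas P) {x : P}
    (hx : x ∈ e.source) (F : Basis (Fin n) ℝ (Vec n)) :
    (frame he hx).orientation = (F.map (chartEquiv he hx).symm.toLinearEquiv).orientation ↔
      (EuclideanSpace.basisFun (Fin n) ℝ).toBasis.orientation = F.orientation := by
  have h7 : (F.map (chartEquiv he hx).symm.toLinearEquiv).map (chartEquiv he hx).toLinearEquiv = F :=
    Basis.eq_of_apply_eq fun i => by simp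
  rw [← orientation_map_eq_map_iff _ _ (chartEquiv he hx).toLinearEquiv, frame_map, h7]

theorem iff_of_iff_iff {a b c d : Prop} (h : (a ↔ b) ↔ c) (h' : b ↔ d) : a ↔ (c ↔ d) := by
  tauto

theorem isOrientationField_of_product {o : OrientationField P} (ho : IsOrientationField o)
    {O : OrientationField (cylinderMfd P)}
    (hO : ∀ x, IsProductOrientation (tangentFst x) (tangentSnd x) (o (cylinderFst x)) (O x)) :
    IsOrientationField O := by
  refine isOrientationField_of_frames fun x => ?_
  have he := chart_mem_maxAtlas (cylinderFst x)
  obtain ⟨E, hE, h1, h2, h3, a, s, has, h4⟩ := exists_product_chart he (cylinderDiffeo P x).2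
  have hs : s * s = 1 := by rcases has with h | h <;> rw [h.2.1] <;> norm_num
  obtain ⟨F, hF⟩ := exists_basis_last n hs
  have hp := mem_chart_source (EuclideanQuadrant n) (cylinderFst x)
  refine ⟨E, hE, h2 _ hp, ?_⟩
  have key : ∀ (y : cylinderMfd P) (hy : y ∈ E.source), (frame hE hy).orientation = O y ↔
      ((EuclideanSpace.basisFun (Fin (n + 1)) ℝ).toBasis.orientation = F.orientation ↔
        (frame he (h1 y hy)).orientation = o (cylinderFst y)) := by
    intro y hy
    have hsn := isSnoc_frame he (h1 y hy) hE hy h3 hs h4 hF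
    have h5 := (hO y).iff hsn
    have h6 := (orientation_eq_iff_iff _ _ (O y)).symm.trans (frame_orientation_iff hE hy F)
    exact iff_of_iff_iff h6 h5
  have hc := (contMDiff_cylinderFst (P := P)).continuous.continuousAt (x := x)
  filter_upwards [hc.eventually (ho.eventually_frame he hp)] with y hy hyE
  exact (key y hyE).trans ((iff_congr Iff.rfl (hy (h1 y hyE))).trans (key x (h2 _ hp)).symm)

end CylinderOrientation

/-! ### The geometric boundary of a cylinder -/

section SumElim

variable {n : ℕ} {B B' : CornerMfd n} {P : CornerMfd (n + 1)} {κ : B → P} {κ' : B' → P}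

theorem isLocalFaceAt_sumElim (h : ∀ b, IsLocalFaceAt κ b) (h' : ∀ b, IsLocalFaceAt κ' b)
    (b : sumMfd B B') : IsLocalFaceAt (B := sumMfd B B') (Sum.elim κ κ') b := by
  rcases b with b | b
  · exact @IsLocalFaceAt.of_comp n _ (sumMfd B B') P b Sum.inl (Sum.elim κ κ')
      (isLocalDiffeomorphAt_inl b) (h b)
  · exact @IsLocalFaceAt.of_comp n _ (sumMfd B B') P b Sum.inr (Sum.elim κ κ')
      (isLocalDiffeomorphAt_inr b) (h' b)

theorem isBoundaryOrientation_sumElim (h : ∀ b, IsLocalFaceAt κ b) (h' : ∀ b, IsLocalFaceAt κ' b)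
    {o : OrientationField P} {o₁ : OrientationField B} {o₁' : OrientationField B'}
    (ho : IsBoundaryOrientation κ o o₁) (ho' : IsBoundaryOrientation κ' o o₁') :
    IsBoundaryOrientation (B := sumMfd B B') (Sum.elim κ κ') o (sumOrientation o₁ o₁') := by
  rintro (b | b)
  · exact (isBoundaryOrientationAt_comp_iff (B' := sumMfd B B') (P := P) (κ := Sum.elim κ κ')
      (isLocalDiffeomorphAt_inl b) (h b) (carries_inl b (o₁ b))).1 (ho b)
  · exact (isBoundaryOrientationAt_comp_iff (B' := sumMfd B B') (P := P) (κ := Sum.elim κ κ')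
      (isLocalDiffeomorphAt_inr b) (h' b) (carries_inr b (o₁' b))).1 (ho' b)

theorem liesOnFace_inl {e : OpenPartialHomeomorph P (EuclideanQuadrant (n + 1))} {i : Fin (n + 1)}
    {b : B} : LiesOnFace (B := sumMfd B B') (Sum.elim κ κ') (Sum.inl b) e i ↔ LiesOnFace κ b e i :=
  (liesOnFace_comp_iff (B' := sumMfd B B') (κ := Sum.elim κ κ') (isLocalDiffeomorphAt_inl b)).symm

theorem liesOnFace_inr {e : OpenPartialHomeomorph P (EuclideanQuadrant (n + 1))} {i : Fin (n + 1)}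
    {b : B'} : LiesOnFace (B := sumMfd B B') (Sum.elim κ κ') (Sum.inr b) e i ↔ LiesOnFace κ' b e i :=
  (liesOnFace_comp_iff (B' := sumMfd B B') (κ := Sum.elim κ κ') (isLocalDiffeomorphAt_inr b)).symm

end SumElim

section CylinderBoundary

open Module

variable {n : ℕ} {P : CornerMfd n}

/-- The inclusion of `P` in `P × [0,1]` at the parameter `t`. -/
def cylinderEnd (t : Icc (0 : ℝ) 1) (p : P) : cylinderMfd P := (cylinderDiffeo P).symm (p, t)

/-- The map `ι × id : B × [0,1] → P × [0,1]`. -/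
def cylinderSide {m : ℕ} {B : CornerMfd m} (ι : B → P) (y : cylinderMfd B) : cylinderMfd P :=
  (cylinderDiffeo P).symm (ι (cylinderFst y), (cylinderDiffeo B y).2)

theorem cylinder_ext {x y : cylinderMfd P} (h1 : cylinderFst x = cylinderFst y)
    (h2 : (cylinderDiffeo P x).2 = (cylinderDiffeo P y).2) : x = y :=
  (cylinderDiffeo P).injective (Prod.ext h1 h2)

theorem contMDiff_cylinderEnd (t : Icc (0 : ℝ) 1) :
    ContMDiff (Q n) (Q (n + 1)) ∞ (cylinderEnd (P := P) t) :=
  (cylinderDiffeo P).symm.contMDiff.comp (contMDiff_id.prodMk contMDiff_const)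

theorem contMDiffAt_cylinderSide {m : ℕ} {B : CornerMfd m} {ι : B → P} {y : cylinderMfd B}
    (h : ContMDiffAt (Q m) (Q n) ∞ ι (cylinderFst y)) :
    ContMDiffAt (Q (m + 1)) (Q (n + 1)) ∞ (cylinderSide ι) y :=
  (cylinderDiffeo P).symm.contMDiff.contMDiffAt.comp y
    ((h.comp y contMDiff_cylinderFst.contMDiffAt).prodMk
      (contMDiff_snd.comp (cylinderDiffeo B).contMDiff).contMDiffAt)

theorem map_cylinderFst_nhds (x : cylinderMfd P) : map cylinderFst (𝓝 x) = 𝓝 (cylinderFst x) :=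
  map_fst_nhds (X := P) (Y := Icc (0 : ℝ) 1) x

theorem isLocalFaceAt_cylinderEnd {t : Icc (0 : ℝ) 1} (ht : t = 0 ∨ t = 1) (p : P) :
    IsLocalFaceAt (cylinderEnd t) p := by
  obtain ⟨E, hE, h1, h2, h3, a, s, has, h4⟩ := exists_product_chart (chart_mem_maxAtlas p) t
  refine ⟨_, chart_mem_maxAtlas p, E, hE, Fin.last n, mem_chart_source _ p, fun x hx =>
    ⟨h2 x hx, ?_, fun j => ?_⟩⟩
  · rw [h4]
    change a + s * (t : ℝ) = 0
    rcases has with ⟨rfl, rfl, h⟩ | ⟨rfl, rfl, rfl⟩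
    · rcases ht with rfl | rfl
      · simp
      · exact absurd h (lt_irrefl _)
    · simp
  · rw [Fin.succAbove_last, h3]
    rfl

theorem tangentFst_mfderiv_cylinderEnd (t : Icc (0 : ℝ) 1) (p : P) (v : TangentSpace (Q n) p) :
    tangentFst (cylinderEnd t p) (mfderiv (Q n) (Q (n + 1)) (cylinderEnd t) p v) = v := by
  have h := mfderiv_comp (I'' := Q n) p (contMDiff_cylinderFst.mdifferentiable (by simp) _)
    ((contMDiff_cylinderEnd t).mdifferentiable (by simp) p)
  have h2 : cylinderFst ∘ cylinderEnd t = (id : P → P) := rfl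
  rw [h2, mfderiv_id] at h
  exact (congrArg (fun L : Vec n →L[ℝ] Vec n => L v) h).symm

theorem tangentSnd_mfderiv_cylinderEnd (t : Icc (0 : ℝ) 1) (p : P) (v : TangentSpace (Q n) p) :
    tangentSnd (cylinderEnd t p) (mfderiv (Q n) (Q (n + 1)) (cylinderEnd t) p v) = 0 := by
  have h := mfderiv_comp (I'' := 𝓘(ℝ)) p (contMDiff_cylinderSnd.mdifferentiable (by simp) _)
    ((contMDiff_cylinderEnd t).mdifferentiable (by simp) p)
  have h2 : cylinderSnd ∘ cylinderEnd t = fun _ : P => (t : ℝ) := rfl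
  rw [h2, mfderiv_const] at h
  exact (congrArg (fun L : Vec n →L[ℝ] ℝ => L v) h).symm

theorem neg_orientation_eq_iff {V : Type*} [AddCommGroup V] [Module ℝ V] (v : Basis (Fin n) ℝ V)
    (o : Orientation ℝ V (Fin n)) : -v.orientation = o ↔ ¬ v.orientation = o := by
  rw [← orientation_eq_neg_iff]
  constructor
  · intro h
    rw [← h, orientation_neg_neg]
  · intro h
    rw [h, orientation_neg_neg]

theorem iff_iff_swap {a b c : Prop} (h : (a ↔ b) ↔ c) : b ↔ (a ↔ c) := by
  tauto

/-- The orientation of the ends of `P × [0,1]`: the sign `(-1)ⁿ` at `t = 1` comes from moving the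
outward normal `∂ₜ` past a basis of the tangent space of `P`; at `t = 0` the outward normal is
`-∂ₜ`. -/
theorem isBoundaryOrientation_cylinderEnd {o : OrientationField P}
    {O : OrientationField (cylinderMfd P)}
    (hO : ∀ x, IsProductOrientation (tangentFst x) (tangentSnd x) (o (cylinderFst x)) (O x))
    {t : Icc (0 : ℝ) 1} (ht : t = 0 ∨ t = 1) {o₁ : OrientationField P}
    (ho₁ : ∀ p (v : Basis (Fin n) ℝ (TangentSpace (Q n) p)), v.orientation = o₁ p ↔
      ((v.orientation = o p ↔ Even n) ↔ t = 1)) :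
    IsBoundaryOrientation (cylinderEnd t) O o₁ := by
  intro p
  have hl := isLocalFaceAt_cylinderEnd ht p
  obtain ⟨E, hE, h1, h2, h3, a, s, has, h4⟩ := exists_product_chart (chart_mem_maxAtlas p) t
  have hpE := h2 p (mem_chart_source _ p)
  have hlies : LiesOnFace (cylinderEnd t) p E (Fin.last n) := by
    refine Eventually.of_forall fun x => ?_
    rw [h4]
    change a + s * (t : ℝ) = 0
    rcases has with ⟨rfl, rfl, h⟩ | ⟨rfl, rfl, rfl⟩
    · rcases ht with rfl | rfl
      · simp
      · exact absurd h (lt_irrefl _)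
    · simp
  let v : Basis (Fin n) ℝ (TangentSpace (Q n) p) :=
    frame (chart_mem_maxAtlas p) (mem_chart_source _ p)
  obtain ⟨w, hw, hwo⟩ := hO (cylinderEnd t p) v
  obtain ⟨w₁, rfl⟩ : ∃ w₁, rotateBasis w₁ = w := ⟨w.reindex (finRotate (n + 1)),
    Basis.eq_of_apply_eq fun i => by simp [rotateBasis]⟩
  have hrot := rotateBasis_orientation w₁
  rw [orientation_eq_iff_iff _ _ (O (cylinderEnd t p)), hwo] at hrot
  have hd : ∀ j : Fin n, w₁ j.succ = mfderiv (Q n) (Q (n + 1)) (cylinderEnd t) p (v j) := by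
    intro j
    rw [← rotateBasis_castSucc]
    refine hw.ext ?_ ?_
    · exact (hw.1 j).1.trans (tangentFst_mfderiv_cylinderEnd t p (v j)).symm
    · exact (hw.1 j).2.trans (tangentSnd_mfderiv_cylinderEnd t p (v j)).symm
  have hτ : tangentSnd (cylinderEnd t p) (w₁ 0) = 1 := by
    rw [← rotateBasis_last]; exact hw.2.2
  have ho := ho₁ p v
  rcases ht with rfl | rfl
  · have hs : s = 1 := by
      rcases has with h | h
      · exact h.2.1
      · exact absurd h.2.2 (by simp)
    refine isBoundaryOrientationAt_of_basis hl v (w₁.unitsSMul (Function.update 1 0 (-1)))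
      ⟨E, hE, hpE, Fin.last n, hlies, ?_⟩ (fun j => ?_) ?_
    · rw [chartComponent_last h4, hs, Basis.unitsSMul_apply, Function.update_self, Units.smul_def,
        map_smul, hτ]
      norm_num
    · rw [Basis.unitsSMul_apply, Function.update_of_ne (Fin.succ_ne_zero j), Pi.one_apply, one_smul,
        hd]
    · rw [Basis.orientation_neg_single, neg_orientation_eq_iff, ho]
      simp only [zero_ne_one, iff_false]
      exact not_congr (iff_iff_swap hrot)
  · have hs : s = -1 := by
      rcases has with h | h
      · exact absurd h.2.2 (lt_irrefl _)
      · exact h.2.1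
    refine isBoundaryOrientationAt_of_basis hl v w₁ ⟨E, hE, hpE, Fin.last n, hlies, ?_⟩ hd ?_
    · rw [chartComponent_last h4, hs, hτ]
      norm_num
    · rw [ho]
      simp only [iff_true]
      exact iff_iff_swap hrot

section Side

variable {B : CornerMfd n} {P : CornerMfd (n + 1)} {ι : B → P}
  {e : OpenPartialHomeomorph P (EuclideanQuadrant (n + 1))}
  {E : OpenPartialHomeomorph (cylinderMfd P) (EuclideanQuadrant (n + 1 + 1))}

theorem liesOnFace_cylinderSide {y : cylinderMfd B} {i : Fin (n + 1)}
    (hEe : ∀ (x : cylinderMfd P) j, (E x).1 j.castSucc = (e (cylinderFst x)).1 j) :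
    LiesOnFace (cylinderSide ι) y E i.castSucc ↔ LiesOnFace ι (cylinderFst y) e i := by
  have h0 : ∀ x : cylinderMfd B,
      (E (cylinderSide ι x)).1 i.castSucc = (e (ι (cylinderFst x))).1 i := fun x => hEe _ _
  have h2 := eventually_map (f := 𝓝 y) (m := cylinderFst (P := B)) (P := fun b => (e (ι b)).1 i = 0)
  rw [map_cylinderFst_nhds] at h2
  constructor
  · intro h
    exact h2.2 (h.mono fun x hx => (h0 x).symm.trans hx)
  · intro h
    exact (h2.1 h).mono fun x hx => (h0 x).trans hx

theorem eq_of_interval_chart {t : Icc (0 : ℝ) 1} {a s a' s' : ℝ}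
    (h : a = 0 ∧ s = 1 ∧ t < 1 ∨ a = 1 ∧ s = -1 ∧ t = 1)
    (h' : a' = 0 ∧ s' = 1 ∧ t < 1 ∨ a' = 1 ∧ s' = -1 ∧ t = 1) : a = a' ∧ s = s' := by
  rcases h with ⟨rfl, rfl, h⟩ | ⟨rfl, rfl, h⟩ <;> rcases h' with ⟨rfl, rfl, h'⟩ | ⟨rfl, rfl, h'⟩
  · exact ⟨rfl, rfl⟩
  · exact absurd h' h.ne
  · exact absurd h h'.ne
  · exact ⟨rfl, rfl⟩

theorem not_liesOnFace_cylinderSide_last {y : cylinderMfd B} {a s : ℝ}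
    (has : a = 0 ∧ s = 1 ∧ (cylinderDiffeo B y).2 < 1 ∨
      a = 1 ∧ s = -1 ∧ (cylinderDiffeo B y).2 = 1)
    (hEs : ∀ x : cylinderMfd P, (E x).1 (Fin.last (n + 1)) = a + s * cylinderSnd x) :
    ¬ LiesOnFace (cylinderSide ι) y E (Fin.last (n + 1)) := by
  intro h
  obtain ⟨E', hE', h1, h2, h3, a', s', has', h4⟩ :=
    exists_product_chart (chart_mem_maxAtlas (cylinderFst y)) (cylinderDiffeo B y).2
  obtain ⟨rfl, rfl⟩ := eq_of_interval_chart has has'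
  refine frequently_interior_face (P := cylinderMfd B) (e := E') (p := y)
    (h2 _ (mem_chart_source _ (cylinderFst y))) (Fin.last n) ?_
  filter_upwards [h] with x hx
  rw [hEs] at hx
  rw [h4]
  exact hx

theorem isLocalFaceAt_cylinderSide {y : cylinderMfd B} (h : IsLocalFaceAt ι (cylinderFst y)) :
    IsLocalFaceAt (cylinderSide ι) y := by
  have hc := (contMDiffAt_cylinderSide h.contMDiffAt).continuousAt
  obtain ⟨ψ, hψ, e, he, i, hb, h⟩ := h
  obtain ⟨E', hE', h1', h2', h3', a', s', has', h4'⟩ :=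
    exists_product_chart hψ (cylinderDiffeo B y).2
  obtain ⟨E, hE, h1, h2, h3, a, s, has, h4⟩ := exists_product_chart he (cylinderDiffeo B y).2
  obtain ⟨rfl, rfl⟩ := eq_of_interval_chart has has'
  have hy : y ∈ E'.source := h2' _ hb
  refine .of_eventually ⟨E', hE', E, hE, i.castSucc, hy, ?_⟩
  filter_upwards [E'.open_source.mem_nhds hy,
    hc.eventually (E.open_source.mem_nhds (h2 _ (h _ hb).1))] with x hx hxE
  obtain ⟨-, hx1, hx2⟩ := h _ (h1' _ hx)
  refine ⟨hxE, ?_, fun j => ?_⟩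
  · rw [h3]; exact hx1
  · refine Fin.lastCases ?_ (fun j => ?_) j
    · rw [Fin.succAbove_castSucc_of_le _ _ (Fin.le_last i), Fin.succ_last, h4, h4']
      rfl
    · rw [Fin.castSucc_succAbove_castSucc, h3, h3']
      exact hx2 j

theorem tangentFst_mfderiv_cylinderSide {y : cylinderMfd B} (h : IsLocalFaceAt ι (cylinderFst y))
    (v : TangentSpace (Q (n + 1)) y) :
    tangentFst (cylinderSide ι y)
      (mfderiv (Q (n + 1)) (Q (n + 1 + 1)) (cylinderSide ι) y v) =
      mfderiv (Q n) (Q (n + 1)) ι (cylinderFst y) (tangentFst y v) := by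
  have h1 := mfderiv_comp (I'' := Q (n + 1)) y
    (contMDiff_cylinderFst.mdifferentiable (by simp) (cylinderSide ι y))
    ((contMDiffAt_cylinderSide h.contMDiffAt).mdifferentiableAt (by simp))
  have h2 := mfderiv_comp (I'' := Q (n + 1)) y h.mdifferentiableAt
    (contMDiff_cylinderFst.mdifferentiable (by simp) y)
  have h3 : cylinderFst ∘ cylinderSide ι = ι ∘ cylinderFst := rfl
  rw [h3] at h1
  exact congrArg (fun L : Vec (n + 1) →L[ℝ] Vec (n + 1) => L v) (h1.symm.trans h2)

theorem tangentSnd_mfderiv_cylinderSide {y : cylinderMfd B} (h : IsLocalFaceAt ι (cylinderFst y))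
    (v : TangentSpace (Q (n + 1)) y) :
    tangentSnd (cylinderSide ι y)
      (mfderiv (Q (n + 1)) (Q (n + 1 + 1)) (cylinderSide ι) y v) = tangentSnd y v := by
  have h1 := mfderiv_comp (I'' := 𝓘(ℝ)) y
    (contMDiff_cylinderSnd.mdifferentiable (by simp) (cylinderSide ι y))
    ((contMDiffAt_cylinderSide h.contMDiffAt).mdifferentiableAt (by simp))
  exact (congrArg (fun L : Vec (n + 1) →L[ℝ] ℝ => L v) h1).symm

/-- The sides of `P × [0,1]` have the product orientation: in `(ν, v, ∂ₜ)` the outward normal `ν`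
already stands in the first place. -/
theorem isBoundaryOrientation_cylinderSide (hι : ∀ b, IsLocalFaceAt ι b) {oP : OrientationField P}
    {oB : OrientationField B} (ho : IsBoundaryOrientation ι oP oB)
    {OP : OrientationField (cylinderMfd P)}
    (hOP : ∀ x, IsProductOrientation (tangentFst x) (tangentSnd x) (oP (cylinderFst x)) (OP x))
    {OB : OrientationField (cylinderMfd B)}
    (hOB : ∀ x, IsProductOrientation (tangentFst x) (tangentSnd x) (oB (cylinderFst x)) (OB x)) :
    IsBoundaryOrientation (cylinderSide ι) OP OB := by
  intro y
  have hl := hι (cylinderFst y)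
  obtain ⟨ν, hν⟩ := hl.exists_isOutward
  let v : Basis (Fin n) ℝ (TangentSpace (Q n) (cylinderFst y)) :=
    frame (chart_mem_maxAtlas _) (mem_chart_source _ (cylinderFst y))
  obtain ⟨w, hw0, hws, hwo⟩ := ho _ ν hν v
  obtain ⟨v', hv', hvo'⟩ := hOB y v
  obtain ⟨w', hw', hwo'⟩ := hOP (cylinderSide ι y) w
  obtain ⟨e, he, hp, i, hi, hneg⟩ := hν
  obtain ⟨E, hE, h1, h2, h3, a, s, has, h4⟩ := exists_product_chart he (cylinderDiffeo B y).2
  refine isBoundaryOrientationAt_of_basis (isLocalFaceAt_cylinderSide hl) v' w'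
    ⟨E, hE, h2 _ hp, i.castSucc, (liesOnFace_cylinderSide h3).2 hi, ?_⟩ (fun j => ?_)
    (hwo'.trans (hwo.trans hvo'.symm))
  · have h0 : tangentFst (cylinderSide ι y) (w' 0) = ν := ((hw'.1 0).1).trans hw0
    have h5 := chartComponent_castSucc he (x := cylinderSide ι y) hp h3 i (w' 0)
    exact (h5.trans (congrArg (chartComponent e i (ι (cylinderFst y))) h0)).trans_lt hneg
  · refine hw'.ext ?_ ?_
    · refine Eq.trans ?_ (tangentFst_mfderiv_cylinderSide hl (v' j)).symm
      refine Fin.lastCases ?_ (fun j => ?_) j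
      · rw [Fin.succ_last]
        exact hw'.2.1.trans ((congrArg _ hv'.2.1).trans (map_zero _)).symm
      · rw [Fin.succ_castSucc]
        exact ((hw'.1 j.succ).1.trans (hws j)).trans (congrArg _ (hv'.1 j).1.symm)
    · refine Eq.trans ?_ (tangentSnd_mfderiv_cylinderSide hl (v' j)).symm
      refine Fin.lastCases ?_ (fun j => ?_) j
      · rw [Fin.succ_last, hw'.2.2, hv'.2.2]
      · rw [Fin.succ_castSucc, (hw'.1 _).2, (hv'.1 _).2]

end Side

end CylinderBoundary

section CylinderFaces

variable {n : ℕ} {P : CornerMfd n}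

/-- The two ends of the cylinder. -/
def cylinderEnds (P : CornerMfd n) : sumMfd P P → cylinderMfd P :=
  Sum.elim (cylinderEnd 1) (cylinderEnd 0)

theorem isLocalFaceAt_cylinderEnds (b : sumMfd P P) : IsLocalFaceAt (cylinderEnds P) b :=
  isLocalFaceAt_sumElim (isLocalFaceAt_cylinderEnd (Or.inr rfl))
    (isLocalFaceAt_cylinderEnd (Or.inl rfl)) b

theorem cylinderEnds_fst (b : sumMfd P P) :
    ∃ t : Icc (0 : ℝ) 1, ∃ p, cylinderEnds P b = cylinderEnd t p ∧
      ∀ {E : OpenPartialHomeomorph (cylinderMfd P) (EuclideanQuadrant (n + 1))} {i : Fin (n + 1)},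
        LiesOnFace (cylinderEnds P) b E i ↔ LiesOnFace (cylinderEnd t) p E i := by
  rcases b with p | p
  · exact ⟨1, p, rfl, liesOnFace_inl⟩
  · exact ⟨0, p, rfl, liesOnFace_inr⟩

variable {e : OpenPartialHomeomorph P (EuclideanQuadrant n)}
  {E : OpenPartialHomeomorph (cylinderMfd P) (EuclideanQuadrant (n + 1))} {x : cylinderMfd P}

theorem existsUnique_cylinderEnds {a s : ℝ}
    (has : a = 0 ∧ s = 1 ∧ (cylinderDiffeo P x).2 < 1 ∨
      a = 1 ∧ s = -1 ∧ (cylinderDiffeo P x).2 = 1)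
    (hEs : ∀ x : cylinderMfd P, (E x).1 (Fin.last n) = a + s * cylinderSnd x)
    (h : (E x).1 (Fin.last n) = 0) :
    ∃! b : sumMfd P P, cylinderEnds P b = x ∧ LiesOnFace (cylinderEnds P) b E (Fin.last n) := by
  have hx := (hEs x).symm.trans h
  rcases has with ⟨rfl, rfl, -⟩ | ⟨rfl, rfl, h1⟩
  · have h0 : (cylinderDiffeo P x).2 = 0 := by
      refine Subtype.ext ?_
      rw [zero_add, one_mul] at hx
      exact hx
    refine ⟨Sum.inr (cylinderFst x), ⟨cylinder_ext rfl h0.symm, liesOnFace_inr.2 ?_⟩, ?_⟩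
    · refine Eventually.of_forall fun y => (hEs _).trans ?_
      change 0 + 1 * ((0 : ℝ)) = 0
      norm_num
    · rintro (p | p) ⟨hp, -⟩
      · have : (1 : Icc (0 : ℝ) 1) = (cylinderDiffeo P x).2 :=
          congrArg (fun y => (cylinderDiffeo P y).2) hp
        rw [h0] at this
        exact absurd this one_ne_zero
      · exact congrArg Sum.inr (congrArg cylinderFst hp)
  · refine ⟨Sum.inl (cylinderFst x), ⟨cylinder_ext rfl h1.symm, liesOnFace_inl.2 ?_⟩, ?_⟩
    · refine Eventually.of_forall fun y => (hEs _).trans ?_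
      change 1 + -1 * ((1 : ℝ)) = 0
      norm_num
    · rintro (p | p) ⟨hp, -⟩
      · exact congrArg Sum.inl (congrArg cylinderFst hp)
      · have : (0 : Icc (0 : ℝ) 1) = (cylinderDiffeo P x).2 :=
          congrArg (fun y => (cylinderDiffeo P y).2) hp
        rw [h1] at this
        exact absurd this zero_ne_one

theorem not_liesOnFace_cylinderEnd {t : Icc (0 : ℝ) 1} {p : P} (hp : p ∈ e.source)
    (hEe : ∀ (x : cylinderMfd P) j, (E x).1 j.castSucc = (e (cylinderFst x)).1 j) (j : Fin n) :
    ¬ LiesOnFace (cylinderEnd t) p E j.castSucc := fun h =>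
  frequently_interior_face hp j (h.mono fun y hy => (hEe (cylinderEnd t y) j).symm.trans hy)

theorem isGeometricBoundary_cylinder_zero (P : CornerMfd 0) :
    IsGeometricBoundary (cylinderEnds P) := by
  refine .of_exists_chart isLocalFaceAt_cylinderEnds fun x => ?_
  obtain ⟨E, hE, h1, h2, h3, a, s, has, h4⟩ :=
    exists_product_chart (chart_mem_maxAtlas (cylinderFst x)) (cylinderDiffeo P x).2
  refine ⟨E, hE, h2 _ (mem_chart_source _ _), fun i hi => ?_⟩
  obtain rfl : i = Fin.last 0 := Fin.eq_of_val_eq (by omega)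
  exact existsUnique_cylinderEnds has h4 hi

end CylinderFaces

section

variable {n : ℕ} {B : CornerMfd n} {P : CornerMfd (n + 1)} {ι : B → P}

/-- The faces of `P × [0,1]`: two copies of `P` and `∂P × [0,1]`. -/
def cylinderFaces (ι : B → P) : sumMfd (sumMfd P P) (cylinderMfd B) → cylinderMfd P :=
  Sum.elim (cylinderEnds P) (cylinderSide ι)

/-- In the product charts the last coordinate is that of `[0,1]`: its face gives the ends, and the
other faces give the sides. -/
theorem isGeometricBoundary_cylinder (hι : IsGeometricBoundary ι) :
    IsGeometricBoundary (cylinderFaces ι) := by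
  refine .of_exists_chart (isLocalFaceAt_sumElim isLocalFaceAt_cylinderEnds fun y =>
    isLocalFaceAt_cylinderSide (hι.isLocalFaceAt _)) fun x => ?_
  have he := chart_mem_maxAtlas (cylinderFst x)
  have hx := mem_chart_source (EuclideanQuadrant (n + 1)) (cylinderFst x)
  obtain ⟨E, hE, h1, h2, h3, a, s, has, h4⟩ := exists_product_chart he (cylinderDiffeo P x).2
  refine ⟨E, hE, h2 _ hx, fun i => ?_⟩
  refine Fin.lastCases (fun hi => ?_) (fun j hj => ?_) i
  · obtain ⟨b, ⟨hb, hbl⟩, hu⟩ := existsUnique_cylinderEnds has h4 hi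
    refine ⟨Sum.inl b, ⟨hb, liesOnFace_inl.2 hbl⟩, ?_⟩
    rintro (b' | y) ⟨h, hl⟩
    · exact congrArg Sum.inl (hu b' ⟨h, liesOnFace_inl.1 hl⟩)
    · have hy : (cylinderDiffeo B y).2 = (cylinderDiffeo P x).2 :=
        congrArg (fun y => (cylinderDiffeo P y).2) h
      rw [← hy] at has
      exact absurd (liesOnFace_inr.1 hl) (not_liesOnFace_cylinderSide_last has h4)
  · rw [h3] at hj
    obtain ⟨b, ⟨hb, hbl⟩, hu⟩ := hι.existsUnique_face _ he _ hx j hj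
    refine ⟨Sum.inr ((cylinderDiffeo B).symm (b, (cylinderDiffeo P x).2)),
      ⟨cylinder_ext hb rfl, liesOnFace_inr.2 ((liesOnFace_cylinderSide h3).2 hbl)⟩, ?_⟩
    rintro (b' | y) ⟨h, hl⟩
    · obtain ⟨t, p, hp, hlp⟩ := cylinderEnds_fst b'
      have hpx : p = cylinderFst x := congrArg cylinderFst (hp.symm.trans h)
      exact absurd (hlp.1 (liesOnFace_inl.1 hl))
        (not_liesOnFace_cylinderEnd (hpx ▸ hx) h3 j)
    · refine congrArg Sum.inr (cylinder_ext ?_ (congrArg (fun y => (cylinderDiffeo P y).2) h))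
      exact hu _ ⟨congrArg cylinderFst h, (liesOnFace_cylinderSide h3).1 (liesOnFace_inr.1 hl)⟩

end

/-! ### Cylinders over chains -/

namespace GeomChain

variable {n : ℕ} {M N : SmoothMfd.{u}} {F : SmoothHomotopy M N}

theorem exists_cylinder_orientation (σ : GeomChain n M) :
    ∃ O : OrientationField (cylinderMfd σ.dom), ∀ x, IsProductOrientation (tangentFst x)
      (tangentSnd x) (σ.orient (cylinderFst x)) (O x) := by
  have h : ∀ x : cylinderMfd σ.dom, ∃ O, IsProductOrientation (tangentFst x) (tangentSnd x)
      (σ.orient (cylinderFst x)) O := fun x => by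
    obtain ⟨v₀, w₀, h⟩ := exists_product_frame x
    exact exists_isProductOrientation h (σ.orient (cylinderFst x))
  choose O hO using h
  exact ⟨O, hO⟩

/-- The chain `H(σ)` with domain `cylinderMfd σ.dom`. -/
def cylinder (F : SmoothHomotopy M N) (σ : GeomChain n M) : GeomChain (n + 1) N where
  dom := cylinderMfd σ.dom
  compact := inferInstanceAs (CompactSpace (σ.dom × Icc (0 : ℝ) 1))
  orient := (exists_cylinder_orientation σ).choose
  isOrientation :=
    isOrientationField_of_product σ.isOrientation (exists_cylinder_orientation σ).choose_spec
  map x := F (σ.map (cylinderFst x), (cylinderDiffeo σ.dom x).2)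
  smooth := F.contMDiff.comp ((σ.smooth.comp contMDiff_cylinderFst).prodMk
    (contMDiff_snd.comp (cylinderDiffeo σ.dom).contMDiff))

theorem isCylinder_cylinder (F : SmoothHomotopy M N) (σ : GeomChain n M) :
    IsCylinder F σ (cylinder F σ) := by
  refine ⟨cylinderDiffeo σ.dom, fun _ => rfl, fun x v => ?_⟩
  obtain ⟨w, ⟨h1, h2, h3⟩, h4⟩ := (exists_cylinder_orientation σ).choose_spec x v
  exact ⟨w, h1, h2, h3, h4⟩

theorem Isomorphic.of_isEtale {σ τ : GeomChain n M} {f : σ.dom → τ.dom} (hf : IsEtale σ τ f)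
    {g : τ.dom → σ.dom} (hg : ContMDiff (Q n) (Q n) ∞ g) (hgf : ∀ x, g (f x) = x)
    (hfg : ∀ y, f (g y) = y) : σ.Isomorphic τ :=
  isomorphic_iff.2 ⟨⟨⟨f, g, hgf, hfg⟩, hf.contMDiff, hg⟩, hf.carries, hf.map⟩

/-- The map `j × id` of cylinders induced by a map `j` of chains. -/
theorem IsEtale.cylinder {σ σ' : GeomChain n M} {j : σ.dom → σ'.dom} (hj : IsEtale σ σ' j)
    {ρ ρ' : GeomChain (n + 1) N}
    {Φ : ρ.dom ≃ₘ⟮Q (n + 1), (Q n).prod (𝓡∂ 1)⟯ (σ.dom × Icc (0 : ℝ) 1)}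
    {Φ' : ρ'.dom ≃ₘ⟮Q (n + 1), (Q n).prod (𝓡∂ 1)⟯ (σ'.dom × Icc (0 : ℝ) 1)}
    (hm : ∀ r, ρ.map r = F (σ.map (Φ r).1, (Φ r).2))
    (hm' : ∀ r, ρ'.map r = F (σ'.map (Φ' r).1, (Φ' r).2))
    (ho : ∀ r, IsProductOrientation (mfderiv (Q (n + 1)) (Q n) (fun s => (Φ s).1) r)
      (mfderiv (Q (n + 1)) 𝓘(ℝ) (fun s => ((Φ s).2 : ℝ)) r) (σ.orient (Φ r).1) (ρ.orient r))
    (ho' : ∀ r, IsProductOrientation (mfderiv (Q (n + 1)) (Q n) (fun s => (Φ' s).1) r)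
      (mfderiv (Q (n + 1)) 𝓘(ℝ) (fun s => ((Φ' s).2 : ℝ)) r) (σ'.orient (Φ' r).1) (ρ'.orient r)) :
    IsEtale ρ ρ' fun r => Φ'.symm (j (Φ r).1, (Φ r).2) := by
  set J : ρ.dom → ρ'.dom := fun r => Φ'.symm (j (Φ r).1, (Φ r).2) with hJ
  have h1 : ContMDiff (Q (n + 1)) (Q n) ∞ fun s => (Φ s).1 := contMDiff_fst.comp Φ.contMDiff
  have h1' : ContMDiff (Q (n + 1)) (Q n) ∞ fun s => (Φ' s).1 := contMDiff_fst.comp Φ'.contMDiff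
  have h2' : ContMDiff (Q (n + 1)) 𝓘(ℝ) ∞ fun s => ((Φ' s).2 : ℝ) :=
    contMDiff_subtypeVal_Icc.comp (contMDiff_snd.comp Φ'.contMDiff)
  have hJc : ContMDiff (Q (n + 1)) (Q (n + 1)) ∞ J := Φ'.symm.contMDiff.comp
    ((hj.contMDiff.comp h1).prodMk (contMDiff_snd.comp Φ.contMDiff))
  have hΦJ : ∀ r, Φ' (J r) = (j (Φ r).1, (Φ r).2) := fun r => Φ'.apply_symm_apply _
  refine ⟨hJc, fun r => ?_, fun r => ?_⟩
  · have e1 := mfderiv_comp (I'' := Q n) r (h1'.mdifferentiable (by simp) (J r))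
      (hJc.mdifferentiable (by simp) r)
    have e2 := mfderiv_comp (I'' := Q n) r (hj.contMDiff.mdifferentiable (by simp) (Φ r).1)
      (h1.mdifferentiable (by simp) r)
    have e3 : (fun s => (Φ' s).1) ∘ J = j ∘ fun s => (Φ s).1 :=
      funext fun r => congrArg Prod.fst (hΦJ r)
    have e4 := mfderiv_comp (I'' := 𝓘(ℝ)) r (h2'.mdifferentiable (by simp) (J r))
      (hJc.mdifferentiable (by simp) r)
    have e5 : (fun s => ((Φ' s).2 : ℝ)) ∘ J = fun s => ((Φ s).2 : ℝ) :=
      funext fun r => congrArg (fun z => (z.2 : ℝ)) (hΦJ r)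
    rw [e5] at e4
    have hc : ∀ q, q = j (Φ r).1 → Carries (V := Vec n) (W := Vec n)
        (show Vec n →L[ℝ] Vec n from mfderiv (Q n) (Q n) j (Φ r).1)
        (σ.orient (Φ r).1) (σ'.orient q) := by
      rintro _ rfl
      exact hj.carries _
    refine IsProductOrientation.carries (n := n) (V := Vec (n + 1)) (W := Vec n)
      (V' := Vec (n + 1)) (W' := Vec n)
      (A := (show Vec (n + 1) →L[ℝ] Vec n from
        mfderiv (Q (n + 1)) (Q n) (fun s => (Φ s).1) r).toLinearMap)
      (τ := (show Vec (n + 1) →L[ℝ] ℝ from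
        mfderiv (Q (n + 1)) 𝓘(ℝ) (fun s => ((Φ s).2 : ℝ)) r).toLinearMap)
      (A' := (show Vec (n + 1) →L[ℝ] Vec n from
        mfderiv (Q (n + 1)) (Q n) (fun s => (Φ' s).1) (J r)).toLinearMap)
      (τ' := (show Vec (n + 1) →L[ℝ] ℝ from
        mfderiv (Q (n + 1)) 𝓘(ℝ) (fun s => ((Φ' s).2 : ℝ)) (J r)).toLinearMap)
      (L := (show Vec (n + 1) →L[ℝ] Vec (n + 1) from
        mfderiv (Q (n + 1)) (Q (n + 1)) J r).toLinearMap)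
      (f := (show Vec n →L[ℝ] Vec n from mfderiv (Q n) (Q n) j (Φ r).1).toLinearMap)
      (ho r) (ho' (J r)) (hc _ (congrArg Prod.fst (hΦJ r))) (fun x => ?_) (fun x => ?_)
      (EuclideanSpace.basisFun (Fin n) ℝ).toBasis
    · have e6 := e1.symm.trans ((congrArg (fun f => (show Vec (n + 1) →L[ℝ] Vec n from
        mfderiv (Q (n + 1)) (Q n) f r)) e3).trans e2)
      exact congrArg (fun L : Vec (n + 1) →L[ℝ] Vec n => L x) e6
    · exact (congrArg (fun L : Vec (n + 1) →L[ℝ] ℝ => L x) e4).symm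
  · rw [hm, hm', hΦJ]
    exact congrArg (fun m => F (m, (Φ r).2)) (hj.map _)

theorem isCylinder_iff {σ : GeomChain n M} {ρ : GeomChain (n + 1) N} : IsCylinder F σ ρ ↔
    ∃ Φ : ρ.dom ≃ₘ⟮Q (n + 1), (Q n).prod (𝓡∂ 1)⟯ (σ.dom × Icc (0 : ℝ) 1),
    (∀ r, ρ.map r = F (σ.map (Φ r).1, (Φ r).2)) ∧
    ∀ r, IsProductOrientation (mfderiv (Q (n + 1)) (Q n) (fun s => (Φ s).1) r)
      (mfderiv (Q (n + 1)) 𝓘(ℝ) (fun s => ((Φ s).2 : ℝ)) r) (σ.orient (Φ r).1) (ρ.orient r) := by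
  refine exists_congr fun Φ => and_congr_right fun _ => forall_congr' fun r =>
    forall_congr' fun v => exists_congr fun w => ?_
  exact ⟨fun ⟨a, b, c, d⟩ => ⟨⟨a, b, c⟩, d⟩, fun ⟨⟨a, b, c⟩, d⟩ => ⟨a, b, c, d⟩⟩

theorem IsCylinder.isomorphic {σ σ' : GeomChain n M} {ρ ρ' : GeomChain (n + 1) N}
    (h : IsCylinder F σ ρ) (h' : IsCylinder F σ' ρ') (hσ : σ.Isomorphic σ') :
    ρ.Isomorphic ρ' := by
  obtain ⟨Φ, hm, ho⟩ := isCylinder_iff.1 h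
  obtain ⟨Φ', hm', ho'⟩ := isCylinder_iff.1 h'
  obtain ⟨f, hf1, hf2⟩ := isomorphic_iff.1 hσ
  have hf : IsEtale σ σ' f := ⟨f.contMDiff, hf1, hf2⟩
  refine .of_isEtale (hf.cylinder hm hm' ho ho') (g := fun r => Φ.symm (f.symm (Φ' r).1, (Φ' r).2))
    (Φ.symm.contMDiff.comp ((f.symm.contMDiff.comp (contMDiff_fst.comp Φ'.contMDiff)).prodMk
      (contMDiff_snd.comp Φ'.contMDiff))) (fun x => ?_) (fun y => ?_)
  · simp
  · simp

theorem IsCylinder.neg {σ : GeomChain n M} {ρ : GeomChain (n + 1) N} (h : IsCylinder F σ ρ) :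
    IsCylinder F σ.neg ρ.neg := by
  obtain ⟨Φ, hm, ho⟩ := isCylinder_iff.1 h
  exact isCylinder_iff.2 ⟨Φ, hm, fun r =>
    IsProductOrientation.neg (V := Vec (n + 1)) (W := Vec n) (ho r)⟩

theorem cylinder_sum (F : SmoothHomotopy M N) (σ τ : GeomChain n M) :
    ((cylinder F σ).sum (cylinder F τ)).Isomorphic (cylinder F (σ.sum τ)) := by
  have key : ∀ {σ σ' : GeomChain n M} {j : σ.dom → σ'.dom}, IsEtale σ σ' j →
      IsEtale (cylinder F σ) (cylinder F σ') (cylinderSide j) := fun {σ σ' _} hj =>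
    hj.cylinder (F := F) (ρ := cylinder F σ) (ρ' := cylinder F σ') (Φ := cylinderDiffeo _)
      (Φ' := cylinderDiffeo _) (fun _ => rfl) (fun _ => rfl) (exists_cylinder_orientation _).choose_spec
      (exists_cylinder_orientation _).choose_spec
  let g : cylinderMfd (sumMfd σ.dom τ.dom) → sumMfd (cylinderMfd σ.dom) (cylinderMfd τ.dom) :=
    fun x => Sum.map (fun p => (cylinderDiffeo σ.dom).symm (p, (cylinderDiffeo _ x).2))
      (fun p => (cylinderDiffeo τ.dom).symm (p, (cylinderDiffeo _ x).2)) (cylinderFst x)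
  refine .of_isEtale (σ := (cylinder F σ).sum (cylinder F τ)) (τ := cylinder F (σ.sum τ))
    ((key (IsEtale.inl σ τ)).sumElim (key (IsEtale.inr σ τ)))
    (g := g) (fun x => ?_) (fun x => ?_) (fun x => ?_)
  · have ht : ContMDiff (Q (n + 1)) (𝓡∂ 1) ∞
        fun y : cylinderMfd (sumMfd σ.dom τ.dom) => (cylinderDiffeo _ y).2 :=
      contMDiff_snd.comp (cylinderDiffeo _).contMDiff
    -- Near a point over `p` in `σ` the map `g` agrees with the one in which every point of `τ` is
    -- replaced by `p`, and this one has all its values over `σ`.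
    rcases hx : cylinderFst x with p | p
    · have hc : ContMDiff (Q n) (Q n) ∞ (Sum.elim id fun _ => p : sumMfd σ.dom τ.dom → σ.dom) :=
        contMDiff_id.sumElim contMDiff_const
      have h : ContMDiff (Q (n + 1)) (Q (n + 1)) ∞
          fun y : cylinderMfd (sumMfd σ.dom τ.dom) => (Sum.inl ((cylinderDiffeo σ.dom).symm
            ((Sum.elim id fun _ => p : sumMfd σ.dom τ.dom → σ.dom) (cylinderFst y),
              (cylinderDiffeo _ y).2)) : sumMfd (cylinderMfd σ.dom) (cylinderMfd τ.dom)) :=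
        ContMDiff.inl.comp ((cylinderDiffeo σ.dom).symm.contMDiff.comp
          ((hc.comp contMDiff_cylinderFst).prodMk ht))
      refine (h x).congr_of_eventuallyEq ?_
      have : ∀ᶠ y in 𝓝 x, cylinderFst (P := sumMfd σ.dom τ.dom) y ∈
          range (Sum.inl : σ.dom → σ.dom ⊕ τ.dom) :=
        contMDiff_cylinderFst.continuous.continuousAt.eventually
          (isOpen_range_inl.mem_nhds ⟨p, hx.symm⟩)
      filter_upwards [this] with y ⟨q, hq⟩
      change Sum.map _ _ (cylinderFst y) = _
      rw [← hq]
      rfl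
    · have hc : ContMDiff (Q n) (Q n) ∞ (Sum.elim (fun _ => p) id : sumMfd σ.dom τ.dom → τ.dom) :=
        contMDiff_const.sumElim contMDiff_id
      have h : ContMDiff (Q (n + 1)) (Q (n + 1)) ∞
          fun y : cylinderMfd (sumMfd σ.dom τ.dom) => (Sum.inr ((cylinderDiffeo τ.dom).symm
            ((Sum.elim (fun _ => p) id : sumMfd σ.dom τ.dom → τ.dom) (cylinderFst y),
              (cylinderDiffeo _ y).2)) : sumMfd (cylinderMfd σ.dom) (cylinderMfd τ.dom)) :=
        ContMDiff.inr.comp ((cylinderDiffeo τ.dom).symm.contMDiff.comp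
          ((hc.comp contMDiff_cylinderFst).prodMk ht))
      refine (h x).congr_of_eventuallyEq ?_
      have : ∀ᶠ y in 𝓝 x, cylinderFst (P := sumMfd σ.dom τ.dom) y ∈
          range (Sum.inr : τ.dom → σ.dom ⊕ τ.dom) :=
        contMDiff_cylinderFst.continuous.continuousAt.eventually
          (isOpen_range_inr.mem_nhds ⟨p, hx.symm⟩)
      filter_upwards [this] with y ⟨q, hq⟩
      change Sum.map _ _ (cylinderFst y) = _
      rw [← hq]
      rfl
  · rcases x with x | x <;> rfl
  · rcases hx : cylinderFst x with p | p
    · have : g x = Sum.inl ((cylinderDiffeo σ.dom).symm (p, (cylinderDiffeo _ x).2)) :=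
        congrArg (Sum.map _ _) hx
      refine (congrArg (Sum.elim _ _) this).trans (cylinder_ext hx.symm rfl)
    · have : g x = Sum.inr ((cylinderDiffeo τ.dom).symm (p, (cylinderDiffeo _ x).2)) :=
        congrArg (Sum.map _ _) hx
      refine (congrArg (Sum.elim _ _) this).trans (cylinder_ext hx.symm rfl)

/-- The part of the boundary of `H(σ)` that lies over the ends of `[0,1]`. -/
def homotopyEnds (F : SmoothHomotopy M N) (σ : GeomChain n M) : GeomChain n N :=
  ((σ.push (F.slice 1)).sum (σ.push (F.slice 0)).neg).signPow n

/-- The ends carry opposite orientations of `P`, up to the common sign `(-1)ⁿ`, which comes from moving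
the normal in the direction of `[0,1]` past the `n` directions of `P`. -/
theorem exists_homotopyEnds (F : SmoothHomotopy M N) (σ : GeomChain n M) :
    ∃ o : OrientationField (sumMfd σ.dom σ.dom), ∃ ho : IsOrientationField o,
      homotopyEnds F σ = ⟨sumMfd σ.dom σ.dom, o, ho,
        Sum.elim (σ.push (F.slice 1)).map (σ.push (F.slice 0)).map,
        (σ.push (F.slice 1)).smooth.sumElim (σ.push (F.slice 0)).smooth⟩ ∧
      ∀ O : OrientationField (cylinderMfd σ.dom), (∀ x, IsProductOrientation (tangentFst x)
        (tangentSnd x) (σ.orient (cylinderFst x)) (O x)) →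
        IsBoundaryOrientation (cylinderEnds σ.dom) O o := by
  by_cases hn : Even n
  · refine ⟨sumOrientation σ.orient fun p => -σ.orient p,
      σ.isOrientation.sum σ.isOrientation.neg, ?_, fun O hO => ?_⟩
    · rw [homotopyEnds, signPow, if_pos hn]
      rfl
    · refine isBoundaryOrientation_sumElim (isLocalFaceAt_cylinderEnd (Or.inr rfl))
        (isLocalFaceAt_cylinderEnd (Or.inl rfl))
        (isBoundaryOrientation_cylinderEnd hO (Or.inr rfl) fun p v => ?_)
        (isBoundaryOrientation_cylinderEnd hO (Or.inl rfl) fun p v => ?_)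
      · simp [hn]
      · rw [orientation_eq_neg_iff]
        simp [hn]
  · refine ⟨fun p => -sumOrientation σ.orient (fun p => -σ.orient p) p,
      (σ.isOrientation.sum σ.isOrientation.neg).neg, ?_, fun O hO => ?_⟩
    · rw [homotopyEnds, signPow, if_neg hn]
      rfl
    · have : (fun p => -sumOrientation σ.orient (fun p => -σ.orient p) p :
          OrientationField (sumMfd σ.dom σ.dom)) =
          sumOrientation (fun p => -σ.orient p) fun p => -(-σ.orient p) := by
        funext p
        rcases p with p | p <;> rfl
      rw [this]
      refine isBoundaryOrientation_sumElim (isLocalFaceAt_cylinderEnd (Or.inr rfl))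
        (isLocalFaceAt_cylinderEnd (Or.inl rfl))
        (isBoundaryOrientation_cylinderEnd hO (Or.inr rfl) fun p v => ?_)
        (isBoundaryOrientation_cylinderEnd hO (Or.inl rfl) fun p v => ?_)
      · rw [orientation_eq_neg_iff]
        simp [hn]
      · rw [orientation_neg_neg]
        simp [hn]

theorem cylinder_isBoundary_zero (F : SmoothHomotopy M N) (σ : GeomChain 0 M) :
    (cylinder F σ).IsBoundary (homotopyEnds F σ) := by
  obtain ⟨o, ho, heq, h⟩ := exists_homotopyEnds F σ
  rw [heq]
  refine ⟨cylinderEnds σ.dom, isGeometricBoundary_cylinder_zero σ.dom,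
    h _ (exists_cylinder_orientation σ).choose_spec, ?_⟩
  rintro (p | p) <;> rfl

theorem cylinder_isBoundary_succ (F : SmoothHomotopy M N) {σ : GeomChain (n + 1) M}
    {τ : GeomChain n M} (hτ : σ.IsBoundary τ) :
    (cylinder F σ).IsBoundary ((homotopyEnds F σ).sum (cylinder F τ)) := by
  obtain ⟨o, ho, heq, h⟩ := exists_homotopyEnds F σ
  obtain ⟨ι, hι, hιo, hm⟩ := hτ
  rw [heq]
  have hs := (exists_cylinder_orientation σ).choose_spec
  refine ⟨cylinderFaces ι, isGeometricBoundary_cylinder hι,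
    isBoundaryOrientation_sumElim isLocalFaceAt_cylinderEnds
      (fun y => isLocalFaceAt_cylinderSide (hι.isLocalFaceAt _)) (h _ hs)
      (isBoundaryOrientation_cylinderSide hι.isLocalFaceAt hιo hs
        (exists_cylinder_orientation τ).choose_spec), ?_⟩
  rintro ((p | p) | y)
  · rfl
  · rfl
  · exact congrArg (fun m => F (m, (cylinderDiffeo τ.dom y).2)) (hm (cylinderFst y))

theorem IsCylinder.isBoundary_zero {σ : GeomChain 0 M} {ρ : GeomChain 1 N}
    (h : IsCylinder F σ ρ) : ρ.IsBoundary (homotopyEnds F σ) :=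
  (cylinder_isBoundary_zero F σ).congr_left ((isCylinder_cylinder F σ).isomorphic h (.refl σ))

theorem IsCylinder.isBoundary_succ {σ : GeomChain (n + 1) M} {τ : GeomChain n M}
    {ρ : GeomChain (n + 2) N} {κ : GeomChain (n + 1) N} (hτ : σ.IsBoundary τ)
    (h : IsCylinder F σ ρ) (h' : IsCylinder F τ κ) :
    ρ.IsBoundary ((homotopyEnds F σ).sum κ) :=
  ((cylinder_isBoundary_succ F hτ).congr_left
    ((isCylinder_cylinder F σ).isomorphic h (.refl σ))).congr_right
    ((Isomorphic.refl _).sum (h'.isomorphic (isCylinder_cylinder F τ) (.refl τ)))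

end GeomChain

/-! ### Small images -/

/-- The dimension of the source is raised by taking products with `[0,1]`. -/
theorem exists_raise_dim {M : SmoothMfd.{u}} {k m : ℕ} (hkm : k ≤ m) {T : CornerMfd k} {g : T → M}
    (hg : ContMDiff (Q k) (𝓡 M.dim) ∞ g) : ∃ (T' : CornerMfd m) (g' : T' → M),
      ContMDiff (Q m) (𝓡 M.dim) ∞ g' ∧ range g ⊆ range g' := by
  induction m, hkm using Nat.le_induction with
  | base => exact ⟨T, g, hg, Subset.rfl⟩
  | succ m _ ih =>
    obtain ⟨T', g', hg', h⟩ := ih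
    refine ⟨cylinderMfd T', fun x => g' (cylinderFst x), hg'.comp contMDiff_cylinderFst,
      h.trans ?_⟩
    rintro _ ⟨p, rfl⟩
    exact ⟨(cylinderDiffeo T').symm (p, 0), rfl⟩

namespace GeomChain

variable {n : ℕ} {M N : SmoothMfd.{u}} {σ τ : GeomChain n M}

theorem HasSmallImage.of_isomorphic (h : σ.Isomorphic τ) (hσ : σ.HasSmallImage) :
    τ.HasSmallImage := by
  obtain ⟨f, -, hf⟩ := h
  rcases hσ with hσ | ⟨k, hk, T, g, hg, hr⟩
  · exact Or.inl f.toEquiv.symm.isEmpty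
  · refine Or.inr ⟨k, hk, T, g, hg, ?_⟩
    rintro _ ⟨p, rfl⟩
    refine hr ⟨f.symm p, ?_⟩
    rw [← hf, f.apply_symm_apply]

theorem HasSmallImage.neg (h : σ.HasSmallImage) : σ.neg.HasSmallImage := h

theorem HasSmallImage.push (f : SmoothMap M N) (h : σ.HasSmallImage) :
    (σ.push f).HasSmallImage := by
  rcases h with h | ⟨k, hk, T, g, hg, hr⟩
  · exact Or.inl h
  · refine Or.inr ⟨k, hk, T, fun x => f (g x), f.contMDiff.comp hg, ?_⟩
    rintro _ ⟨p, rfl⟩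
    obtain ⟨x, hx⟩ := hr ⟨p, rfl⟩
    exact ⟨x, congrArg f hx⟩

theorem HasSmallImage.sum (h : σ.HasSmallImage) (h' : τ.HasSmallImage) :
    (σ.sum τ).HasSmallImage := by
  rcases h with h | ⟨k, hk, T, g, hg, hr⟩
  · exact h'.of_isomorphic ((sum_comm σ τ).trans (sum_empty τ h)).symm
  · rcases h' with h' | ⟨k', hk', T', g', hg', hr'⟩
    · exact HasSmallImage.of_isomorphic (sum_empty σ h').symm (Or.inr ⟨k, hk, T, g, hg, hr⟩)
    · obtain ⟨T₁, g₁, hg₁, h₁⟩ := exists_raise_dim (le_max_left k k') hg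
      obtain ⟨T₂, g₂, hg₂, h₂⟩ := exists_raise_dim (le_max_right k k') hg'
      refine Or.inr ⟨_, max_lt hk hk', sumMfd T₁ T₂, Sum.elim g₁ g₂, hg₁.sumElim hg₂, ?_⟩
      rintro _ ⟨p | p, rfl⟩
      · obtain ⟨x, hx⟩ := h₁ (hr ⟨p, rfl⟩)
        exact ⟨Sum.inl x, hx⟩
      · obtain ⟨x, hx⟩ := h₂ (hr' ⟨p, rfl⟩)
        exact ⟨Sum.inr x, hx⟩

theorem HasSmallImage.cylinder (F : SmoothHomotopy M N) (h : σ.HasSmallImage) :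
    (cylinder F σ).HasSmallImage := by
  rcases h with h | ⟨k, hk, T, g, hg, hr⟩
  · exact Or.inl ⟨fun x => h.elim (cylinderFst x)⟩
  · refine Or.inr ⟨k + 1, Nat.succ_lt_succ hk, cylinderMfd T,
      fun x => F (g (cylinderFst x), (cylinderDiffeo T x).2),
      F.contMDiff.comp ((hg.comp contMDiff_cylinderFst).prodMk
        (contMDiff_snd.comp (cylinderDiffeo T).contMDiff)), ?_⟩
    rintro _ ⟨p, rfl⟩
    obtain ⟨x, hx⟩ := hr ⟨cylinderFst p, rfl⟩
    exact ⟨(cylinderDiffeo T).symm (x, (cylinderDiffeo _ p).2),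
      congrArg (fun m => F (m, (cylinderDiffeo _ p).2)) hx⟩

end GeomChain

/-! ### The monoid of chains up to isomorphism -/

/-- Isomorphism of chains, as a setoid. -/
def isoSetoid (n : ℕ) (M : SmoothMfd.{u}) : Setoid (GeomChain n M) :=
  ⟨GeomChain.Isomorphic, .refl, .symm, .trans⟩

/-- Chains up to isomorphism. -/
def IsoClass (n : ℕ) (M : SmoothMfd.{u}) : Type (max 1 u) := Quotient (isoSetoid n M)

namespace IsoClass

open GeomChain

variable {n : ℕ} {M N : SmoothMfd.{u}}

/-- The isomorphism class of a chain. -/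
def mk (σ : GeomChain n M) : IsoClass n M := Quotient.mk (isoSetoid n M) σ

theorem mk_eq {σ τ : GeomChain n M} : mk σ = mk τ ↔ σ.Isomorphic τ :=
  Quotient.eq (r := isoSetoid n M)

theorem exists_mk (x : IsoClass n M) : ∃ σ, mk σ = x := Quotient.exists_rep x

instance : Zero (IsoClass n M) := ⟨mk (empty n M)⟩

instance : Add (IsoClass n M) :=
  ⟨Quotient.map₂ GeomChain.sum fun _ _ h _ _ h' => Isomorphic.sum h h'⟩

theorem mk_sum (σ τ : GeomChain n M) : mk (σ.sum τ) = mk σ + mk τ := rfl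

instance : AddCommMonoid (IsoClass n M) where
  add_assoc x y z := by
    obtain ⟨σ, rfl⟩ := exists_mk x
    obtain ⟨τ, rfl⟩ := exists_mk y
    obtain ⟨υ, rfl⟩ := exists_mk z
    exact mk_eq.2 (sum_assoc σ τ υ)
  add_comm x y := by
    obtain ⟨σ, rfl⟩ := exists_mk x
    obtain ⟨τ, rfl⟩ := exists_mk y
    exact mk_eq.2 (sum_comm σ τ)
  add_zero x := by
    obtain ⟨σ, rfl⟩ := exists_mk x
    exact mk_eq.2 (sum_empty σ inferInstance)
  zero_add x := by
    obtain ⟨σ, rfl⟩ := exists_mk x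
    exact mk_eq.2 ((sum_comm _ _).trans (sum_empty σ inferInstance))
  nsmul := nsmulRec

instance : IsLeftCancelAdd (IsoClass n M) where
  add_left_cancel x y z h := by
    obtain ⟨σ, rfl⟩ := exists_mk x
    obtain ⟨τ, rfl⟩ := exists_mk y
    obtain ⟨υ, rfl⟩ := exists_mk z
    exact mk_eq.2 (mk_eq.1 h).sum_left_cancel

/-- An operation on chains that respects isomorphism and disjoint unions. -/
def lift {m : ℕ} (Φ : GeomChain n M → GeomChain m N)
    (h : ∀ {σ τ}, σ.Isomorphic τ → (Φ σ).Isomorphic (Φ τ))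
    (hs : ∀ σ τ, (Φ (σ.sum τ)).Isomorphic ((Φ σ).sum (Φ τ))) : IsoClass n M →+ IsoClass m N :=
  let Ψ : IsoClass n M → IsoClass m N := Quotient.map Φ fun _ _ => h
  have hadd : ∀ x y, Ψ (x + y) = Ψ x + Ψ y := by
    intro x y
    obtain ⟨σ, rfl⟩ := exists_mk x
    obtain ⟨τ, rfl⟩ := exists_mk y
    exact mk_eq.2 (hs σ τ)
  { toFun := Ψ
    map_zero' := by
      have := hadd 0 0
      rw [add_zero] at this
      exact add_left_cancel (this.symm.trans (add_zero _).symm)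
    map_add' := hadd }

/-- Reversal of the orientation. -/
def neg : IsoClass n M →+ IsoClass n M := lift GeomChain.neg Isomorphic.neg neg_sum

/-- The boundary. -/
def bd : IsoClass (n + 1) M →+ IsoClass n M :=
  lift (fun σ => (exists_isBoundary σ).choose)
    (fun {σ τ} h => ((exists_isBoundary σ).choose_spec.congr_left h).isomorphic
      (exists_isBoundary τ).choose_spec)
    (fun σ τ => (exists_isBoundary (σ.sum τ)).choose_spec.isomorphic
      ((exists_isBoundary σ).choose_spec.sum (exists_isBoundary τ).choose_spec))

/-- Composition with a smooth map. -/
def push (f : SmoothMap M N) : IsoClass n M →+ IsoClass n N :=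
  lift (GeomChain.push f) (Isomorphic.push f) (push_sum f)

/-- The operation `H`. -/
def cyl (F : SmoothHomotopy M N) : IsoClass n M →+ IsoClass (n + 1) N :=
  lift (cylinder F) (fun h => (isCylinder_cylinder F _).isomorphic (isCylinder_cylinder F _) h)
    (fun σ τ => (cylinder_sum F σ τ).symm)

theorem neg_mk (σ : GeomChain n M) : neg (mk σ) = mk σ.neg := rfl

theorem bd_mk {σ : GeomChain (n + 1) M} {τ : GeomChain n M} :
    bd (mk σ) = mk τ ↔ σ.IsBoundary τ := by
  have h := (exists_isBoundary σ).choose_spec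
  change mk _ = mk τ ↔ _
  rw [mk_eq]
  exact ⟨fun h' => h.congr_right h'.symm, fun h' => h.isomorphic h'⟩

theorem cyl_mk {F : SmoothHomotopy M N} {σ : GeomChain n M} {ρ : GeomChain (n + 1) N}
    (h : IsCylinder F σ ρ) : cyl F (mk σ) = mk ρ :=
  mk_eq.2 ((isCylinder_cylinder F σ).isomorphic h (.refl σ))

theorem neg_neg (x : IsoClass n M) : neg (neg x) = x := by
  obtain ⟨σ, rfl⟩ := exists_mk x
  exact mk_eq.2 (GeomChain.neg_neg σ)

theorem bd_neg (x : IsoClass (n + 1) M) : bd (neg x) = neg (bd x) := by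
  obtain ⟨σ, rfl⟩ := exists_mk x
  obtain ⟨τ, h⟩ := exists_isBoundary σ
  rw [bd_mk.2 h]
  exact bd_mk.2 h.neg

theorem bd_push (f : SmoothMap M N) (x : IsoClass (n + 1) M) : bd (push f x) = push f (bd x) := by
  obtain ⟨σ, rfl⟩ := exists_mk x
  obtain ⟨τ, h⟩ := exists_isBoundary σ
  rw [bd_mk.2 h]
  exact bd_mk.2 (h.push f)

theorem neg_bd_bd (x : IsoClass (n + 2) M) : neg (bd (bd x)) = bd (bd x) := by
  obtain ⟨σ, rfl⟩ := exists_mk x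
  obtain ⟨τ, h⟩ := exists_isBoundary σ
  obtain ⟨υ, h'⟩ := exists_isBoundary τ
  rw [bd_mk.2 h, bd_mk.2 h', neg_mk]
  exact mk_eq.2 (isTrivial_iff.1 (h.isTrivial h')).symm

theorem push_neg (f : SmoothMap M N) (x : IsoClass n M) : push f (neg x) = neg (push f x) := by
  obtain ⟨σ, rfl⟩ := exists_mk x
  rfl

theorem cyl_neg (F : SmoothHomotopy M N) (x : IsoClass n M) : cyl F (neg x) = neg (cyl F x) := by
  obtain ⟨σ, rfl⟩ := exists_mk x
  rw [neg_mk, cyl_mk (isCylinder_cylinder F σ).neg, cyl_mk (isCylinder_cylinder F σ), neg_mk]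

/-- The sign `(-1)ᵏ`. -/
def sign (k : ℕ) (x : IsoClass n M) : IsoClass n M := if Even k then x else neg x

theorem mk_homotopyEnds (F : SmoothHomotopy M N) (σ : GeomChain n M) : mk (homotopyEnds F σ) =
    sign n (push (F.slice 1) (mk σ) + neg (push (F.slice 0) (mk σ))) := by
  unfold homotopyEnds sign signPow
  split_ifs <;> rfl

theorem bd_cyl_zero (F : SmoothHomotopy M N) (x : IsoClass 0 M) : bd (cyl F x) =
    sign 0 (push (F.slice 1) x + neg (push (F.slice 0) x)) := by
  obtain ⟨σ, rfl⟩ := exists_mk x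
  rw [← mk_homotopyEnds]
  exact bd_mk.2 (cylinder_isBoundary_zero F σ)

theorem bd_cyl_succ (F : SmoothHomotopy M N) (x : IsoClass (n + 1) M) : bd (cyl F x) =
    sign (n + 1) (push (F.slice 1) x + neg (push (F.slice 0) x)) + cyl F (bd x) := by
  obtain ⟨σ, rfl⟩ := exists_mk x
  obtain ⟨τ, h⟩ := exists_isBoundary σ
  rw [← mk_homotopyEnds, bd_mk.2 h, cyl_mk (isCylinder_cylinder F τ), ← mk_sum]
  exact bd_mk.2 (cylinder_isBoundary_succ F h)

/-- The class of a chain with small image. -/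
def Small (x : IsoClass n M) : Prop := ∃ σ, mk σ = x ∧ σ.HasSmallImage

theorem small_mk {σ : GeomChain n M} : Small (mk σ) ↔ σ.HasSmallImage :=
  ⟨fun ⟨_, h, hs⟩ => hs.of_isomorphic (mk_eq.1 h), fun h => ⟨σ, rfl, h⟩⟩

theorem small_zero : Small (0 : IsoClass n M) :=
  ⟨empty n M, rfl, Or.inl inferInstance⟩

theorem Small.add {x y : IsoClass n M} : Small x → Small y → Small (x + y) := by
  rintro ⟨σ, rfl, h⟩ ⟨τ, rfl, h'⟩
  exact ⟨_, rfl, h.sum h'⟩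

theorem Small.neg {x : IsoClass n M} : Small x → Small (neg x) := by
  rintro ⟨σ, rfl, h⟩
  exact ⟨_, rfl, h.neg⟩

theorem Small.push (f : SmoothMap M N) {x : IsoClass n M} : Small x → Small (push f x) := by
  rintro ⟨σ, rfl, h⟩
  exact ⟨_, rfl, h.push f⟩

theorem Small.cyl (F : SmoothHomotopy M N) {x : IsoClass n M} : Small x → Small (cyl F x) := by
  rintro ⟨σ, rfl, h⟩
  exact ⟨_, rfl, h.cylinder F⟩

theorem Small.sign {x : IsoClass n M} (k : ℕ) (h : Small x) : Small (sign k x) := by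
  unfold IsoClass.sign
  split_ifs
  exacts [h, h.neg]

/-- The class of a degenerate chain. -/
def Deg : {n : ℕ} → IsoClass n M → Prop
  | 0, x => Small x
  | _ + 1, x => Small x ∧ ∃ a b, neg a = a ∧ Small b ∧ bd x = a + b

/-- The class of a chain in `Q(M)`. -/
def Null (x : IsoClass n M) : Prop := ∃ a b, neg a = a ∧ Deg b ∧ x = a + b

theorem neg_mk_eq {σ : GeomChain n M} : neg (mk σ) = mk σ ↔ σ.IsTrivial := by
  rw [isTrivial_iff, neg_mk, mk_eq]
  exact ⟨.symm, .symm⟩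

theorem deg_mk {n : ℕ} {σ : GeomChain n M} (h : σ.IsDegenerate) : Deg (mk σ) := by
  cases n with
  | zero => exact small_mk.2 h
  | succ n =>
    obtain ⟨h1, α, β, h2, h3, h4⟩ := h
    exact ⟨small_mk.2 h1, mk α, mk β, neg_mk_eq.2 h2, small_mk.2 h3, bd_mk.2 h4⟩

theorem isDegenerate_of_deg_mk {n : ℕ} {σ : GeomChain n M} (h : Deg (mk σ)) :
    σ.IsDegenerate := by
  cases n with
  | zero => exact small_mk.1 h
  | succ n =>
    obtain ⟨h1, a, b, h2, h3, h4⟩ := h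
    obtain ⟨α, rfl⟩ := exists_mk a
    obtain ⟨β, rfl⟩ := exists_mk b
    exact ⟨small_mk.1 h1, α, β, neg_mk_eq.1 h2, small_mk.1 h3, bd_mk.1 h4⟩

theorem null_mk {σ : GeomChain n M} : Null (mk σ) ↔ σ.IsNull := by
  constructor
  · rintro ⟨a, b, h1, h2, h3⟩
    obtain ⟨α, rfl⟩ := exists_mk a
    obtain ⟨β, rfl⟩ := exists_mk b
    exact ⟨α, β, neg_mk_eq.1 h1, isDegenerate_of_deg_mk h2, mk_eq.1 h3⟩
  · rintro ⟨α, β, h1, h2, h3⟩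
    exact ⟨mk α, mk β, neg_mk_eq.2 h1, deg_mk h2, mk_eq.2 h3⟩

theorem Deg.small {n : ℕ} {x : IsoClass n M} (h : Deg x) : Small x := by
  cases n with
  | zero => exact h
  | succ n => exact h.1

theorem deg_zero : ∀ {n : ℕ}, Deg (0 : IsoClass n M)
  | 0 => small_zero
  | _ + 1 => ⟨small_zero, 0, 0, map_zero _, small_zero, by rw [map_zero, add_zero]⟩

theorem Deg.add {n : ℕ} {x y : IsoClass n M} (hx : Deg x) (hy : Deg y) : Deg (x + y) := by
  cases n with
  | zero => exact Small.add hx hy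
  | succ n =>
    obtain ⟨h1, a, b, h2, h3, h4⟩ := hx
    obtain ⟨h1', a', b', h2', h3', h4'⟩ := hy
    exact ⟨h1.add h1', a + a', b + b', by rw [map_add, h2, h2'], h3.add h3', by
      rw [map_add, h4, h4', add_add_add_comm]⟩

theorem Deg.neg {n : ℕ} {x : IsoClass n M} (hx : Deg x) : Deg (IsoClass.neg x) := by
  cases n with
  | zero => exact Small.neg hx
  | succ n =>
    obtain ⟨h1, a, b, h2, h3, h4⟩ := hx
    exact ⟨h1.neg, a, IsoClass.neg b, h2, h3.neg, by rw [bd_neg, h4, map_add, h2]⟩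

theorem Deg.push (f : SmoothMap M N) {n : ℕ} {x : IsoClass n M} (hx : Deg x) :
    Deg (IsoClass.push f x) := by
  cases n with
  | zero => exact Small.push f hx
  | succ n =>
    obtain ⟨h1, a, b, h2, h3, h4⟩ := hx
    exact ⟨h1.push f, IsoClass.push f a, IsoClass.push f b, by rw [← push_neg, h2], h3.push f, by
      rw [bd_push, h4, map_add]⟩

/-- If `∂b = a' + b'` with `a'` trivial and `b'` of small image, then `H(a')` is the trivial part of
`∂H(b)`, while the ends of `H(b)` and `H(b')` have small image. -/
theorem Deg.cyl (F : SmoothHomotopy M N) {n : ℕ} {x : IsoClass n M} (hx : Deg x) :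
    Deg (IsoClass.cyl F x) := by
  have hs := hx.small
  have he := Small.sign n ((hs.push (F.slice 1)).add (hs.push (F.slice 0)).neg)
  cases n with
  | zero => exact ⟨hs.cyl F, 0, _, map_zero _, he, by rw [bd_cyl_zero, zero_add]⟩
  | succ n =>
    obtain ⟨h1, a, b, h2, h3, h4⟩ := hx
    refine ⟨hs.cyl F, IsoClass.cyl F a, _, by rw [← cyl_neg, h2], he.add (h3.cyl F), ?_⟩
    rw [bd_cyl_succ, h4, map_add, add_left_comm]

theorem Null.of_neg_eq {x : IsoClass n M} (h : IsoClass.neg x = x) : Null x :=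
  ⟨x, 0, h, deg_zero, (add_zero x).symm⟩

theorem Null.add {x y : IsoClass n M} : Null x → Null y → Null (x + y) := by
  rintro ⟨a, b, h1, h2, rfl⟩ ⟨a', b', h1', h2', rfl⟩
  exact ⟨a + a', b + b', by rw [map_add, h1, h1'], h2.add h2', add_add_add_comm _ _ _ _⟩

theorem Null.neg {x : IsoClass n M} : Null x → Null (neg x) := by
  rintro ⟨a, b, h1, h2, rfl⟩
  exact ⟨a, _, h1, h2.neg, by rw [map_add, h1]⟩

theorem null_add_neg (x : IsoClass n M) : Null (x + neg x) :=
  .of_neg_eq (by rw [map_add, neg_neg, add_comm])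

theorem Null.push (f : SmoothMap M N) {x : IsoClass n M} : Null x → Null (push f x) := by
  rintro ⟨a, b, h1, h2, rfl⟩
  exact ⟨_, _, by rw [← push_neg, h1], h2.push f, map_add _ _ _⟩

theorem Null.cyl (F : SmoothHomotopy M N) {x : IsoClass n M} : Null x → Null (cyl F x) := by
  rintro ⟨a, b, h1, h2, rfl⟩
  exact ⟨_, _, by rw [← cyl_neg, h1], h2.cyl F, map_add _ _ _⟩

/-- If `∂b = a' + b'` with `a'` trivial, then `∂b'` is trivial because `∂∂b` and `∂a'` are and
because disjoint unions can be cancelled. -/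
theorem Null.bd {x : IsoClass (n + 1) M} : Null x → Null (bd x) := by
  rintro ⟨a, b, h1, ⟨-, a', b', h2, h3, h4⟩, rfl⟩
  refine ⟨IsoClass.bd a + a', b', by rw [map_add, ← bd_neg, h1, h2], ?_, by
    rw [map_add, h4, add_assoc]⟩
  cases n with
  | zero => exact h3
  | succ n =>
    refine ⟨h3, IsoClass.bd b', 0, ?_, small_zero, (add_zero _).symm⟩
    have := neg_bd_bd b
    rw [h4, map_add, map_add, ← bd_neg, h2] at this
    exact add_left_cancel this

end IsoClass

/-! ### The chain complex -/

section ChainClass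

open GeomChain

variable {n : ℕ} {M N : SmoothMfd.{u}}

/-- The class in `Cₙ(M)` of an isomorphism class of chains. -/
def IsoClass.cls (x : IsoClass n M) : GeomChainClass n M :=
  Quotient.lift GeomChain.cls (fun σ τ h => Quot.sound <| IsoClass.null_mk.1 <| by
    rw [IsoClass.mk_sum, IsoClass.mk_eq.2 h, ← IsoClass.neg_mk]
    exact IsoClass.null_add_neg _) x

namespace GeomChainClass

theorem exists_cls (c : GeomChainClass n M) : ∃ x : IsoClass n M, x.cls = c := by
  obtain ⟨σ, rfl⟩ := Quot.exists_rep c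
  exact ⟨IsoClass.mk σ, rfl⟩

theorem cls_eq {x y : IsoClass n M} (h : IsoClass.Null (x + IsoClass.neg y)) : x.cls = y.cls := by
  obtain ⟨σ, rfl⟩ := IsoClass.exists_mk x
  obtain ⟨τ, rfl⟩ := IsoClass.exists_mk y
  exact Quot.sound (IsoClass.null_mk.1 h)

/-- Functions on `Cₙ(M)` from functions on isomorphism classes of chains. -/
def lift {α : Type*} (f : IsoClass n M → α)
    (h : ∀ x y, IsoClass.Null (x + IsoClass.neg y) → f x = f y) (c : GeomChainClass n M) : α :=
  Quot.lift (fun σ => f (IsoClass.mk σ)) (fun _ _ hr => h _ _ (IsoClass.null_mk.2 hr)) c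

theorem lift_cls {α : Type*} (f : IsoClass n M → α)
    (h : ∀ x y, IsoClass.Null (x + IsoClass.neg y) → f x = f y) (x : IsoClass n M) :
    lift f h x.cls = f x := by
  obtain ⟨σ, rfl⟩ := IsoClass.exists_mk x
  rfl

instance : Zero (GeomChainClass n M) := ⟨IsoClass.cls 0⟩

instance : Neg (GeomChainClass n M) :=
  ⟨lift (fun x => (IsoClass.neg x).cls) fun x y h => cls_eq <| by
    rw [← map_add]
    exact h.neg⟩

instance : Add (GeomChainClass n M) :=
  ⟨lift (fun x => lift (fun y => (x + y).cls) fun y y' h => cls_eq <| by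
      have := (IsoClass.null_add_neg x).add h
      rwa [add_add_add_comm, ← map_add] at this)
    fun x x' h => funext fun c => by
      obtain ⟨y, rfl⟩ := exists_cls c
      rw [lift_cls, lift_cls]
      refine cls_eq ?_
      have := h.add (IsoClass.null_add_neg y)
      rwa [add_add_add_comm, ← map_add] at this⟩

theorem cls_add (x y : IsoClass n M) : (x + y).cls = x.cls + y.cls := by
  obtain ⟨σ, rfl⟩ := IsoClass.exists_mk x
  obtain ⟨τ, rfl⟩ := IsoClass.exists_mk y
  rfl

theorem cls_neg (x : IsoClass n M) : (IsoClass.neg x).cls = -x.cls := by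
  change _ = lift _ _ x.cls
  rw [lift_cls]

instance : AddCommGroup (GeomChainClass n M) where
  add_assoc a b c := by
    obtain ⟨x, rfl⟩ := exists_cls a
    obtain ⟨y, rfl⟩ := exists_cls b
    obtain ⟨z, rfl⟩ := exists_cls c
    simp only [← cls_add, add_assoc]
  add_comm a b := by
    obtain ⟨x, rfl⟩ := exists_cls a
    obtain ⟨y, rfl⟩ := exists_cls b
    simp only [← cls_add, add_comm]
  add_zero a := by
    obtain ⟨x, rfl⟩ := exists_cls a
    exact (cls_add x 0).symm.trans (congrArg _ (add_zero x))
  zero_add a := by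
    obtain ⟨x, rfl⟩ := exists_cls a
    exact (cls_add 0 x).symm.trans (congrArg _ (zero_add x))
  neg_add_cancel a := by
    obtain ⟨x, rfl⟩ := exists_cls a
    rw [← cls_neg, ← cls_add, add_comm]
    refine cls_eq (y := 0) ?_
    rw [map_zero, add_zero]
    exact IsoClass.null_add_neg x
  nsmul := nsmulRec
  zsmul := zsmulRec

theorem cls_eq_zero {x : IsoClass n M} (h : x.Null) : x.cls = 0 :=
  cls_eq (y := 0) (by rwa [map_zero, add_zero])

/-- The homomorphism of groups of chains induced by an additive operation on isomorphism classes
of chains that preserves the null chains. -/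
def map {m : ℕ} (f : IsoClass n M →+ IsoClass m N) (h : ∀ {x}, x.Null → (f x).Null) :
    GeomChainClass n M →+ GeomChainClass m N where
  toFun := lift (fun x => (f x).cls) fun x y hxy => by
    have h1 := cls_eq_zero (h hxy)
    have h2 := cls_eq_zero (h (IsoClass.null_add_neg y))
    rw [map_add, cls_add] at h1 h2
    exact add_right_cancel (h1.trans h2.symm)
  map_zero' := (lift_cls _ _ 0).trans (congrArg _ (map_zero f))
  map_add' a b := by
    obtain ⟨x, rfl⟩ := exists_cls a
    obtain ⟨y, rfl⟩ := exists_cls b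
    rw [← cls_add, lift_cls, lift_cls, lift_cls, map_add, cls_add]

theorem map_cls {m : ℕ} (f : IsoClass n M →+ IsoClass m N) (h : ∀ {x}, x.Null → (f x).Null)
    (x : IsoClass n M) : map f h x.cls = (f x).cls := by
  obtain ⟨σ, rfl⟩ := IsoClass.exists_mk x
  rfl

/-- The differential of the complex of chains. -/
def d : GeomChainClass (n + 1) M →+ GeomChainClass n M := map IsoClass.bd IsoClass.Null.bd

/-- The homomorphism induced by a smooth map. -/
def push (f : SmoothMap M N) : GeomChainClass n M →+ GeomChainClass n N :=
  map (IsoClass.push f) (IsoClass.Null.push f)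

/-- The homomorphism induced by the operation `H`. -/
def cyl (F : SmoothHomotopy M N) : GeomChainClass n M →+ GeomChainClass (n + 1) N :=
  map (IsoClass.cyl F) (IsoClass.Null.cyl F)

theorem d_d (c : GeomChainClass (n + 2) M) : d (d c) = 0 := by
  obtain ⟨x, rfl⟩ := exists_cls c
  rw [d, d, map_cls, map_cls]
  exact cls_eq_zero (.of_neg_eq (IsoClass.neg_bd_bd x))

theorem push_id (c : GeomChainClass n M) : push (𝟙 M : M ⟶ M) c = c := by
  obtain ⟨x, rfl⟩ := exists_cls c
  obtain ⟨σ, rfl⟩ := IsoClass.exists_mk x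
  rfl

theorem push_comp {L : SmoothMfd.{u}} (f : M ⟶ N) (g : N ⟶ L) (c : GeomChainClass n M) :
    push (f ≫ g) c = push g (push f c) := by
  obtain ⟨x, rfl⟩ := exists_cls c
  obtain ⟨σ, rfl⟩ := IsoClass.exists_mk x
  rfl

theorem d_push (f : SmoothMap M N) (c : GeomChainClass (n + 1) M) :
    d (push f c) = push f (d c) := by
  obtain ⟨x, rfl⟩ := exists_cls c
  simp only [d, push, map_cls, IsoClass.bd_push]

theorem cls_sign (k : ℕ) (x : IsoClass n M) : (x.sign k).cls = (-1 : ℤ) ^ k • x.cls := by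
  unfold IsoClass.sign
  split_ifs with h
  · rw [h.neg_one_pow, one_smul]
  · rw [(Nat.not_even_iff_odd.1 h).neg_one_pow, neg_smul, one_smul, cls_neg]

theorem cls_sign_ends (F : SmoothHomotopy M N) (k : ℕ) (x : IsoClass n M) :
    (IsoClass.sign k (IsoClass.push (F.slice 1) x + IsoClass.neg (IsoClass.push (F.slice 0) x))).cls
      = (-1 : ℤ) ^ k • (push (F.slice 1) x.cls - push (F.slice 0) x.cls) := by
  rw [cls_sign, cls_add, cls_neg, push, push, map_cls, map_cls, sub_eq_add_neg]

theorem d_cyl_zero (F : SmoothHomotopy M N) (c : GeomChainClass 0 M) :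
    d (cyl F c) = push (F.slice 1) c - push (F.slice 0) c := by
  obtain ⟨x, rfl⟩ := exists_cls c
  rw [d, cyl, map_cls, map_cls, IsoClass.bd_cyl_zero, cls_sign_ends, pow_zero, one_smul]

theorem d_cyl_succ (F : SmoothHomotopy M N) (c : GeomChainClass (n + 1) M) :
    d (cyl F c) = (-1 : ℤ) ^ (n + 1) • (push (F.slice 1) c - push (F.slice 0) c) +
      cyl F (d c) := by
  obtain ⟨x, rfl⟩ := exists_cls c
  rw [d, cyl, map_cls, map_cls, IsoClass.bd_cyl_succ, cls_add, cls_sign_ends, d, map_cls, cyl,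
    map_cls]

theorem push_eq_zero (F : SmoothHomotopy M N) (c : GeomChainClass 0 M) :
    push (F.slice 1) c = d ((-1 : ℤ) ^ 0 • cyl F c) + push (F.slice 0) c := by
  rw [pow_zero, one_smul, d_cyl_zero, sub_add_cancel]

theorem push_eq_succ (F : SmoothHomotopy M N) (c : GeomChainClass (n + 1) M) :
    push (F.slice 1) c = (-1 : ℤ) ^ n • cyl F (d c) + d ((-1 : ℤ) ^ (n + 1) • cyl F c) +
      push (F.slice 0) c := by
  have h : (-1 : ℤ) ^ (n + 1) * (-1) ^ (n + 1) = 1 := by rw [← mul_pow]; simp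
  rw [map_zsmul, d_cyl_succ, smul_add, smul_smul, h, one_smul, pow_succ]
  simp only [mul_neg, mul_one, neg_smul]
  abel

end GeomChainClass

/-- The complex `C_*(M)`. -/
def chainComplex (M : SmoothMfd.{u}) : ChainComplex AddCommGrpCat.{max 1 u} ℕ :=
  ChainComplex.of (fun n => AddCommGrpCat.of (GeomChainClass n M))
    (fun _ => AddCommGrpCat.ofHom GeomChainClass.d)
    (fun _ => AddCommGrpCat.ext GeomChainClass.d_d)

theorem chainComplex_d (M : SmoothMfd.{u}) (n : ℕ) :
    (chainComplex M).d (n + 1) n = AddCommGrpCat.ofHom GeomChainClass.d :=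
  ChainComplex.of_d (fun n => AddCommGrpCat.of (GeomChainClass n M))
    (fun _ => AddCommGrpCat.ofHom GeomChainClass.d) n

/-- The chain map induced by a smooth map. -/
def chainMap (f : M ⟶ N) : chainComplex M ⟶ chainComplex N :=
  ChainComplex.ofHom (fun _ => AddCommGrpCat.ofHom (GeomChainClass.push f)) fun n => by
    rw [chainComplex_d, chainComplex_d]
    exact AddCommGrpCat.ext (GeomChainClass.d_push f)

/-- The functor `M ↦ C_*(M)`. -/
def chainFunctor : SmoothMfd.{u} ⥤ ChainComplex AddCommGrpCat.{max 1 u} ℕ where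
  obj M := chainComplex M
  map f := chainMap f
  map_id _ := HomologicalComplex.hom_ext _ _ fun _ => AddCommGrpCat.ext GeomChainClass.push_id
  map_comp f g := HomologicalComplex.hom_ext _ _ fun _ =>
    AddCommGrpCat.ext (GeomChainClass.push_comp f g)

/-- The homomorphism `(-1)ⁿ H`. -/
def homotopyHom (F : SmoothHomotopy M N) (n : ℕ) :
    (chainComplex M).X n ⟶ (chainComplex N).X (n + 1) :=
  AddCommGrpCat.ofHom ((-1 : ℤ) ^ n • (GeomChainClass.cyl F : GeomChainClass n M →+ _))

/-- The homomorphisms `(-1)ⁿ H` form a chain homotopy. -/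
def chainHomotopy (F : SmoothHomotopy M N) :
    Homotopy (chainMap (F.slice 1)) (chainMap (F.slice 0)) where
  hom i j := if h : i + 1 = j then
    homotopyHom F i ≫ eqToHom (congrArg (chainComplex N).X h) else 0
  zero _ _ h := dif_neg h
  comm i := by
    cases i with
    | zero =>
      rw [Homotopy.dNext_zero_chainComplex, Homotopy.prevD_chainComplex, dif_pos rfl,
        chainComplex_d, eqToHom_refl, Category.comp_id, zero_add]
      exact AddCommGrpCat.ext (GeomChainClass.push_eq_zero F)
    | succ n =>
      rw [Homotopy.dNext_succ_chainComplex, Homotopy.prevD_chainComplex, dif_pos rfl, dif_pos rfl,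
        chainComplex_d, chainComplex_d, eqToHom_refl, eqToHom_refl, Category.comp_id,
        Category.comp_id]
      exact AddCommGrpCat.ext (GeomChainClass.push_eq_succ F)

theorem chainHomotopy_hom (F : SmoothHomotopy M N) (n : ℕ) :
    (chainHomotopy F).hom n (n + 1) = homotopyHom F n :=
  (dif_pos rfl).trans (Category.comp_id _)

end ChainClass

end GeomHomology

end

theorem mainTheorem9 :
    -- every chain of positive dimension has a boundary, unique up to isomorphism of chains
    (∀ (M : SmoothMfd.{u}) (n : ℕ) (σ : GeomChain (n + 1) M), ∃ τ : GeomChain n M,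
      σ.IsBoundary τ ∧ ∀ τ' : GeomChain n M, σ.IsBoundary τ' → τ.Isomorphic τ') ∧
    -- the chain `H(σ) = F ∘ (σ × id)` exists for every homotopy `F` and every chain `σ`
    (∀ (M N : SmoothMfd.{u}) (F : SmoothHomotopy M N) (n : ℕ) (σ : GeomChain n M),
      ∃ ρ : GeomChain (n + 1) N, GeomChain.IsCylinder F σ ρ) ∧
    -- the boundary formula `∂H(σ) = (-1)ⁿ (F₁σ - F₀σ) + H(∂σ)`
    (∀ (M N : SmoothMfd.{u}) (F : SmoothHomotopy M N),
      (∀ (σ : GeomChain 0 M) (ρ : GeomChain 1 N), GeomChain.IsCylinder F σ ρ →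
        ρ.IsBoundary ((σ.push (F.slice 1)).sum (σ.push (F.slice 0)).neg)) ∧
      (∀ (n : ℕ) (σ : GeomChain (n + 1) M) (τ : GeomChain n M)
        (ρ : GeomChain (n + 2) N) (κ : GeomChain (n + 1) N),
        σ.IsBoundary τ → GeomChain.IsCylinder F σ ρ → GeomChain.IsCylinder F τ κ →
        ρ.IsBoundary
          ((((σ.push (F.slice 1)).sum (σ.push (F.slice 0)).neg).signPow (n + 1)).sum κ))) ∧
    -- the functor `M ↦ C_*(M)` to chain complexes, in degree `n` the set `Cₙ(M)` of classes of chains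
    ∃ (C : SmoothMfd.{u} ⥤ ChainComplex AddCommGrpCat.{max 1 u} ℕ)
      (ε : ∀ (M : SmoothMfd.{u}) (n : ℕ), GeomChainClass n M ≃ (C.obj M).X n),
      -- addition is disjoint union
      (∀ (M : SmoothMfd.{u}) (n : ℕ) (σ τ : GeomChain n M),
        ε M n (σ.sum τ).cls = ε M n σ.cls + ε M n τ.cls) ∧
      -- the differential is the geometric boundary
      (∀ (M : SmoothMfd.{u}) (n : ℕ) (σ : GeomChain (n + 1) M) (τ : GeomChain n M),
        σ.IsBoundary τ → (C.obj M).d (n + 1) n (ε M (n + 1) σ.cls) = ε M n τ.cls) ∧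
      -- the chain map induced by `f` is composition with `f`
      (∀ (M N : SmoothMfd.{u}) (f : M ⟶ N) (n : ℕ) (σ : GeomChain n M),
        (C.map f).f n (ε M n σ.cls) = ε N n (σ.push f).cls) ∧
      -- the two ends of a smooth homotopy are chain homotopic through `σ ↦ (-1)ⁿ H(σ)`
      (∀ (M N : SmoothMfd.{u}) (F : SmoothHomotopy M N),
        ∃ h : Homotopy (C.map (F.slice 1)) (C.map (F.slice 0)),
          ∀ (n : ℕ) (σ : GeomChain n M) (ρ : GeomChain (n + 1) N), GeomChain.IsCylinder F σ ρ →
            h.hom n (n + 1) (ε M n σ.cls) = (-1 : ℤ) ^ n • ε N (n + 1) ρ.cls) := by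
  refine ⟨fun M n σ => ?_, fun M N F n σ => ⟨_, GeomChain.isCylinder_cylinder F σ⟩,
    fun M N F => ⟨fun σ ρ h => ?_, fun n σ τ ρ κ hτ h h' => h.isBoundary_succ hτ h'⟩,
    chainFunctor, fun M n => Equiv.refl _, fun M n σ τ => ?_, fun M n σ τ h => ?_,
    fun M N f n σ => rfl, fun M N F => ⟨chainHomotopy F, fun n σ ρ h => ?_⟩⟩
  · obtain ⟨τ, h⟩ := GeomChain.exists_isBoundary σ
    exact ⟨τ, h, fun τ' h' => h.isomorphic h'⟩
  · have := h.isBoundary_zero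
    rwa [GeomChain.homotopyEnds, GeomChain.signPow, if_pos Even.zero] at this
  · rfl
  · change (chainComplex M).d (n + 1) n σ.cls = τ.cls
    rw [chainComplex_d]
    exact congrArg IsoClass.cls (IsoClass.bd_mk.2 h)
  · change (chainHomotopy F).hom n (n + 1) σ.cls = _
    rw [chainHomotopy_hom]
    exact congrArg (fun c => (-1 : ℤ) ^ n • c) (congrArg IsoClass.cls (IsoClass.cyl_mk h))
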